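/- Let $d\ge 1$, let $\mathcal X\subset\mathbb R^d$, and let $P,Q$ be probability measures with $P(\mathcal X)=Q(\mathcal X)=1$. Let $\kappa(x,\mathrm dy)$ be a Markov kernel from $\mathbb R^d$ to $\mathbb R$ (the common conditional law of the label given the covariate), and let $h:\mathbb R^d\times\mathbb R\to\mathbb R$ be measurable and integrable under $P(\mathrm dx)\kappa(x,\mathrm dy)$. Put $\Delta(x,u):=\int h(x,y)\,\kappa(u,\mathrm dy)$, $g(x):=\Delta(x,x)$ and $e(h):=\iint h(x,y)\,\kappa(x,\mathrm dy)\,Q(\mathrm dx)$. Write $B(x,r)$ for the closed Euclidean ball, $|\cdot|$ for Lebesgue measure, $\delta(x)$ for the distance from $x$ to $\mathbb R^d\setminus\mathcal X$, and $\operatorname{co}(\mathcal X)$ for the convex hull. Assume: - (X1) $\mathcal X$ is compact; - (X2) there is $c>0$ with $|B(x,r)\cap\mathcal X|\ge c\,|B(x,r)|$ for all $x\in\mathcal X$ and $0\le r\le\operatorname{diam}(\mathcal X)$; - (X3) $P$ and $Q$ have Lebesgue densities $p,q$, and there are $\underline p,\overline q>0$ with $p\ge\underline p$ and $q\le\overline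 q$ on $\mathcal X$; - (X4) $g$ is Lipschitz on $\mathcal X$; - (X5) $p$ is Lipschitz on $\mathcal X$; - (A) $\sup_{L>0}L^{1/d}\int_{\mathcal X}\exp(-L\,\delta(x)^d)\,\mathrm dQ(x)<\infty$. For $1\le k\le n$ and $m\ge1$, let $(X_i,Y_i)_{1\le i\le n}$ be i.i.d. with law $P(\mathrm dx)\kappa(x,\mathrm dy)$, and let $X^*_1,\dots,X^*_m$ be i.i.d. with law $Q$, independent of $(X_i,Y_i)_i$. Let $\hat\tau_k(x)$ be the $k$-th order statistic of $(\|X_i-x\|)_{1\le i\le n}$. Let $\hat Y^*_1,\dots,\hat Y^*_m$ be random variables such that, for each $j$, the conditional law of $\hat Y_j^*$ given all the $X_i,Y_i,X^*_{j'}$ is $\frac1k\sum_{i=1}^n\mathbf 1\{\|X_i-X_j^*\|\le\hat\tau_k(X_j^*)\}\,\delta_{Y_i}$. Define $$\hat e_1(h)=\frac1m\sum_{j=1}^m h(X_j^*,\hat Y_j^*),\qquad \hat e_2(h)=\frac1n\sum_{i=1}^n\frac{n\,M_k^*(X_i)}{mk}\,h(X_i,Y_i),\qquad M_k^*(x)=\sum_{j=1}^m\mathbf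 1\{\|x-X_j^*\|\le\hat\tau_k(X_j^*)\},$$ and the conditional biases $B_{i,n}:=\mathbb E[\hat e_i(h)\mid X_1,\dots,X_n]-e(h)$, $i=1,2$. 1. Suppose in addition that there are a bounded convex open set $U\supseteq\mathcal X$ and, for every $x\in\mathcal X$, an extension of $\Delta(x,\cdot)|_{\mathcal X}$ to a $C^2$ function on $U$ (still denoted $\Delta(x,\cdot)$) with $\sup_{(x,y)\in\mathcal X\times\operatorname{co}(\mathcal X)}\{\|\nabla_2\Delta(x,y)\|+\|\nabla_2^2\Delta(x,y)\|\}<\infty$. Then there is a constant $C_1$, not depending on $n,m,k$ or on the sample, such that, whenever the variables $h(X_j^*,\hat Y_j^*)$ are integrable, $$\mathbb E[B_{1,n}^2]\le C_1\Big(\frac k{n+1}\Big)^{\min\{4/d,\,3\}}.$$ 2. Suppose in addition that $g|_{\mathcal X}$ extends to a $C^2$ function on some bounded convex open set $U\supseteq\mathcal X$. Then there is a constant $C_2$, not depending on $n,m,k$ or on the sample, such that $$\mathbb E[B_{2,n}^2]\le C_2\Big(\frac k{n+1}\Big)^{\min\{4/d,\,3\}}.$$ -/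

import Mathlib

open MeasureTheory ProbabilityTheory Set
open scoped ENNReal

universe u

noncomputable section

namespace Matching

/-- `ℝ^d` with the Euclidean norm. -/
abbrev E (d : ℕ) : Type := EuclideanSpace ℝ (Fin d)

variable {d n m : ℕ}

/-! ### Regression functions -/

/-- `Δ(x,u) = E[h(x,Y) | X = u]`, where `κ u` is the conditional law of `Y` given `X = u`. -/
def Delta (κ : Kernel (E d) ℝ) (h : E d → ℝ → ℝ) (x u : E d) : ℝ :=
  ∫ y, h x y ∂(κ u)

/-- The regression function `g(x) = E[h(X,Y) | X = x]`. -/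
def regr (κ : Kernel (E d) ℝ) (h : E d → ℝ → ℝ) (x : E d) : ℝ :=
  ∫ y, h x y ∂(κ x)

/-- The target `e(h) = E[h(X*,Y*)]`, the law of `(X*,Y*)` being `Q ⊗ κ`. -/
def targetMean (Q : Measure (E d)) (κ : Kernel (E d) ℝ) (h : E d → ℝ → ℝ) : ℝ :=
  ∫ z, h z.1 z.2 ∂(Q ⊗ₘ κ)

/-! ### The two estimators -/

/-- The `k`-nearest neighbour radius of `x`: the `k`-th order statistic of the distances
`‖X_i - x‖`, i.e. the least `r` such that at least `k` of them are `≤ r` (for `1 ≤ k ≤ n`). -/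
def knnRadius (k : ℕ) (X : Fin n → E d) (x : E d) : ℝ :=
  sInf {r : ℝ | k ≤ (Finset.univ.filter (fun i => ‖X i - x‖ ≤ r)).card}

/-- The first estimator, computed from the target covariates and the generated labels. -/
def est1 (h : E d → ℝ → ℝ) (Xs : Fin m → E d) (Yhat : Fin m → ℝ) : ℝ :=
  (1 / (m : ℝ)) * ∑ j, h (Xs j) (Yhat j)

/-- The number `M_k^*(x)` of target points that have `x` within their `k`-NN radius. -/
def matchCount (k : ℕ) (X : Fin n → E d) (Xs : Fin m → E d) (x : E d) : ℕ :=
  (Finset.univ.filter (fun j => ‖x - Xs j‖ ≤ knnRadius k X (Xs j))).card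

/-- The second (matching) estimator. -/
def est2 (k : ℕ) (h : E d → ℝ → ℝ) (X : Fin n → E d) (Y : Fin n → ℝ) (Xs : Fin m → E d) : ℝ :=
  (1 / (n : ℝ)) * ∑ i, ((n : ℝ) * (matchCount k X Xs (X i) : ℝ) / ((m : ℝ) * (k : ℝ))) *
    h (X i) (Y i)

/-! ### Sampling model -/

/-- `(X_i,Y_i)`, `i < n`, are i.i.d. with law `P ⊗ κ`; `X*_j`, `j < m`, are i.i.d. with law `Q`;
the two samples are independent. -/
structure IsSample {Ω : Type*} [MeasurableSpace Ω] (μ : Measure Ω)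
    (P Q : Measure (E d)) (κ : Kernel (E d) ℝ)
    (X : Fin n → Ω → E d) (Y : Fin n → Ω → ℝ) (Xs : Fin m → Ω → E d) : Prop where
  measurable_X : ∀ i, Measurable (X i)
  measurable_Y : ∀ i, Measurable (Y i)
  measurable_Xs : ∀ j, Measurable (Xs j)
  law_XY : ∀ i, μ.map (fun ω => (X i ω, Y i ω)) = P ⊗ₘ κ
  law_Xs : ∀ j, μ.map (Xs j) = Q
  indep_XY : iIndepFun (fun i ω => (X i ω, Y i ω)) μ
  indep_Xs : iIndepFun Xs μ
  indep : IndepFun (fun ω i => (X i ω, Y i ω)) (fun ω j => Xs j ω) μ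

/-- The sigma-algebra generated by `X_i, Y_i, X*_j`. -/
abbrev dataSigma {Ω : Type*} (X : Fin n → Ω → E d) (Y : Fin n → Ω → ℝ) (Xs : Fin m → Ω → E d) :
    MeasurableSpace Ω :=
  MeasurableSpace.comap
    (fun ω => ((fun i => (X i ω, Y i ω)), (fun j => Xs j ω)) :
      Ω → (Fin n → E d × ℝ) × (Fin m → E d)) inferInstance

/-- The sigma-algebra generated by `X = (X_1, …, X_n)`. -/
abbrev covSigma {Ω : Type*} (X : Fin n → Ω → E d) : MeasurableSpace Ω :=
  MeasurableSpace.comap (fun ω i => X i ω : Ω → Fin n → E d) inferInstance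

open Classical in
/-- The labels `Ŷ_j` have, given the data, the conditional law
`k⁻¹ ∑_i 1{‖X_i - X*_j‖ ≤ τ_k(X*_j)} δ_{Y_i}`. -/
structure IsLabels {Ω : Type*} [MeasurableSpace Ω] (μ : Measure Ω) (k : ℕ)
    (X : Fin n → Ω → E d) (Y : Fin n → Ω → ℝ) (Xs : Fin m → Ω → E d)
    (Yhat : Fin m → Ω → ℝ) : Prop where
  measurable : ∀ j, Measurable (Yhat j)
  condLaw : ∀ j, ∀ B : Set ℝ, MeasurableSet B →
    μ[(Yhat j ⁻¹' B).indicator (fun _ => (1 : ℝ)) | dataSigma X Y Xs] =ᵐ[μ]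
      fun ω => (k : ℝ)⁻¹ * ∑ i,
        if ‖X i ω - Xs j ω‖ ≤ knnRadius k (fun i => X i ω) (Xs j ω) ∧ Y i ω ∈ B
          then (1 : ℝ) else 0

/-- The conditional bias `E[ê | X] - e(h)`. -/
def condBias {Ω : Type*} [MeasurableSpace Ω] (μ : Measure Ω) (X : Fin n → Ω → E d)
    (est : Ω → ℝ) (e : ℝ) : Ω → ℝ :=
  fun ω => (μ[est | covSigma X]) ω - e

/-- The conditional bias of the first estimator. -/
def B1 {Ω : Type*} [MeasurableSpace Ω] (Q : Measure (E d)) (κ : Kernel (E d) ℝ)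
    (h : E d → ℝ → ℝ) (μ : Measure Ω) (X : Fin n → Ω → E d) (Xs : Fin m → Ω → E d)
    (Yhat : Fin m → Ω → ℝ) : Ω → ℝ :=
  condBias μ X (fun ω => est1 h (fun j => Xs j ω) (fun j => Yhat j ω)) (targetMean Q κ h)

/-- The conditional bias of the second estimator. -/
def B2 {Ω : Type*} [MeasurableSpace Ω] (Q : Measure (E d)) (κ : Kernel (E d) ℝ)
    (h : E d → ℝ → ℝ) (μ : Measure Ω) (k : ℕ) (X : Fin n → Ω → E d) (Y : Fin n → Ω → ℝ)
    (Xs : Fin m → Ω → E d) : Ω → ℝ :=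
  condBias μ X (fun ω => est2 k h (fun i => X i ω) (fun i => Y i ω) (fun j => Xs j ω))
    (targetMean Q κ h)

/-! ### Assumptions -/

/-- The volume of balls intersected with the domain is comparable to that of the balls. -/
def BallVolume (𝒳 : Set (E d)) : Prop :=
  ∃ c : ℝ, 0 < c ∧ ∀ x ∈ 𝒳, ∀ r : ℝ, 0 ≤ r → r ≤ Metric.diam 𝒳 →
    ENNReal.ofReal c * volume (Metric.closedBall x r) ≤ volume (Metric.closedBall x r ∩ 𝒳)

/-- `p` is a density of `P` with respect to Lebesgue measure. -/
structure IsDensity (P : Measure (E d)) (p : E d → ℝ) : Prop where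
  measurable : Measurable p
  nonneg : ∀ x, 0 ≤ p x
  eq : P = volume.withDensity (fun x => ENNReal.ofReal (p x))

/-- The geometric condition
`sup_{L>0} L^{1/d} ∫_𝒳 exp(-L δ(x)^d) dQ(x) < ∞`, with `δ(x)` the distance to `𝒳ᶜ`. -/
def GeomCondition (𝒳 : Set (E d)) (Q : Measure (E d)) : Prop :=
  ∃ M : ℝ, ∀ L : ℝ, 0 < L →
    L ^ (1 / (d : ℝ)) * ∫ x in 𝒳, Real.exp (-L * (Metric.infDist x 𝒳ᶜ) ^ d) ∂Q ≤ M

/-- Every `Δ(x,·)`, `x ∈ 𝒳`, extends to a `C²` function on a common bounded convex open set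
`U ⊇ 𝒳`, with gradients and Hessians bounded uniformly over `𝒳 × co(𝒳)`. -/
def SmoothDelta (𝒳 : Set (E d)) (κ : Kernel (E d) ℝ) (h : E d → ℝ → ℝ) : Prop :=
  ∃ U : Set (E d), IsOpen U ∧ Convex ℝ U ∧ Bornology.IsBounded U ∧ 𝒳 ⊆ U ∧
    ∃ D : E d → E d → ℝ,
      (∀ x ∈ 𝒳, ContDiffOn ℝ 2 (D x) U ∧ EqOn (D x) (Delta κ h x) 𝒳) ∧
      ∃ M : ℝ, ∀ x ∈ 𝒳, ∀ y ∈ convexHull ℝ 𝒳,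
        ‖fderiv ℝ (D x) y‖ + ‖fderiv ℝ (fderiv ℝ (D x)) y‖ ≤ M

/-- `g` extends to a `C²` function on a bounded convex open set `U ⊇ 𝒳`. -/
def SmoothRegr (𝒳 : Set (E d)) (κ : Kernel (E d) ℝ) (h : E d → ℝ → ℝ) : Prop :=
  ∃ U : Set (E d), IsOpen U ∧ Convex ℝ U ∧ Bornology.IsBounded U ∧ 𝒳 ⊆ U ∧
    ∃ G : E d → ℝ, ContDiffOn ℝ 2 G U ∧ EqOn G (regr κ h) 𝒳

end Matching

end

/-! Both conditional biases are, almost surely, values of one functional of the source covariates: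
`nnBias`, the `Q`-average over `x` of `Φ x (X i)` averaged over the `k` nearest neighbours of `x`.
For the first estimator `Φ x u = Δ(x,u) - Δ(x,x)`, for the second `Φ x u = g(u) - g(x)`, both cut
off outside `𝒳 × 𝒳`. The labels and the target points have been integrated out, so `m` disappears
(`IsSample.condBias_ae_eq`). Smoothness enters only through `IsLocalIncrement`: `Φ x` is linear in
`u - x` up to a quadratic error. The second moment is then the squared mean plus a variance, both
measured in a length `ε` with `ε ^ d` of order `k / n`, the typical size of the nearest neighbour
radius.

Mean. Whether `X i` is a `k`-nearest neighbour of `x` depends on the other points only through their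
`k`-th distance `R`, so the contribution of `X i` has the expectation of the integral of `Φ x`
against `P` over the ball of radius `R` (`integral_ite_knnRadius`). If the ball lies in `𝒳`, its
symmetry kills the linear term against a constant density, and the Lipschitz bound on `p` leaves an
error of order `R ^ (d + 2)`. If it leaves `𝒳`, only `R ^ (d + 1)` is available, but then the
distance from `x` to the complement is at most `R`; exponential moments of the radius turn this
event into the factor `exp (-L δ(x) ^ d)` whose `Q`-integral `GeomCondition` bounds by a multiple of
`ε`. Summing over the `n` points and dividing by `k` gives a mean of order `ε ^ 2`, hence `(k / n) ^
(4 / d)` after squaring.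

Variance. A leave-one-out Efron–Stein inequality (`efron_stein`) reduces it to the effect of
deleting one point. Deleting `X i` changes the average at `x` only if `X i` is a `k`-nearest
neighbour of `x`, and then by at most `2 M / k` times the `(k + 1)`-st radius. Expanding the squared
`Q`-integral of this effect as a double integral, two points `x`, `x'` can share a neighbour only if
they are within twice the larger radius, and then they share at most `k`. So the total is at most a
constant times the mean of radius `^ (d + 2)`, that is `(k / n) ^ (1 + 2 / d)`. This is dominated by
`(k / n) ^ (4 / d)` for `d ≥ 2` and equals the cube for `d = 1`, which explains the minimum in the
exponent. -/

noncomputable section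

namespace Matching

/-! ### Order statistics of a finite family -/

section OrderStatistics

variable {ι : Type*}

/-- The `k`-th order statistic of the family `(a i)`, `i ∈ s`. -/
def ordStat (s : Finset ι) (k : ℕ) (a : ι → ℝ) : ℝ :=
  sInf {r : ℝ | k ≤ (s.filter (fun i => a i ≤ r)).card}

theorem knnRadius_eq_ordStat {d n : ℕ} (k : ℕ) (X : Fin n → E d) (x : E d) :
    knnRadius k X x = ordStat Finset.univ k (fun i => ‖X i - x‖) := rfl

theorem ordStat_congr {s : Finset ι} {k : ℕ} {a b : ι → ℝ} (hab : ∀ i ∈ s, a i = b i) :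
    ordStat s k a = ordStat s k b := by
  unfold ordStat
  congr 1
  ext r
  simp only [mem_ofPred_eq]
  rw [Finset.filter_congr (fun i hi => by rw [hab i hi])]

/-- The count of values below a level is a right-continuous step function of the level, so the
infimum defining `ordStat` is attained. The later facts on order statistics are counting arguments
through this equivalence. -/
theorem ordStat_le_iff {s : Finset ι} {k : ℕ} {a : ι → ℝ} (hk : 1 ≤ k) (hks : k ≤ s.card)
    {r : ℝ} : ordStat s k a ≤ r ↔ k ≤ (s.filter (fun i => a i ≤ r)).card := by
  have hbdd : BddBelow {r : ℝ | k ≤ (s.filter (fun i => a i ≤ r)).card} := by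
    have hne : s.Nonempty := Finset.card_pos.1 (by omega)
    refine ⟨s.inf' hne a, fun r hr => ?_⟩
    obtain ⟨i, hi⟩ := Finset.card_pos.1 (lt_of_lt_of_le hk hr)
    rw [Finset.mem_filter] at hi
    exact (Finset.inf'_le _ hi.1).trans hi.2
  refine ⟨fun h => ?_, fun h => csInf_le hbdd h⟩
  have hnonempty : {r : ℝ | k ≤ (s.filter (fun i => a i ≤ r)).card}.Nonempty := by
    have hne : s.Nonempty := Finset.card_pos.1 (by omega)
    refine ⟨s.sup' hne a, ?_⟩
    simp only [mem_ofPred_eq]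
    rwa [Finset.filter_true_of_mem (fun i hi => Finset.le_sup' _ hi)]
  -- Right-continuity of the count: by finiteness, no value lies just above `r`.
  have hev : ∀ᶠ t in nhds r, ∀ i ∈ s, a i ≤ t → a i ≤ r := by
    rw [Filter.eventually_all_finset]
    intro i _
    by_cases hi : a i ≤ r
    · exact Filter.Eventually.of_forall fun _ _ => hi
    · filter_upwards [eventually_lt_nhds (not_le.1 hi)] with t ht h
      exact absurd h (not_le.2 ht)
  obtain ⟨ε, hε, hball⟩ := Metric.eventually_nhds_iff.1 hev
  obtain ⟨t, ht, htr⟩ :=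
    exists_lt_of_csInf_lt hnonempty (lt_of_le_of_lt h (lt_add_of_pos_right r hε))
  refine le_trans ht (Finset.card_le_card fun i hi => ?_)
  rw [Finset.mem_filter] at hi ⊢
  refine ⟨hi.1, ?_⟩
  rcases le_or_gt t r with htr' | htr'
  · exact hi.2.trans htr'
  · refine hball ?_ i hi.1 hi.2
    rw [Real.dist_eq, abs_of_pos (sub_pos.2 htr')]
    linarith

theorem le_card_filter_le_ordStat {s : Finset ι} {k : ℕ} {a : ι → ℝ} (hk : 1 ≤ k)
    (hks : k ≤ s.card) : k ≤ (s.filter (fun i => a i ≤ ordStat s k a)).card :=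
  (ordStat_le_iff hk hks).1 le_rfl

/-- With `k` values strictly below, the largest of them would already be an admissible level, below
the infimum. -/
theorem card_filter_lt_ordStat {s : Finset ι} {k : ℕ} {a : ι → ℝ} (hk : 1 ≤ k)
    (hks : k ≤ s.card) : (s.filter (fun i => a i < ordStat s k a)).card < k := by
  by_contra! hcon
  have hne : (s.filter (fun i => a i < ordStat s k a)).Nonempty := Finset.card_pos.1 (by omega)
  have hlt : (s.filter (fun i => a i < ordStat s k a)).sup' hne a < ordStat s k a := by
    rw [Finset.sup'_lt_iff]
    exact fun i hi => (Finset.mem_filter.1 hi).2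
  refine absurd ((ordStat_le_iff hk hks).2 (hcon.trans (Finset.card_le_card fun i hi => ?_)))
    (not_le.2 hlt)
  exact Finset.mem_filter.2 ⟨(Finset.mem_filter.1 hi).1, Finset.le_sup' a hi⟩

theorem card_filter_le_ordStat {s : Finset ι} {k : ℕ} {a : ι → ℝ} (hk : 1 ≤ k)
    (hks : k ≤ s.card) (ha : Set.InjOn a s) :
    (s.filter (fun i => a i ≤ ordStat s k a)).card = k := by
  classical
  refine le_antisymm ?_ (le_card_filter_le_ordStat hk hks)
  have hsub : s.filter (fun i => a i ≤ ordStat s k a) ⊆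
      s.filter (fun i => a i < ordStat s k a) ∪ s.filter (fun i => a i = ordStat s k a) := by
    intro i hi
    rw [Finset.mem_union, Finset.mem_filter, Finset.mem_filter]
    rw [Finset.mem_filter] at hi
    rcases hi.2.lt_or_eq with h | h
    · exact Or.inl ⟨hi.1, h⟩
    · exact Or.inr ⟨hi.1, h⟩
  have hone : (s.filter (fun i => a i = ordStat s k a)).card ≤ 1 := by
    rw [Finset.card_le_one]
    intro i hi j hj
    rw [Finset.mem_filter] at hi hj
    exact ha hi.1 hj.1 (hi.2.trans hj.2.symm)
  have := (Finset.card_le_card hsub).trans (Finset.card_union_le _ _)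
  have := card_filter_lt_ordStat (a := a) hk hks
  omega

theorem ordStat_le_of_forall_le {s : Finset ι} {k : ℕ} {a : ι → ℝ} (hk : 1 ≤ k)
    (hks : k ≤ s.card) {r : ℝ} (hr : ∀ i ∈ s, a i ≤ r) : ordStat s k a ≤ r := by
  rw [ordStat_le_iff hk hks, Finset.filter_true_of_mem hr]
  exact hks

theorem ordStat_nonneg {s : Finset ι} {k : ℕ} {a : ι → ℝ} (hk : 1 ≤ k)
    (hks : k ≤ s.card) (h0 : ∀ i ∈ s, 0 ≤ a i) : 0 ≤ ordStat s k a := by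
  obtain ⟨i, hi⟩ :=
    Finset.card_pos.1 (lt_of_lt_of_le hk (le_card_filter_le_ordStat (a := a) hk hks))
  rw [Finset.mem_filter] at hi
  exact (h0 i hi.1).trans hi.2

theorem ordStat_mono_right {s : Finset ι} {k l : ℕ} {a : ι → ℝ} (hk : 1 ≤ k) (hkl : k ≤ l)
    (hls : l ≤ s.card) : ordStat s k a ≤ ordStat s l a :=
  (ordStat_le_iff hk (hkl.trans hls)).2
    (hkl.trans (le_card_filter_le_ordStat (hk.trans hkl) hls))

variable [DecidableEq ι]

theorem ordStat_le_ordStat_erase {s : Finset ι} {k : ℕ} {a : ι → ℝ} {i : ι} (hk : 1 ≤ k)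
    (hks : k ≤ (s.erase i).card) : ordStat s k a ≤ ordStat (s.erase i) k a := by
  rw [ordStat_le_iff hk (hks.trans Finset.card_erase_le)]
  exact (le_card_filter_le_ordStat hk hks).trans
    (Finset.card_le_card (Finset.filter_subset_filter _ (Finset.erase_subset _ _)))

theorem ordStat_erase_le {s : Finset ι} {k : ℕ} {a : ι → ℝ} {i : ι} (hk : 1 ≤ k)
    (hi : i ∈ s) (hks : k + 1 ≤ s.card) : ordStat (s.erase i) k a ≤ ordStat s (k + 1) a := by
  rw [ordStat_le_iff hk (by rw [Finset.card_erase_of_mem hi]; omega), Finset.filter_erase]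
  have h1 := le_card_filter_le_ordStat (a := a) (by omega : 1 ≤ k + 1) hks
  have h2 := Finset.pred_card_le_card_erase (s := s.filter (fun j => a j ≤ ordStat s (k + 1) a))
    (a := i)
  omega

/-- A value above the threshold is not among those counted, so deleting it leaves the threshold
where it was. This decouples the event from its own threshold: on the right-hand side the threshold
no longer depends on `a i`. -/
theorem le_ordStat_iff_le_ordStat_erase {s : Finset ι} {k : ℕ} {a : ι → ℝ} {i : ι} (hk : 1 ≤ k)
    (hi : i ∈ s) (hks : k + 1 ≤ s.card) :
    a i ≤ ordStat s k a ↔ a i ≤ ordStat (s.erase i) k a := by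
  have hks' : k ≤ (s.erase i).card := by rw [Finset.card_erase_of_mem hi]; omega
  refine ⟨fun h => h.trans (ordStat_le_ordStat_erase hk hks'), fun h => ?_⟩
  by_contra! hlt
  have h1 := le_card_filter_le_ordStat (a := a) hk (by omega : k ≤ s.card)
  have h2 : ordStat (s.erase i) k a ≤ ordStat s k a := by
    rw [ordStat_le_iff hk hks', Finset.filter_erase, Finset.erase_eq_of_notMem]
    · exact h1
    · simp [hlt]
  linarith

/-- Deleting one index replaces at most that index in the set of the `k` smallest elements. -/
theorem abs_sum_filter_sub_sum_filter_erase_le {s : Finset ι} {k : ℕ} {a : ι → ℝ} {i : ι}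
    (hk : 1 ≤ k) (hi : i ∈ s) (hks : k + 1 ≤ s.card) (ha : Set.InjOn a s) (φ : ι → ℝ) {c : ℝ}
    (hφ : ∀ j ∈ s, a j ≤ ordStat s (k + 1) a → |φ j| ≤ c) :
    |(∑ j ∈ s.filter (fun j => a j ≤ ordStat s k a), φ j) -
        ∑ j ∈ (s.erase i).filter (fun j => a j ≤ ordStat (s.erase i) k a), φ j| ≤
      if a i ≤ ordStat s k a then 2 * c else 0 := by
  have hks' : k ≤ (s.erase i).card := by rw [Finset.card_erase_of_mem hi]; omega
  set S := s.filter (fun j => a j ≤ ordStat s k a) with hS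
  set S' := (s.erase i).filter (fun j => a j ≤ ordStat (s.erase i) k a) with hS'
  have hSc : S.card = k := card_filter_le_ordStat hk (by omega) ha
  have hSc' : S'.card = k :=
    card_filter_le_ordStat hk hks' (ha.mono (by simp))
  have hsub : S.erase i ⊆ S' := by
    intro j hj
    rw [Finset.mem_erase, hS, Finset.mem_filter] at hj
    exact Finset.mem_filter.2 ⟨Finset.mem_erase.2 ⟨hj.1, hj.2.1⟩,
      hj.2.2.trans (ordStat_le_ordStat_erase hk hks')⟩
  have hbd : ∀ j ∈ S', |φ j| ≤ c := by
    intro j hj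
    rw [hS', Finset.mem_filter, Finset.mem_erase] at hj
    exact hφ j hj.1.2 (hj.2.trans (ordStat_erase_le hk hi hks))
  split_ifs with hai
  · have hiS : i ∈ S := Finset.mem_filter.2 ⟨hi, hai⟩
    -- Exactly one index moves in to replace `i`; its value is at most the `(k + 1)`-st order
    -- statistic, whence `k + 1` in the hypothesis on `φ`.
    have hcard : (S' \ S.erase i).card = 1 := by
      rw [Finset.card_sdiff_of_subset hsub, Finset.card_erase_of_mem hiS, hSc, hSc']
      omega
    obtain ⟨j, hj⟩ := Finset.card_eq_one.1 hcard
    have hjS : j ∈ S' := (Finset.mem_sdiff.1 (hj ▸ Finset.mem_singleton_self j)).1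
    rw [← Finset.add_sum_erase S φ hiS, ← Finset.sum_sdiff hsub, hj, Finset.sum_singleton]
    have h1 := hbd j hjS
    have h2 := hφ i hi (hai.trans (ordStat_mono_right hk (by omega) hks))
    rw [abs_le] at h1 h2 ⊢
    constructor <;> linarith
  · have hiS : i ∉ S := fun h => hai (Finset.mem_filter.1 h).2
    rw [Finset.erase_eq_of_notMem hiS] at hsub
    rw [Finset.eq_of_subset_of_card_le hsub (by omega)]
    simp

end OrderStatistics

theorem measurable_ordStat {ι α : Type*} [MeasurableSpace α] {s : Finset ι} {k : ℕ} (hk : 1 ≤ k)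
    (hks : k ≤ s.card) {a : α → ι → ℝ} (ha : ∀ i, Measurable fun z => a z i) :
    Measurable fun z => ordStat s k (a z) := by
  refine measurable_of_Iic fun r => ?_
  have : (fun z => ordStat s k (a z)) ⁻¹' Iic r =
      (fun z => ∑ i ∈ s, if a z i ≤ r then 1 else 0) ⁻¹' Ici k := by
    ext z
    simp only [mem_preimage, mem_Iic, mem_Ici]
    rw [ordStat_le_iff hk hks, Finset.card_filter]
  rw [this]
  refine Finset.measurable_fun_sum s (fun i _ => ?_) measurableSet_Ici
  exact Measurable.ite (measurableSet_le (ha i) measurable_const) measurable_const measurable_const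


/-! ### Resampling one coordinate and the Efron–Stein inequality -/

section ProductMeasures

variable {α : Type*} [MeasurableSpace α]

/-- Replacing one coordinate by an independent copy does not change the law. Combined with Fubini,
this is how one conditions on all coordinates but the `i`-th. -/
theorem measurePreserving_update {ι : Type*} [Fintype ι] [DecidableEq ι] (P : Measure α)
    [IsProbabilityMeasure P] (i : ι) :
    MeasurePreserving (fun z : (ι → α) × α => Function.update z.1 i z.2)
      ((Measure.pi fun _ : ι => P).prod P) (Measure.pi fun _ : ι => P) := by
  have hm : Measurable (fun z : (ι → α) × α => Function.update z.1 i z.2) := by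
    refine measurable_pi_lambda _ fun j => ?_
    by_cases hj : j = i
    · subst hj; simpa using measurable_snd
    · simp only [Function.update_of_ne hj]; fun_prop
  refine ⟨hm, (Measure.pi_eq fun s hs => ?_).symm⟩
  rw [Measure.map_apply hm (MeasurableSet.univ_pi hs)]
  have : (fun z : (ι → α) × α => Function.update z.1 i z.2) ⁻¹' (univ.pi s) =
      (univ.pi (Function.update s i univ)) ×ˢ s i := by
    ext z
    simp only [mem_preimage, mem_pi, mem_univ, true_imp_iff, mem_prod]
    constructor
    · intro h
      refine ⟨fun j => ?_, by simpa using h i⟩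
      by_cases hj : j = i
      · subst hj; simp
      · simpa [Function.update_of_ne hj] using h j
    · rintro ⟨h1, h2⟩ j
      by_cases hj : j = i
      · subst hj; simpa using h2
      · simpa [Function.update_of_ne hj] using h1 j
  rw [this, Measure.prod_prod, Measure.pi_pi, ← Finset.prod_erase_mul _ _ (Finset.mem_univ i),
    ← Finset.prod_erase_mul Finset.univ (fun j => P (s j)) (Finset.mem_univ i)]
  simp only [Function.update_self, measure_univ, mul_one]
  congr 1
  refine Finset.prod_congr rfl fun j hj => ?_
  rw [Function.update_of_ne (Finset.ne_of_mem_erase hj)]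

theorem integral_pi_succ (P : Measure α) [IsProbabilityMeasure P] {n : ℕ}
    {f : (Fin (n + 1) → α) → ℝ} (hf : Integrable f (Measure.pi fun _ => P)) :
    ∫ x, f x ∂(Measure.pi fun _ => P) =
      ∫ a, ∫ x, f (Fin.cons a x) ∂(Measure.pi fun _ => P) ∂P := by
  have hmp := (measurePreserving_piFinSuccAbove (fun _ : Fin (n + 1) => P) 0).symm
  rw [← hmp.integral_comp', integral_prod]
  · simp [MeasurableEquiv.piFinSuccAbove, Fin.insertNthEquiv, Fin.insertNth_zero']
  · exact (hmp.integrable_comp_emb (MeasurableEquiv.measurableEmbedding _)).2 hf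

theorem measurable_fin_cons {n : ℕ} :
    Measurable (fun z : α × (Fin n → α) => (Fin.cons z.1 z.2 : Fin (n + 1) → α)) := by
  refine measurable_pi_lambda _ fun j => ?_
  refine Fin.cases ?_ (fun j => ?_) j
  · simpa using measurable_fst
  · simp only [Fin.cons_succ]; fun_prop

theorem integral_sub_const_sq {μ : Measure α} [IsProbabilityMeasure μ] {f : α → ℝ}
    (hf : Integrable f μ) (hf2 : Integrable (fun x => f x ^ 2) μ) (c : ℝ) :
    ∫ x, (f x - c) ^ 2 ∂μ = ∫ x, f x ^ 2 ∂μ - 2 * c * ∫ x, f x ∂μ + c ^ 2 := by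
  have : ∀ x, (f x - c) ^ 2 = f x ^ 2 - 2 * c * f x + c ^ 2 := fun x => by ring
  have hcf : Integrable (fun x => 2 * c * f x) μ := hf.const_mul _
  have hs : Integrable (fun x => f x ^ 2 - 2 * c * f x) μ := hf2.sub hcf
  simp only [this]
  rw [integral_add hs (integrable_const _), integral_sub hf2 hcf, integral_const_mul,
    integral_const]
  simp

/-- The mean is the best constant approximation in `L²`. -/
theorem integral_sq_le_sq_integral_add {μ : Measure α} [IsProbabilityMeasure μ] {f : α → ℝ}
    (hf : Integrable f μ) (hf2 : Integrable (fun x => f x ^ 2) μ) (c : ℝ) :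
    ∫ x, f x ^ 2 ∂μ ≤ (∫ x, f x ∂μ) ^ 2 + ∫ x, (f x - c) ^ 2 ∂μ := by
  rw [integral_sub_const_sq hf hf2]
  nlinarith [sq_nonneg (∫ x, f x ∂μ - c)]

theorem sq_integral_le_integral_sq {μ : Measure α} [IsProbabilityMeasure μ] {f : α → ℝ}
    (hf : Integrable f μ) (hf2 : Integrable (fun x => f x ^ 2) μ) :
    (∫ x, f x ∂μ) ^ 2 ≤ ∫ x, f x ^ 2 ∂μ := by
  have h := integral_sub_const_sq hf hf2 (∫ x, f x ∂μ)
  have h0 : 0 ≤ ∫ x, (f x - ∫ x, f x ∂μ) ^ 2 ∂μ := integral_nonneg fun x => sq_nonneg _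
  nlinarith

theorem integrable_of_abs_le {μ : Measure α} [IsFiniteMeasure μ] {f : α → ℝ}
    (hf : Measurable f) {C : ℝ} (hC : ∀ x, |f x| ≤ C) : Integrable f μ :=
  Integrable.of_bound hf.aestronglyMeasurable C (Filter.Eventually.of_forall hC)

/-- Leave-one-out form: `g i` may be any bounded function that ignores the `i`-th coordinate.
Induction on `n`: freeze the first coordinate and use the hypothesis for the remaining ones. What is
left is the variance of the partial mean `F`, which is at most its mean squared distance to the
constant `c`, the mean of `g 0`; Jensen bounds that distance by the term of index `0`. -/
theorem efron_stein (P : Measure α) [IsProbabilityMeasure P] {C : ℝ} :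
    ∀ (n : ℕ) (f : (Fin n → α) → ℝ) (g : Fin n → (Fin n → α) → ℝ), Measurable f →
      (∀ i, Measurable (g i)) → (∀ x, |f x| ≤ C) → (∀ i x, |g i x| ≤ C) →
      (∀ i x y, g i (Function.update x i y) = g i x) →
      ∫ x, f x ^ 2 ∂(Measure.pi fun _ => P) ≤ (∫ x, f x ∂(Measure.pi fun _ => P)) ^ 2 +
        ∑ i, ∫ x, (f x - g i x) ^ 2 ∂(Measure.pi fun _ => P)
  | 0, f, g, hf, hg, hfC, hgC, hinv => by
    have hsub : ∀ x, f x = f finZeroElim := fun x => by rw [Subsingleton.elim x finZeroElim]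
    simp only [hsub]
    simp
  | n + 1, f, g, hf, hg, hfC, hgC, hinv => by
    have hsq : ∀ {β : Type _} [MeasurableSpace β] {μ : Measure β} [IsFiniteMeasure μ]
        {u : β → ℝ} {D : ℝ}, Measurable u → (∀ x, |u x| ≤ D) →
        Integrable (fun x => u x ^ 2) μ := by
      intro β _ μ _ u D hu huD
      refine integrable_of_abs_le (hu.pow_const 2) (C := D ^ 2) fun x => ?_
      rw [abs_pow]
      exact pow_le_pow_left₀ (abs_nonneg _) (huD x) 2
    have hfg : ∀ i, Measurable fun x => f x - g i x := fun i => hf.sub (hg i)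
    have hfgC : ∀ i x, |f x - g i x| ≤ C + C := fun i x =>
      (abs_sub _ _).trans (add_le_add (hfC x) (hgC i x))
    have hfm : Measurable fun z : α × (Fin n → α) => f (Fin.cons z.1 z.2) :=
      hf.comp measurable_fin_cons
    have hgm : ∀ i, Measurable fun z : α × (Fin n → α) => g i (Fin.cons z.1 z.2) :=
      fun i => (hg i).comp measurable_fin_cons
    have hcons : ∀ a : α, Measurable fun x : Fin n → α => (Fin.cons a x : Fin (n + 1) → α) :=
      fun a => measurable_fin_cons.comp measurable_prodMk_left
    have key : ∀ a : α, ∫ x, f (Fin.cons a x) ^ 2 ∂(Measure.pi fun _ => P) ≤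
        (∫ x, f (Fin.cons a x) ∂(Measure.pi fun _ => P)) ^ 2 +
        ∑ i : Fin n, ∫ x, (f (Fin.cons a x) - g i.succ (Fin.cons a x)) ^ 2
          ∂(Measure.pi fun _ => P) := fun a => by
      refine efron_stein P n (fun x => f (Fin.cons a x)) (fun i x => g i.succ (Fin.cons a x))
        (hf.comp (hcons a)) (fun i => (hg _).comp (hcons a)) (fun x => hfC _) (fun i x => hgC _ _)
        fun i x y => ?_
      rw [← hinv i.succ (Fin.cons a x) y, Fin.cons_update]
    set F : α → ℝ := fun a => ∫ x, f (Fin.cons a x) ∂(Measure.pi fun _ => P) with hF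
    have hFm : Measurable F := by
      exact (hfm.stronglyMeasurable.integral_prod_right (ν := Measure.pi fun _ : Fin n => P)).measurable
    have hFC : ∀ a, |F a| ≤ C := fun a => by
      refine (norm_integral_le_of_norm_le_const (μ := Measure.pi fun _ : Fin n => P)
        (f := fun x => f (Fin.cons a x)) (C := C)
        (Filter.Eventually.of_forall fun x => hfC _)).trans ?_
      simp
    have hdint : ∀ i, Integrable (fun a => ∫ x, (f (Fin.cons a x) - g i (Fin.cons a x)) ^ 2
        ∂(Measure.pi fun _ => P)) P := fun i =>
      (hsq (μ := P.prod (Measure.pi fun _ : Fin n => P)) (hfm.sub (hgm i))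
        (fun z => hfgC i _)).integral_prod_left
    have h0 : ∀ a a' x, g 0 (Fin.cons a x) = g 0 (Fin.cons a' x : Fin (n + 1) → α) := by
      intro a a' x
      rw [← hinv 0 (Fin.cons a' x) a, Fin.update_cons_zero]
    have hFF : ∫ a, F a ^ 2 ∂P ≤ (∫ a, F a ∂P) ^ 2 +
        ∫ a, ∫ x, (f (Fin.cons a x) - g 0 (Fin.cons a x)) ^ 2 ∂(Measure.pi fun _ => P) ∂P := by
      -- The choice of `a₀` is immaterial, because `g 0` ignores the first coordinate.
      obtain ⟨a₀⟩ : Nonempty α := P.nonempty_of_neZero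
      set c := ∫ x, g 0 (Fin.cons a₀ x) ∂(Measure.pi fun _ : Fin n => P) with hc
      refine (integral_sq_le_sq_integral_add (integrable_of_abs_le hFm hFC) (hsq hFm hFC) c).trans ?_
      gcongr
      · exact hsq (hFm.sub_const c) (D := C + |c|) fun a =>
          (abs_sub _ _).trans (add_le_add (hFC a) le_rfl)
      · exact hdint 0
      · intro a
        have hi1 : Integrable (fun x => f (Fin.cons a x)) (Measure.pi fun _ : Fin n => P) :=
          integrable_of_abs_le (hf.comp (hcons a)) fun x => hfC _
        have hi2 : Integrable (fun x => g 0 (Fin.cons a x)) (Measure.pi fun _ : Fin n => P) :=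
          integrable_of_abs_le ((hg 0).comp (hcons a)) fun x => hgC 0 _
        have hFc : F a - c =
            ∫ x, (f (Fin.cons a x) - g 0 (Fin.cons a x)) ∂(Measure.pi fun _ => P) := by
          rw [integral_sub hi1 hi2, hc]
          simp only [h0 a₀ a]
          rfl
        show (F a - c) ^ 2 ≤ _
        rw [hFc]
        exact sq_integral_le_integral_sq (f := fun x => f (Fin.cons a x) - g 0 (Fin.cons a x))
          (hi1.sub hi2) (hsq ((hfg 0).comp (hcons a)) fun x => hfgC 0 _)
    rw [integral_pi_succ P (hsq hf hfC), integral_pi_succ P (integrable_of_abs_le hf hfC),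
      Fin.sum_univ_succ]
    simp only [integral_pi_succ P (hsq (hfg _) (hfgC _))]
    calc ∫ a, ∫ x, f (Fin.cons a x) ^ 2 ∂(Measure.pi fun _ => P) ∂P
        ≤ ∫ a, (F a ^ 2 + ∑ i : Fin n, ∫ x, (f (Fin.cons a x) - g i.succ (Fin.cons a x)) ^ 2
          ∂(Measure.pi fun _ => P)) ∂P := by
          refine integral_mono (hsq (μ := P.prod (Measure.pi fun _ : Fin n => P)) hfm
            fun z => hfC _).integral_prod_left ?_ key
          exact (hsq hFm hFC).add (integrable_finsetSum _ fun i _ => hdint i.succ)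
      _ = ∫ a, F a ^ 2 ∂P + ∑ i : Fin n, ∫ a, ∫ x, (f (Fin.cons a x) -
          g i.succ (Fin.cons a x)) ^ 2 ∂(Measure.pi fun _ => P) ∂P := by
          rw [integral_add (hsq hFm hFC) (integrable_finsetSum _ fun i _ => hdint i.succ),
            integral_finsetSum _ fun i _ => hdint i.succ]
      _ ≤ _ := by linarith

end ProductMeasures


/-! ### Measures of balls -/

section Balls

variable {d : ℕ}

theorem measureReal_closedBall_eq (x : E d) {r : ℝ} (hr : 0 ≤ r) :
    volume.real (Metric.closedBall x r) = r ^ d * volume.real (Metric.ball (0 : E d) 1) := by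
  rw [Measure.real, Measure.addHaar_closedBall volume x hr, ENNReal.toReal_mul,
    ENNReal.toReal_ofReal (by positivity), finrank_euclideanSpace_fin]
  rfl

theorem measureReal_unitBall_pos : 0 < volume.real (Metric.ball (0 : E d) 1) :=
  ENNReal.toReal_pos (Metric.measure_ball_pos volume _ one_pos).ne' measure_ball_lt_top.ne

theorem IsDensity.measureReal_le {P : Measure (E d)} {p : E d → ℝ} (hp : IsDensity P p)
    {𝒳 : Set (E d)} (h𝒳 : MeasurableSet 𝒳) (hP : P 𝒳ᶜ = 0) {b : ℝ} (hb : 0 ≤ b)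
    (hpb : ∀ x ∈ 𝒳, p x ≤ b) {B : Set (E d)} (hB : MeasurableSet B) (hBf : volume B ≠ ∞) :
    P.real B ≤ b * volume.real B := by
  have h : P B ≤ ENNReal.ofReal b * volume B := by
    calc P B ≤ P (B ∩ 𝒳) + P 𝒳ᶜ :=
          (measure_mono fun y hy => by by_cases hy' : y ∈ 𝒳 <;> simp [hy, hy']).trans
            (measure_union_le _ _)
      _ = ∫⁻ y in B ∩ 𝒳, ENNReal.ofReal (p y) := by
          rw [hP, add_zero]
          conv_lhs => rw [hp.eq]
          rw [withDensity_apply _ (hB.inter h𝒳)]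
      _ ≤ ∫⁻ _ in B ∩ 𝒳, ENNReal.ofReal b :=
          setLIntegral_mono measurable_const fun y hy => ENNReal.ofReal_le_ofReal (hpb y hy.2)
      _ ≤ ENNReal.ofReal b * volume B := by
          rw [setLIntegral_const]; gcongr; exact inter_subset_left
  have := ENNReal.toReal_mono (ENNReal.mul_ne_top ENNReal.ofReal_ne_top hBf) h
  rwa [ENNReal.toReal_mul, ENNReal.toReal_ofReal hb] at this

theorem exists_measureReal_closedBall_le {P : Measure (E d)} {p : E d → ℝ} (hp : IsDensity P p)
    {𝒳 : Set (E d)} (h𝒳 : MeasurableSet 𝒳) (hP : P 𝒳ᶜ = 0)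
    (hpb : ∃ b : ℝ, 0 < b ∧ ∀ x ∈ 𝒳, p x ≤ b) :
    ∃ C : ℝ, 0 < C ∧ ∀ x : E d, ∀ r : ℝ, 0 ≤ r → P.real (Metric.closedBall x r) ≤ C * r ^ d := by
  obtain ⟨b, hb, hpb⟩ := hpb
  refine ⟨b * volume.real (Metric.ball (0 : E d) 1), mul_pos hb measureReal_unitBall_pos,
    fun x r hr => ?_⟩
  refine (hp.measureReal_le h𝒳 hP hb.le hpb measurableSet_closedBall
    measure_closedBall_lt_top.ne).trans ?_
  rw [measureReal_closedBall_eq x hr]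
  exact le_of_eq (by ring)

/-- `BallVolume` keeps the lower bound uniform up to the boundary of `𝒳`, where part of the ball
carries no mass. -/
theorem exists_le_measureReal_closedBall {P : Measure (E d)} [IsFiniteMeasure P] {p : E d → ℝ}
    (hp : IsDensity P p) {𝒳 : Set (E d)} (h𝒳 : MeasurableSet 𝒳) (hX2 : BallVolume 𝒳)
    (hpinf : ∃ pinf : ℝ, 0 < pinf ∧ ∀ x ∈ 𝒳, pinf ≤ p x) :
    ∃ c : ℝ, 0 < c ∧ ∀ x ∈ 𝒳, ∀ r : ℝ, 0 ≤ r → r ≤ Metric.diam 𝒳 →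
      c * r ^ d ≤ P.real (Metric.closedBall x r) := by
  obtain ⟨b, hb, hpb⟩ := hpinf
  obtain ⟨c, hc, hvol⟩ := hX2
  refine ⟨b * c * volume.real (Metric.ball (0 : E d) 1),
    mul_pos (mul_pos hb hc) measureReal_unitBall_pos, fun x hx r hr hrd => ?_⟩
  have h : ENNReal.ofReal b * (ENNReal.ofReal c * volume (Metric.closedBall x r)) ≤
      P (Metric.closedBall x r) := by
    calc ENNReal.ofReal b * (ENNReal.ofReal c * volume (Metric.closedBall x r))
        ≤ ENNReal.ofReal b * volume (Metric.closedBall x r ∩ 𝒳) := by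
          gcongr; exact hvol x hx r hr hrd
      _ = ∫⁻ _ in Metric.closedBall x r ∩ 𝒳, ENNReal.ofReal b := by rw [setLIntegral_const]
      _ ≤ ∫⁻ y in Metric.closedBall x r ∩ 𝒳, ENNReal.ofReal (p y) :=
          setLIntegral_mono hp.measurable.ennreal_ofReal fun y hy =>
            ENNReal.ofReal_le_ofReal (hpb y hy.2)
      _ = P (Metric.closedBall x r ∩ 𝒳) := by
          conv_rhs => rw [hp.eq]
          rw [withDensity_apply _ (measurableSet_closedBall.inter h𝒳)]
      _ ≤ P (Metric.closedBall x r) := measure_mono inter_subset_left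
  have := ENNReal.toReal_mono (measure_ne_top _ _) h
  rw [ENNReal.toReal_mul, ENNReal.toReal_mul, ENNReal.toReal_ofReal hb.le,
    ENNReal.toReal_ofReal hc.le] at this
  refine le_trans (le_of_eq ?_) this
  rw [← Measure.real, measureReal_closedBall_eq x hr]
  ring

/-! ### Exponential moments of the nearest neighbour radius -/

theorem measurable_knnRadius {n k : ℕ} (hk : 1 ≤ k) (hkn : k ≤ n) :
    Measurable fun z : (Fin n → E d) × E d => knnRadius k z.1 z.2 := by
  simp only [knnRadius_eq_ordStat]
  exact measurable_ordStat hk (by simpa using hkn) fun i => by fun_prop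

theorem measurable_knnRadius_left {n k : ℕ} (hk : 1 ≤ k) (hkn : k ≤ n) (x : E d) :
    Measurable fun X : Fin n → E d => knnRadius k X x := by
  simp only [knnRadius_eq_ordStat]
  exact measurable_ordStat hk (by simpa using hkn) fun i => by fun_prop

theorem measurable_knnRadius_right {n k : ℕ} (hk : 1 ≤ k) (hkn : k ≤ n) (X : Fin n → E d) :
    Measurable fun x : E d => knnRadius k X x := by
  simp only [knnRadius_eq_ordStat]
  exact measurable_ordStat hk (by simpa using hkn) fun i => by fun_prop

theorem knnRadius_nonneg {n k : ℕ} (hk : 1 ≤ k) (hkn : k ≤ n) (X : Fin n → E d) (x : E d) :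
    0 ≤ knnRadius k X x := by
  rw [knnRadius_eq_ordStat]
  exact ordStat_nonneg hk (by simpa using hkn) fun i _ => norm_nonneg _

theorem knnRadius_le_diam {n k : ℕ} (hk : 1 ≤ k) (hkn : k ≤ n) {𝒳 : Set (E d)}
    (h𝒳 : Bornology.IsBounded 𝒳) {X : Fin n → E d} (hX : ∀ i, X i ∈ 𝒳) {x : E d} (hx : x ∈ 𝒳) :
    knnRadius k X x ≤ Metric.diam 𝒳 := by
  rw [knnRadius_eq_ordStat]
  refine ordStat_le_of_forall_le hk (by simpa using hkn) fun i _ => ?_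
  rw [← dist_eq_norm]
  exact Metric.dist_le_diam_of_mem h𝒳 (hX i) hx

theorem ae_pi_forall_mem {n : ℕ} {P : Measure (E d)} [IsProbabilityMeasure P] {𝒳 : Set (E d)}
    (hP : P 𝒳ᶜ = 0) : ∀ᵐ X ∂(Measure.pi fun _ : Fin n => P), ∀ i, X i ∈ 𝒳 := by
  rw [ae_all_iff]
  intro i
  have h := (measurePreserving_eval (fun _ : Fin n => P) i).quasiMeasurePreserving
  exact h.ae (p := fun y => y ∈ 𝒳) hP

theorem half_le_one_sub_exp_neg {y : ℝ} (hy0 : 0 ≤ y) (hy1 : y ≤ 1) :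
    y / 2 ≤ 1 - Real.exp (-y) := by
  have h1 : Real.exp (-y) ≤ 1 / (1 + y) := by
    rw [Real.exp_neg, ← one_div]
    apply one_div_le_one_div_of_le (by linarith)
    linarith [Real.add_one_le_exp y]
  have h2 : 1 / (1 + y) ≤ 1 - y / 2 := by
    rw [div_le_iff₀ (by linarith)]
    nlinarith
  linarith

/-- A Chernoff bound: a radius above `r` means fewer than `k` sample points in the ball, so the
indicator of this event is at most `e · exp (-count / k)`, and the exponential factorises over the
independent points. -/
theorem measureReal_lt_knnRadius_le_of_ball {n k : ℕ} (hk : 1 ≤ k) (hkn : k ≤ n)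
    {P : Measure (E d)} [IsProbabilityMeasure P] (x : E d) (r : ℝ) :
    (Measure.pi fun _ : Fin n => P).real {X | r < knnRadius k X x} ≤
      Real.exp 1 * Real.exp (-(n * P.real (Metric.closedBall x r) / (2 * k))) := by
  have hk0 : (0 : ℝ) < k := by exact_mod_cast hk
  have hk1 : (1 : ℝ) / k ≤ 1 := by
    rw [div_le_one hk0]; exact_mod_cast hk
  set B := Metric.closedBall x r
  -- With this `q`, the function `φ` below equals `exp (-1 / k)` on the ball and `1` off it.
  set q := 1 - Real.exp (-(1 / (k : ℝ))) with hq
  have hq0 : 1 / (2 * k) ≤ q := by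
    have := half_le_one_sub_exp_neg (y := 1 / (k : ℝ)) (by positivity) hk1
    rw [hq]; convert this using 1; field_simp
  have hq1 : q ≤ 1 := by rw [hq]; linarith [Real.exp_pos (-(1 / (k : ℝ)))]
  set φ : E d → ℝ := fun y => 1 - q * B.indicator (fun _ => (1 : ℝ)) y with hφ
  have hBm : MeasurableSet B := measurableSet_closedBall
  have hφm : Measurable φ :=
    measurable_const.sub ((measurable_const.indicator hBm).const_mul q)
  have hφint : ∫ y, φ y ∂P = 1 - q * P.real B := by
    rw [hφ, integral_sub (integrable_const _)
      (((integrable_const _).indicator hBm).const_mul q), integral_const_mul,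
      integral_indicator_const _ hBm]
    simp
  have hφ01 : ∀ y, 0 ≤ φ y ∧ φ y ≤ 1 := by
    intro y
    by_cases hy : y ∈ B
    · simp only [hφ, indicator_of_mem hy]
      have : 0 ≤ 1 / (2 * (k : ℝ)) := by positivity
      constructor <;> linarith
    · simp [hφ, indicator_of_notMem hy]
  have hmeas : MeasurableSet {X : Fin n → E d | r < knnRadius k X x} :=
    measurableSet_lt measurable_const (measurable_knnRadius_left hk hkn x)
  have hprodm : Measurable fun X : Fin n → E d => ∏ i, φ (X i) :=
    Finset.measurable_fun_prod _ fun i _ => hφm.comp (measurable_pi_apply i)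
  have hpt : ∀ X : Fin n → E d, {X | r < knnRadius k X x}.indicator (fun _ => (1 : ℝ)) X ≤
      Real.exp 1 * ∏ i, φ (X i) := by
    intro X
    have hφexp : ∀ i, φ (X i) = Real.exp (-(if ‖X i - x‖ ≤ r then 1 else 0) / k) := by
      intro i
      by_cases hi : ‖X i - x‖ ≤ r
      · have : X i ∈ B := by rw [Metric.mem_closedBall, dist_eq_norm]; exact hi
        simp only [hφ, indicator_of_mem this, hi, if_true, hq]
        rw [neg_div]; ring
      · have : X i ∉ B := by rw [Metric.mem_closedBall, dist_eq_norm]; exact hi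
        simp [hφ, indicator_of_notMem this, hi]
    by_cases hX : r < knnRadius k X x
    · rw [indicator_of_mem (show X ∈ {X | r < knnRadius k X x} from hX),
        Finset.prod_congr rfl (fun i _ => hφexp i), ← Real.exp_sum, ← Real.exp_add,
        Real.one_le_exp_iff, ← Finset.sum_div, Finset.sum_neg_distrib]
      have hcard : ((Finset.univ.filter (fun i => ‖X i - x‖ ≤ r)).card : ℝ) ≤ k := by
        rw [knnRadius_eq_ordStat, ← not_le, ordStat_le_iff hk (by simpa using hkn), not_le] at hX
        exact_mod_cast hX.le
      rw [Finset.card_filter] at hcard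
      push_cast at hcard
      rw [neg_div, ← sub_eq_add_neg, sub_nonneg, div_le_one hk0]
      exact hcard
    · rw [indicator_of_notMem (show X ∉ {X | r < knnRadius k X x} from hX)]
      exact mul_nonneg (Real.exp_pos _).le (Finset.prod_nonneg fun i _ => (hφ01 _).1)
  calc (Measure.pi fun _ : Fin n => P).real {X | r < knnRadius k X x}
      = ∫ X, {X | r < knnRadius k X x}.indicator (fun _ => (1 : ℝ)) X
          ∂(Measure.pi fun _ : Fin n => P) := by
        rw [integral_indicator_const _ hmeas]; simp
    _ ≤ ∫ X, Real.exp 1 * ∏ i, φ (X i) ∂(Measure.pi fun _ : Fin n => P) := by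
        refine integral_mono ((integrable_const _).indicator hmeas) ?_ hpt
        refine (integrable_of_abs_le hprodm (C := 1) fun X => ?_).const_mul _
        rw [Finset.abs_prod]
        exact Finset.prod_le_one (fun i _ => abs_nonneg _) fun i _ => by
          rw [abs_of_nonneg (hφ01 _).1]; exact (hφ01 _).2
    _ = Real.exp 1 * (1 - q * P.real B) ^ n := by
        rw [integral_const_mul, integral_fintype_prod_eq_prod (fun _ : Fin n => φ)]
        simp [hφint]
    _ ≤ Real.exp 1 * Real.exp (-(n * P.real B / (2 * k))) := by
        gcongr
        have hB0 : 0 ≤ P.real B := measureReal_nonneg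
        have hB1 : P.real B ≤ 1 := measureReal_le_one
        have hq0' : 0 ≤ 1 / (2 * (k : ℝ)) := by positivity
        have h0 : 0 ≤ 1 - q * P.real B := by nlinarith
        have h1 : 1 - q * P.real B ≤ Real.exp (-(P.real B / (2 * k))) := by
          have h2 := Real.add_one_le_exp (-(P.real B / (2 * k)))
          have h3 : P.real B / (2 * k) ≤ q * P.real B := by
            rw [div_eq_mul_one_div, mul_comm]
            exact mul_le_mul_of_nonneg_right hq0 hB0
          linarith
        refine (pow_le_pow_left₀ h0 h1 n).trans (le_of_eq ?_)
        rw [← Real.exp_nat_mul]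
        congr 1
        ring

theorem measureReal_lt_knnRadius_le {n k : ℕ} (hk : 1 ≤ k) (hkn : k ≤ n)
    {P : Measure (E d)} [IsProbabilityMeasure P] {𝒳 : Set (E d)} (h𝒳 : Bornology.IsBounded 𝒳)
    (hP : P 𝒳ᶜ = 0) {c : ℝ} (hc : ∀ x ∈ 𝒳, ∀ r : ℝ, 0 ≤ r → r ≤ Metric.diam 𝒳 →
      c * r ^ d ≤ P.real (Metric.closedBall x r)) {x : E d} (hx : x ∈ 𝒳) {r : ℝ} (hr : 0 ≤ r) :
    (Measure.pi fun _ : Fin n => P).real {X | r < knnRadius k X x} ≤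
      Real.exp 1 * Real.exp (-(c * n / (2 * k) * r ^ d)) := by
  rcases le_or_gt r (Metric.diam 𝒳) with hrd | hrd
  · refine (measureReal_lt_knnRadius_le_of_ball hk hkn x r).trans ?_
    gcongr
    have h := hc x hx r hr hrd
    calc c * n / (2 * k) * r ^ d = n * (c * r ^ d) / (2 * k) := by ring
      _ ≤ _ := by gcongr
  -- The lower bound on ball masses stops at the diameter, but beyond it the event is null.
  · have h0 : (Measure.pi fun _ : Fin n => P) {X | r < knnRadius k X x} = 0 := by
      refine measure_mono_null (fun X hX => ?_) (ae_pi_forall_mem (n := n) hP)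
      intro hX'
      exact absurd (knnRadius_le_diam hk hkn h𝒳 hX' hx) (not_le.2 (hrd.trans hX))
    rw [Measure.real, h0]
    simp only [ENNReal.toReal_zero]
    positivity

/-- The rate `c n / (4 k)` is half of the tail rate, so the exponential has tail `e · t ^ (-2)`. The
layer-cake formula then gives `1` from levels below `1` and `e` from those above. -/
theorem lintegral_exp_knnRadius_le (hd : 1 ≤ d) {n k : ℕ} (hk : 1 ≤ k) (hkn : k ≤ n)
    {P : Measure (E d)} [IsProbabilityMeasure P] {𝒳 : Set (E d)} (h𝒳 : Bornology.IsBounded 𝒳)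
    (hP : P 𝒳ᶜ = 0) {c : ℝ} (hc0 : 0 < c)
    (hc : ∀ x ∈ 𝒳, ∀ r : ℝ, 0 ≤ r → r ≤ Metric.diam 𝒳 →
      c * r ^ d ≤ P.real (Metric.closedBall x r)) {x : E d} (hx : x ∈ 𝒳) :
    ∫⁻ X, ENNReal.ofReal (Real.exp (c * n / (4 * k) * knnRadius k X x ^ d))
      ∂(Measure.pi fun _ : Fin n => P) ≤ ENNReal.ofReal (1 + Real.exp 1) := by
  have hk0 : (0 : ℝ) < k := by exact_mod_cast hk
  have hn0 : (0 : ℝ) < n := by exact_mod_cast hk.trans hkn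
  set lam := c * n / (4 * k) with hlam
  have hlam0 : 0 < lam := by positivity
  have hm := measurable_knnRadius_left (d := d) hk hkn x
  have htail : ∀ t : ℝ, 1 < t → (Measure.pi fun _ : Fin n => P)
      {X | t < Real.exp (lam * knnRadius k X x ^ d)} ≤
      ENNReal.ofReal (Real.exp 1 * t ^ (-2 : ℝ)) := by
    intro t ht
    have hlog : 0 < Real.log t := Real.log_pos ht
    set r := (Real.log t / lam) ^ (1 / (d : ℝ)) with hr
    have hr0 : 0 ≤ r := by positivity
    have hrd : r ^ d = Real.log t / lam := by
      rw [hr, one_div, Real.rpow_inv_natCast_pow (by positivity) (by omega)]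
    have hsub : {X : Fin n → E d | t < Real.exp (lam * knnRadius k X x ^ d)} ⊆
        {X | r < knnRadius k X x} := by
      intro X hX
      simp only [mem_ofPred_eq] at hX ⊢
      by_contra! hcon
      have h1 : knnRadius k X x ^ d ≤ r ^ d :=
        pow_le_pow_left₀ (knnRadius_nonneg hk hkn X x) hcon d
      rw [hrd, le_div_iff₀ hlam0] at h1
      have h2 : Real.exp (lam * knnRadius k X x ^ d) ≤ Real.exp (Real.log t) :=
        Real.exp_le_exp.2 (by linarith)
      rw [Real.exp_log (by linarith)] at h2
      linarith
    refine (measure_mono hsub).trans ?_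
    rw [← ofReal_measureReal]
    refine ENNReal.ofReal_le_ofReal
      ((measureReal_lt_knnRadius_le hk hkn h𝒳 hP hc hx hr0).trans (le_of_eq ?_))
    rw [hrd, Real.rpow_def_of_pos (by linarith), hlam]
    congr 2
    field_simp
    ring
  rw [lintegral_eq_lintegral_meas_lt _ (Filter.Eventually.of_forall fun X => (Real.exp_pos _).le)
    (Real.measurable_exp.comp ((hm.pow_const d).const_mul lam)).aemeasurable,
    ← Ioc_union_Ioi_eq_Ioi zero_le_one, lintegral_union measurableSet_Ioi
      (Ioc_disjoint_Ioi le_rfl), ENNReal.ofReal_add zero_le_one (Real.exp_pos 1).le]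
  gcongr
  · calc _ ≤ ∫⁻ _ in Ioc (0 : ℝ) 1, 1 := lintegral_mono fun t => prob_le_one
      _ = ENNReal.ofReal 1 := by simp
  · calc _ ≤ ∫⁻ t in Ioi (1 : ℝ), ENNReal.ofReal (Real.exp 1 * t ^ (-2 : ℝ)) :=
          setLIntegral_mono' measurableSet_Ioi fun t ht => htail t ht
      _ = ENNReal.ofReal (∫ t in Ioi (1 : ℝ), Real.exp 1 * t ^ (-2 : ℝ)) := by
          rw [ofReal_integral_eq_lintegral_ofReal]
          · exact (integrableOn_Ioi_rpow_of_lt (by norm_num) one_pos).const_mul _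
          · filter_upwards [ae_restrict_mem measurableSet_Ioi] with t ht
            have : (0 : ℝ) < t := lt_trans one_pos ht
            positivity
      _ = ENNReal.ofReal (Real.exp 1) := by
          rw [integral_const_mul, integral_Ioi_rpow_of_lt (by norm_num) one_pos]
          norm_num

theorem integrable_exp_knnRadius (hd : 1 ≤ d) {n k : ℕ} (hk : 1 ≤ k) (hkn : k ≤ n)
    {P : Measure (E d)} [IsProbabilityMeasure P] {𝒳 : Set (E d)} (h𝒳 : Bornology.IsBounded 𝒳)
    (hP : P 𝒳ᶜ = 0) {c : ℝ} (hc0 : 0 < c)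
    (hc : ∀ x ∈ 𝒳, ∀ r : ℝ, 0 ≤ r → r ≤ Metric.diam 𝒳 →
      c * r ^ d ≤ P.real (Metric.closedBall x r)) {x : E d} (hx : x ∈ 𝒳) :
    Integrable (fun X => Real.exp (c * n / (4 * k) * knnRadius k X x ^ d))
        (Measure.pi fun _ : Fin n => P) ∧
      ∫ X, Real.exp (c * n / (4 * k) * knnRadius k X x ^ d) ∂(Measure.pi fun _ : Fin n => P) ≤
        1 + Real.exp 1 := by
  have hle := lintegral_exp_knnRadius_le hd hk hkn h𝒳 hP hc0 hc hx
  have hm : Measurable fun X : Fin n → E d =>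
      Real.exp (c * n / (4 * k) * knnRadius k X x ^ d) :=
    Real.measurable_exp.comp (((measurable_knnRadius_left hk hkn x).pow_const d).const_mul _)
  have hnn : ∀ X : Fin n → E d, 0 ≤ Real.exp (c * n / (4 * k) * knnRadius k X x ^ d) :=
    fun X => (Real.exp_pos _).le
  refine ⟨⟨hm.aestronglyMeasurable, ?_⟩, ?_⟩
  · rw [hasFiniteIntegral_iff_ofReal (Filter.Eventually.of_forall hnn)]
    exact hle.trans_lt ENNReal.ofReal_lt_top
  · rw [integral_eq_lintegral_of_nonneg_ae (Filter.Eventually.of_forall hnn)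
      hm.aestronglyMeasurable]
    exact ENNReal.toReal_le_of_le_ofReal (by positivity) hle

end Balls


section Moments

variable {d : ℕ}

/-! ### Moments of the nearest neighbour radius -/

/-- For `v ≥ 1`, `v ≤ v ^ d` and one term of the exponential series suffices; for `v ≤ 1` the
right-hand side is at least `1`. -/
theorem pow_le_factorial_mul_exp (hd : 1 ≤ d) (s : ℕ) {v : ℝ} (hv : 0 ≤ v) :
    v ^ s ≤ (s.factorial * 2 ^ s : ℝ) * Real.exp (v ^ d / 2) := by
  have hf : (1 : ℝ) ≤ s.factorial * 2 ^ s := by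
    have h1 : (1 : ℝ) ≤ s.factorial := by exact_mod_cast s.factorial_pos
    have h2 : (1 : ℝ) ≤ 2 ^ s := one_le_pow₀ (by norm_num)
    nlinarith
  have he : (1 : ℝ) ≤ Real.exp (v ^ d / 2) := Real.one_le_exp (by positivity)
  rcases le_total v 1 with h1 | h1
  · calc v ^ s ≤ 1 := pow_le_one₀ hv h1
      _ ≤ _ := by nlinarith
  · have hvd : v ≤ v ^ d := le_self_pow₀ h1 (by omega)
    calc v ^ s ≤ (v ^ d) ^ s := pow_le_pow_left₀ hv hvd s
      _ = (s.factorial * 2 ^ s) * ((v ^ d / 2) ^ s / s.factorial) := by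
          have : (s.factorial : ℝ) ≠ 0 := by exact_mod_cast s.factorial_ne_zero
          rw [div_pow]
          field_simp
      _ ≤ _ := by
          gcongr
          exact Real.pow_div_factorial_le_exp _ (by positivity) s

theorem pow_le_mul_exp (hd : 1 ≤ d) (s : ℕ) {lam ε T : ℝ} (hε : 0 < ε) (hεl : lam * ε ^ d = 1)
    (hT : 0 ≤ T) : T ^ s ≤ (s.factorial * 2 ^ s : ℝ) * ε ^ s * Real.exp (lam * T ^ d / 2) := by
  have h := pow_le_factorial_mul_exp hd s (div_nonneg hT hε.le)
  have hlam : lam = 1 / ε ^ d := by field_simp; linarith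
  rw [div_pow, div_pow, div_le_iff₀ (by positivity)] at h
  refine h.trans (le_of_eq ?_)
  rw [hlam]
  ring_nf

/-- One half of the exponent `lam * T ^ d` absorbs the power of `T`, the other half pays for the
indicator of `δ ≤ T`. The resulting factor in `δ` is the integrand of `GeomCondition`. -/
theorem ite_pow_le_mul_exp (hd : 1 ≤ d) (s : ℕ) {lam ε T δ : ℝ} (hlam : 0 ≤ lam) (hε : 0 < ε)
    (hεl : lam * ε ^ d = 1) (hT : 0 ≤ T) (hδ : 0 ≤ δ) :
    (if δ ≤ T then T ^ s else 0) ≤ (s.factorial * 2 ^ s : ℝ) * ε ^ s *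
      Real.exp (-(lam / 2) * δ ^ d) * Real.exp (lam * T ^ d) := by
  split_ifs with h
  · refine (pow_le_mul_exp hd s hε hεl hT).trans ?_
    rw [mul_assoc _ (Real.exp _), ← Real.exp_add]
    gcongr
    have : δ ^ d ≤ T ^ d := pow_le_pow_left₀ hδ h d
    nlinarith
  · positivity

/-! ### Local averages over a ball -/

/-- The reflection `y ↦ 2x - y` preserves the ball and Lebesgue measure and changes the sign of the
integrand. -/
theorem setIntegral_closedBall_apply_sub (A : E d →L[ℝ] ℝ) (x : E d) (r : ℝ) :
    ∫ y in Metric.closedBall x r, A (y - x) = 0 := by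
  rw [← integral_indicator measurableSet_closedBall]
  set F : E d → ℝ := (Metric.closedBall x r).indicator fun y => A (y - x) with hF
  have h1 : ∫ y, F ((2 : ℝ) • x - y) = ∫ y, F y := integral_sub_left_eq_self F volume _
  have h2 : ∀ y, F ((2 : ℝ) • x - y) = -F y := by
    intro y
    have hsub : (2 : ℝ) • x - y - x = -(y - x) := by rw [two_smul]; abel
    have hmem : (2 : ℝ) • x - y ∈ Metric.closedBall x r ↔ y ∈ Metric.closedBall x r := by
      rw [Metric.mem_closedBall, Metric.mem_closedBall, dist_eq_norm, dist_eq_norm, hsub, norm_neg]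
    by_cases hy : y ∈ Metric.closedBall x r
    · rw [hF, indicator_of_mem hy, indicator_of_mem (hmem.2 hy), hsub, map_neg]
    · rw [hF, indicator_of_notMem hy, indicator_of_notMem (fun h => hy (hmem.1 h)), neg_zero]
  simp only [h2, integral_neg] at h1
  linarith

theorem closedBall_subset_of_lt_infDist {𝒳 : Set (E d)} {x : E d} {r : ℝ}
    (h : r < Metric.infDist x 𝒳ᶜ) : Metric.closedBall x r ⊆ 𝒳 := by
  intro y hy
  by_contra hcon
  have := Metric.infDist_le_dist_of_mem (x := x) (show y ∈ 𝒳ᶜ from hcon)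
  rw [Metric.mem_closedBall, dist_comm] at hy
  linarith

theorem abs_setIntegral_closedBall_le {P : Measure (E d)} [IsProbabilityMeasure P]
    {𝒳 : Set (E d)} (hP : P 𝒳ᶜ = 0) {CP M : ℝ} (hM : 0 ≤ M) {x : E d}
    (hCP : ∀ r : ℝ, 0 ≤ r → P.real (Metric.closedBall x r) ≤ CP * r ^ d) {φ : E d → ℝ}
    {s : ℕ} (hφ : ∀ u ∈ 𝒳, |φ u| ≤ M * ‖u - x‖ ^ s) {r : ℝ} (hr : 0 ≤ r) :
    |∫ y in Metric.closedBall x r, φ y ∂P| ≤ M * CP * r ^ (d + s) := by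
  have h1 : ‖∫ y in Metric.closedBall x r, φ y ∂P‖ ≤
      M * r ^ s * P.real (Metric.closedBall x r) := by
    refine norm_setIntegral_le_of_norm_le_const_ae (measure_lt_top _ _) ?_
    filter_upwards [ae_restrict_mem measurableSet_closedBall,
      ae_restrict_of_ae (show ∀ᵐ y ∂P, y ∈ 𝒳 from hP)] with y hy hy𝒳
    rw [Metric.mem_closedBall, dist_eq_norm] at hy
    refine (hφ y hy𝒳).trans ?_
    gcongr
  refine h1.trans ?_
  calc M * r ^ s * P.real (Metric.closedBall x r) ≤ M * r ^ s * (CP * r ^ d) := by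
        gcongr; exact hCP r hr
    _ = _ := by ring

/-- Against the frozen density `p x` the integral vanishes by symmetry. What remains carries the
increment `p y - p x`, at most `K r`, and so gains one power of `r` over the trivial bound. -/
theorem abs_setIntegral_closedBall_apply_sub_le {P : Measure (E d)} [IsProbabilityMeasure P]
    {p : E d → ℝ} (hp : IsDensity P p) {𝒳 : Set (E d)} {K : NNReal} (hK : LipschitzOnWith K p 𝒳)
    {M : ℝ} {A : E d →L[ℝ] ℝ} (hA : ‖A‖ ≤ M) {x : E d} {r : ℝ} (hr : 0 ≤ r)
    (hB : Metric.closedBall x r ⊆ 𝒳) :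
    |∫ y in Metric.closedBall x r, A (y - x) ∂P| ≤
      M * (K * volume.real (Metric.ball (0 : E d) 1)) * r ^ (d + 2) := by
  have hx : x ∈ 𝒳 := hB (Metric.mem_closedBall_self hr)
  have hM : 0 ≤ M := (norm_nonneg _).trans hA
  have hcont : ContinuousOn p (Metric.closedBall x r) := (hK.mono hB).continuousOn
  have hAc : Continuous fun y => A (y - x) := by fun_prop
  have hcomp : IsCompact (Metric.closedBall x r) := isCompact_closedBall x r
  have hi1 : IntegrableOn (fun y => p y * A (y - x)) (Metric.closedBall x r) volume :=
    (hcont.mul hAc.continuousOn).integrableOn_compact hcomp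
  have hi2 : IntegrableOn (fun y => p x * A (y - x)) (Metric.closedBall x r) volume :=
    (hAc.continuousOn.integrableOn_compact hcomp).const_mul _
  have h1 : ∫ y in Metric.closedBall x r, A (y - x) ∂P =
      ∫ y in Metric.closedBall x r, (p y - p x) * A (y - x) := by
    have h2 : ∫ y in Metric.closedBall x r, A (y - x) ∂P =
        ∫ y in Metric.closedBall x r, p y * A (y - x) := by
      conv_lhs => rw [hp.eq]
      rw [setIntegral_withDensity_eq_setIntegral_toReal_smul hp.measurable.ennreal_ofReal
        (Filter.Eventually.of_forall fun _ => ENNReal.ofReal_lt_top) _ measurableSet_closedBall]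
      simp only [ENNReal.toReal_ofReal (hp.nonneg _), smul_eq_mul]
    have h3 : ∫ y in Metric.closedBall x r, p x * A (y - x) = 0 := by
      rw [integral_const_mul, setIntegral_closedBall_apply_sub, mul_zero]
    simp only [sub_mul]
    rw [integral_sub hi1 hi2, h3, sub_zero, h2]
  rw [h1]
  have h4 : ‖∫ y in Metric.closedBall x r, (p y - p x) * A (y - x)‖ ≤
      (K * r) * (M * r) * volume.real (Metric.closedBall x r) := by
    refine norm_setIntegral_le_of_norm_le_const measure_closedBall_lt_top fun y hy => ?_
    have hy' := hy
    rw [Metric.mem_closedBall] at hy'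
    rw [norm_mul]
    gcongr
    · rw [← dist_eq_norm]
      exact (hK.dist_le_mul y (hB hy) x hx).trans (by gcongr)
    · refine (A.le_opNorm _).trans ?_
      rw [← dist_eq_norm]
      gcongr
  refine h4.trans (le_of_eq ?_)
  rw [measureReal_closedBall_eq x hr]
  ring

/-- First-order local approximation of a two-point function, vanishing off `𝒳 × 𝒳`. -/
structure IsLocalIncrement (𝒳 : Set (E d)) (M : ℝ) (Φ : E d → E d → ℝ) : Prop where
  measurable : Measurable (Function.uncurry Φ)
  eq_zero : ∀ x u, ¬(x ∈ 𝒳 ∧ u ∈ 𝒳) → Φ x u = 0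
  abs_le : ∀ x ∈ 𝒳, ∀ u ∈ 𝒳, |Φ x u| ≤ M * ‖u - x‖
  taylor : ∀ x ∈ 𝒳, ∃ A : E d →L[ℝ] ℝ, ‖A‖ ≤ M ∧
    ∀ u ∈ 𝒳, |Φ x u - A (u - x)| ≤ M * ‖u - x‖ ^ 2

theorem IsLocalIncrement.nonneg {𝒳 : Set (E d)} {M : ℝ} {Φ : E d → E d → ℝ}
    (hΦ : IsLocalIncrement 𝒳 M Φ) {x : E d} (hx : x ∈ 𝒳) : 0 ≤ M :=
  let ⟨_, hA, _⟩ := hΦ.taylor x hx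
  (norm_nonneg _).trans hA

theorem IsLocalIncrement.abs_le_diam {𝒳 : Set (E d)} {M : ℝ} {Φ : E d → E d → ℝ}
    (hΦ : IsLocalIncrement 𝒳 M Φ) (hM : 0 ≤ M) (h𝒳 : Bornology.IsBounded 𝒳) (x u : E d) :
    |Φ x u| ≤ M * Metric.diam 𝒳 := by
  by_cases h : x ∈ 𝒳 ∧ u ∈ 𝒳
  · refine (hΦ.abs_le x h.1 u h.2).trans ?_
    rw [← dist_eq_norm]
    gcongr
    exact Metric.dist_le_diam_of_mem h𝒳 h.2 h.1
  · rw [hΦ.eq_zero x u h, abs_zero]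
    exact mul_nonneg hM Metric.diam_nonneg

/-- In a ball inside `𝒳` the linear part cancels to order `r ^ (d + 2)` and the Taylor remainder has
the same order. In a ball that may leave `𝒳` there is no symmetry, and the Lipschitz bound on `Φ x`
costs one power of `r`. -/
theorem IsLocalIncrement.abs_setIntegral_le {P : Measure (E d)} [IsProbabilityMeasure P]
    {p : E d → ℝ} (hp : IsDensity P p) {𝒳 : Set (E d)} (h𝒳 : Bornology.IsBounded 𝒳)
    (hP : P 𝒳ᶜ = 0) {K : NNReal}
    (hK : LipschitzOnWith K p 𝒳) {CP M : ℝ} (hCP0 : 0 ≤ CP)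
    (hCP : ∀ x : E d, ∀ r : ℝ, 0 ≤ r → P.real (Metric.closedBall x r) ≤ CP * r ^ d)
    {Φ : E d → E d → ℝ} (hΦ : IsLocalIncrement 𝒳 M Φ) {x : E d} (hx : x ∈ 𝒳) {r : ℝ}
    (hr : 0 ≤ r) :
    |∫ y in Metric.closedBall x r, Φ x y ∂P| ≤
      M * (CP + K * volume.real (Metric.ball (0 : E d) 1)) *
        (r ^ (d + 2) + if Metric.infDist x 𝒳ᶜ ≤ r then r ^ (d + 1) else 0) := by
  have hM := hΦ.nonneg hx
  have hv := measureReal_unitBall_pos (d := d)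
  rcases lt_or_ge r (Metric.infDist x 𝒳ᶜ) with hlt | hge
  · rw [if_neg (not_le.2 hlt), add_zero]
    obtain ⟨A, hA, htay⟩ := hΦ.taylor x hx
    have hAm : Measurable fun y => A (y - x) := by fun_prop
    have hΦm : Measurable (Φ x) := hΦ.measurable.comp measurable_prodMk_left
    have hi1 : IntegrableOn (fun y => Φ x y) (Metric.closedBall x r) P :=
      integrable_of_abs_le hΦm (hΦ.abs_le_diam hM h𝒳 x)
    have hi2 : IntegrableOn (fun y => A (y - x)) (Metric.closedBall x r) P := by
      have hAc : Continuous fun y => A (y - x) := by fun_prop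
      exact hAc.continuousOn.integrableOn_compact (isCompact_closedBall x r)
    have hsplit : ∫ y in Metric.closedBall x r, Φ x y ∂P =
        (∫ y in Metric.closedBall x r, (Φ x y - A (y - x)) ∂P) +
          ∫ y in Metric.closedBall x r, A (y - x) ∂P := by
      rw [integral_sub hi1 hi2]; ring
    rw [hsplit]
    refine (abs_add_le _ _).trans ?_
    have h1 := abs_setIntegral_closedBall_le hP hM (hCP x) htay hr
    have h2 := abs_setIntegral_closedBall_apply_sub_le hp hK hA hr
      (closedBall_subset_of_lt_infDist hlt)
    calc _ ≤ _ := add_le_add h1 h2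
      _ = _ := by ring
  · rw [if_pos hge]
    have h1 := abs_setIntegral_closedBall_le hP hM (hCP x) (φ := Φ x) (s := 1)
      (by simpa using hΦ.abs_le x hx) hr
    refine h1.trans ?_
    gcongr
    · exact le_add_of_nonneg_right (by positivity)
    · exact le_add_of_nonneg_left (by positivity)

end Moments


section NearestNeighbourBias

variable {d n : ℕ}

/-! ### Nearest neighbour sums -/

/-- The sum of `Φ x (X i)` over the `k` nearest neighbours `X i`, `i ∈ s`, of `x`. -/
def nnSum (s : Finset (Fin n)) (k : ℕ) (Φ : E d → E d → ℝ) (X : Fin n → E d) (x : E d) : ℝ :=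
  ∑ i ∈ s.filter (fun i => ‖X i - x‖ ≤ ordStat s k (fun j => ‖X j - x‖)), Φ x (X i)

/-- The nearest neighbour average of `Φ x (X i)`, averaged over `x ∼ Q`. -/
def nnBias (s : Finset (Fin n)) (k : ℕ) (Q : Measure (E d)) (Φ : E d → E d → ℝ)
    (X : Fin n → E d) : ℝ :=
  ∫ x, (k : ℝ)⁻¹ * nnSum s k Φ X x ∂Q

theorem nnSum_eq_sum_ite (s : Finset (Fin n)) (k : ℕ) (Φ : E d → E d → ℝ) (X : Fin n → E d)
    (x : E d) : nnSum s k Φ X x =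
      ∑ i ∈ s, if ‖X i - x‖ ≤ ordStat s k (fun j => ‖X j - x‖) then Φ x (X i) else 0 := by
  rw [nnSum, Finset.sum_filter]

theorem measurable_nnSum {s : Finset (Fin n)} {k : ℕ} (hk : 1 ≤ k) (hks : k ≤ s.card)
    {Φ : E d → E d → ℝ} (hΦ : Measurable (Function.uncurry Φ)) :
    Measurable fun z : (Fin n → E d) × E d => nnSum s k Φ z.1 z.2 := by
  simp only [nnSum_eq_sum_ite]
  refine Finset.measurable_fun_sum _ fun i _ => ?_
  have h1 : Measurable fun z : (Fin n → E d) × E d => ordStat s k (fun j => ‖z.1 j - z.2‖) :=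
    measurable_ordStat hk hks fun i => by fun_prop
  have h2 : Measurable fun z : (Fin n → E d) × E d => ‖z.1 i - z.2‖ := by fun_prop
  have h3 : Measurable fun z : (Fin n → E d) × E d => (z.2, z.1 i) := by fun_prop
  exact Measurable.ite (measurableSet_le h2 h1) (hΦ.comp h3) measurable_const

theorem abs_nnSum_le {s : Finset (Fin n)} {k : ℕ} {Φ : E d → E d → ℝ} {D : ℝ}
    (hΦ : ∀ x u, |Φ x u| ≤ D) (X : Fin n → E d) (x : E d) : |nnSum s k Φ X x| ≤ n * D := by
  have hD : 0 ≤ D := (abs_nonneg _).trans (hΦ x x)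
  refine (Finset.abs_sum_le_sum_abs _ _).trans ((Finset.sum_le_card_nsmul _ _ D
    fun i _ => hΦ _ _).trans ?_)
  rw [nsmul_eq_mul]
  gcongr
  simpa using Finset.card_le_univ (s.filter _)

theorem measurable_nnBias {s : Finset (Fin n)} {k : ℕ} (hk : 1 ≤ k) (hks : k ≤ s.card)
    {Φ : E d → E d → ℝ} (hΦ : Measurable (Function.uncurry Φ)) (Q : Measure (E d)) [SFinite Q] :
    Measurable (nnBias s k Q Φ : (Fin n → E d) → ℝ) :=
  (((measurable_nnSum hk hks hΦ).const_mul
    (k : ℝ)⁻¹).stronglyMeasurable.integral_prod_right).measurable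

theorem abs_nnBias_le {s : Finset (Fin n)} {k : ℕ} {Φ : E d → E d → ℝ} {D : ℝ}
    (hΦ : ∀ x u, |Φ x u| ≤ D) (Q : Measure (E d)) [IsProbabilityMeasure Q] (X : Fin n → E d) :
    |nnBias s k Q Φ X| ≤ (k : ℝ)⁻¹ * (n * D) := by
  refine (norm_integral_le_of_norm_le_const (f := fun x => (k : ℝ)⁻¹ * nnSum s k Φ X x)
    (C := (k : ℝ)⁻¹ * (n * D)) (Filter.Eventually.of_forall fun x => ?_)).trans (by simp)
  rw [Real.norm_eq_abs, abs_mul, abs_of_nonneg (by positivity : 0 ≤ (k : ℝ)⁻¹)]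
  gcongr
  exact abs_nnSum_le hΦ X x

/-- Supplies the invariance that `efron_stein` asks of the leave-one-out functionals. -/
theorem nnSum_erase_update (k : ℕ) (Φ : E d → E d → ℝ) (X : Fin n → E d) (i : Fin n)
    (y x : E d) : nnSum (Finset.univ.erase i) k Φ (Function.update X i y) x =
      nnSum (Finset.univ.erase i) k Φ X x := by
  have hX : ∀ j ∈ Finset.univ.erase i, Function.update X i y j = X j := fun j hj =>
    Function.update_of_ne (Finset.ne_of_mem_erase hj) _ _
  rw [nnSum_eq_sum_ite, nnSum_eq_sum_ite]
  have hord := ordStat_congr (k := k) (s := Finset.univ.erase i)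
    (a := fun j => ‖Function.update X i y j - x‖) (b := fun j => ‖X j - x‖)
    fun j hj => by rw [hX j hj]
  rw [hord]
  exact Finset.sum_congr rfl fun j hj => by rw [hX j hj]

theorem nnBias_erase_update (k : ℕ) (Q : Measure (E d)) (Φ : E d → E d → ℝ) (X : Fin n → E d)
    (i : Fin n) (y : E d) : nnBias (Finset.univ.erase i) k Q Φ (Function.update X i y) =
      nnBias (Finset.univ.erase i) k Q Φ X := by
  simp only [nnBias, nnSum_erase_update]

/-! ### Absence of ties -/

/-- Given the other points, a tie forces `X i` onto a sphere around `x`, which is Lebesgue null. -/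
theorem ae_norm_sub_ne (hd : 1 ≤ d) {P : Measure (E d)} [IsProbabilityMeasure P]
    (hP : P ≪ volume) {i j : Fin n} (hij : i ≠ j) (x : E d) :
    ∀ᵐ X ∂(Measure.pi fun _ : Fin n => P), ‖X i - x‖ ≠ ‖X j - x‖ := by
  have : Nonempty (Fin d) := ⟨⟨0, hd⟩⟩
  have hmeas : MeasurableSet {X : Fin n → E d | ‖X i - x‖ ≠ ‖X j - x‖} :=
    (measurableSet_eq_fun (by fun_prop) (by fun_prop)).compl
  rw [← (measurePreserving_update P i).map_eq,
    ae_map_iff (measurePreserving_update P i).measurable.aemeasurable hmeas]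
  have hmeas' : MeasurableSet {z : (Fin n → E d) × E d |
      ‖Function.update z.1 i z.2 i - x‖ ≠ ‖Function.update z.1 i z.2 j - x‖} :=
    (measurePreserving_update P i).measurable hmeas
  rw [Measure.ae_prod_iff_ae_ae hmeas']
  refine Filter.Eventually.of_forall fun X => ?_
  have h0 : P (Metric.sphere x ‖X j - x‖) = 0 := hP (Measure.addHaar_sphere _ _ _)
  refine measure_mono_null (fun y hy => ?_) h0
  simp only [ne_eq, mem_compl_iff, mem_ofPred_eq, not_not, Function.update_self,
    Function.update_of_ne hij.symm] at hy
  rw [mem_sphere_iff_norm]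
  exact hy

theorem ae_ae_injective_norm_sub (hd : 1 ≤ d) {P Q : Measure (E d)} [IsProbabilityMeasure P]
    [IsProbabilityMeasure Q] (hP : P ≪ volume) :
    ∀ᵐ X ∂(Measure.pi fun _ : Fin n => P), ∀ᵐ x ∂Q,
      Function.Injective fun i => ‖X i - x‖ := by
  have h : ∀ i j : Fin n, ∀ᵐ X ∂(Measure.pi fun _ : Fin n => P), ∀ᵐ x ∂Q,
      i ≠ j → ‖X i - x‖ ≠ ‖X j - x‖ := by
    intro i j
    by_cases hij : i = j
    · simp [hij]
    · have hmeas : MeasurableSet {z : (Fin n → E d) × E d | ‖z.1 i - z.2‖ ≠ ‖z.1 j - z.2‖} :=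
        (measurableSet_eq_fun (by fun_prop) (by fun_prop)).compl
      have := (Measure.ae_ae_comm (μ := Measure.pi fun _ : Fin n => P) (ν := Q) hmeas).2
        (Filter.Eventually.of_forall fun x => ae_norm_sub_ne hd hP hij x)
      filter_upwards [this] with X hX
      filter_upwards [hX] with x hx _ using hx
  have h' := ae_all_iff.2 fun i => ae_all_iff.2 (h i)
  filter_upwards [h'] with X hX
  have hX' := ae_all_iff.2 fun i => ae_all_iff.2 (hX i)
  filter_upwards [hX'] with x hx i j hij
  by_contra hne
  exact hx i j hne hij

/-! ### The mean -/

/-- By `le_ordStat_iff_le_ordStat_erase` the threshold may be computed from the other points alone.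
It is then independent of `X i`, and integrating `X i` out leaves an integral over a ball whose
radius does not involve `X i`. -/
theorem integral_ite_knnRadius {k : ℕ} (hk : 1 ≤ k) (hkn : k + 1 ≤ n) (P : Measure (E d))
    [IsProbabilityMeasure P] {φ : E d → ℝ} (hφ : Measurable φ) {D : ℝ} (hD : ∀ u, |φ u| ≤ D)
    (x : E d) (i : Fin n) :
    ∫ X, (if ‖X i - x‖ ≤ ordStat Finset.univ k (fun j => ‖X j - x‖) then φ (X i) else 0)
        ∂(Measure.pi fun _ : Fin n => P) =
      ∫ X, ∫ y in Metric.closedBall x (ordStat (Finset.univ.erase i) k fun j => ‖X j - x‖), φ y ∂P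
        ∂(Measure.pi fun _ : Fin n => P) := by
  have hiff : ∀ X : Fin n → E d, ‖X i - x‖ ≤ ordStat Finset.univ k (fun j => ‖X j - x‖) ↔
      ‖X i - x‖ ≤ ordStat (Finset.univ.erase i) k (fun j => ‖X j - x‖) := fun X =>
    le_ordStat_iff_le_ordStat_erase (a := fun j => ‖X j - x‖) hk (Finset.mem_univ i)
      (by simpa using hkn)
  simp only [hiff]
  set R : (Fin n → E d) → ℝ := fun X => ordStat (Finset.univ.erase i) k fun j => ‖X j - x‖ with hR
  have hRm : Measurable R := measurable_ordStat hk
    (by rw [Finset.card_erase_of_mem (Finset.mem_univ i)]; simp; omega) fun i => by fun_prop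
  have hRu : ∀ X y, R (Function.update X i y) = R X := fun X y =>
    ordStat_congr fun j hj => by rw [Function.update_of_ne (Finset.ne_of_mem_erase hj)]
  have h2 : Measurable fun X : Fin n → E d => ‖X i - x‖ := by fun_prop
  set F : (Fin n → E d) → ℝ := fun X => if ‖X i - x‖ ≤ R X then φ (X i) else 0 with hF
  have hFm : Measurable F := Measurable.ite (measurableSet_le h2 hRm)
    (hφ.comp (measurable_pi_apply i)) measurable_const
  have hFD : ∀ X, |F X| ≤ D := by
    intro X
    simp only [hF]
    split_ifs
    · exact hD _
    · rw [abs_zero]; exact (abs_nonneg _).trans (hD x)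
  have hmp := measurePreserving_update P i
  have h3 : ∫ X, F X ∂(Measure.pi fun _ : Fin n => P) =
      ∫ z, F (Function.update z.1 i z.2) ∂((Measure.pi fun _ : Fin n => P).prod P) := by
    conv_lhs => rw [← hmp.map_eq]
    rw [integral_map hmp.measurable.aemeasurable hFm.aestronglyMeasurable]
  change ∫ X, F X ∂_ = _
  have hFi : Integrable (fun z : (Fin n → E d) × E d => F (Function.update z.1 i z.2))
      ((Measure.pi fun _ : Fin n => P).prod P) :=
    integrable_of_abs_le (hFm.comp hmp.measurable) fun z => hFD _
  rw [h3, integral_prod _ hFi]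
  congr 1
  ext X
  rw [← integral_indicator measurableSet_closedBall]
  congr 1
  ext y
  have hRu' := hRu X y
  simp only [hR] at hRu'
  simp only [hF, hR, hRu', Function.update_self, indicator, Metric.mem_closedBall, dist_eq_norm]

/-- Moments of the nearest neighbour radius, in units of `ε = (4 k / (c n)) ^ (1 / d)`. -/
theorem integral_pow_knnRadius_le (hd : 1 ≤ d) {k : ℕ} (hk : 1 ≤ k) (hkn : k ≤ n)
    {P : Measure (E d)} [IsProbabilityMeasure P] {𝒳 : Set (E d)} (h𝒳 : Bornology.IsBounded 𝒳)
    (hP : P 𝒳ᶜ = 0) {c : ℝ} (hc0 : 0 < c)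
    (hc : ∀ x ∈ 𝒳, ∀ r : ℝ, 0 ≤ r → r ≤ Metric.diam 𝒳 →
      c * r ^ d ≤ P.real (Metric.closedBall x r)) {x : E d} (hx : x ∈ 𝒳) {ε : ℝ} (hε : 0 < ε)
    (hεl : c * n / (4 * k) * ε ^ d = 1) (s : ℕ) :
    ∫ X, knnRadius k X x ^ s ∂(Measure.pi fun _ : Fin n => P) ≤
      (s.factorial * 2 ^ s : ℝ) * ε ^ s * (1 + Real.exp 1) := by
  obtain ⟨hint, hle⟩ := integrable_exp_knnRadius hd hk hkn h𝒳 hP hc0 hc hx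
  have hpt : ∀ X : Fin n → E d, knnRadius k X x ^ s ≤ (s.factorial * 2 ^ s : ℝ) * ε ^ s *
      Real.exp (c * n / (4 * k) * knnRadius k X x ^ d) := by
    intro X
    have hT := knnRadius_nonneg hk hkn X x
    refine (pow_le_mul_exp hd s hε hεl hT).trans ?_
    gcongr
    exact half_le_self (by positivity)
  calc ∫ X, knnRadius k X x ^ s ∂(Measure.pi fun _ : Fin n => P)
      ≤ ∫ X, (s.factorial * 2 ^ s : ℝ) * ε ^ s *
        Real.exp (c * n / (4 * k) * knnRadius k X x ^ d) ∂(Measure.pi fun _ : Fin n => P) :=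
        integral_mono_of_nonneg (Filter.Eventually.of_forall fun X =>
          pow_nonneg (knnRadius_nonneg hk hkn X x) s) (hint.const_mul _)
          (Filter.Eventually.of_forall hpt)
    _ ≤ _ := by
        rw [integral_const_mul]
        gcongr

/-- Each of the `n` summands is the mean of a ball integral with the leave-one-out radius. That
radius is at most the `(k + 1)`-st radius of the full sample, which is why `lam` is built with `k +
1`: this is the radius whose exponential moment gets used. -/
theorem abs_integral_nnSum_le (hd : 1 ≤ d) {k : ℕ} (hk : 1 ≤ k) (hkn : k + 1 ≤ n)
    {P : Measure (E d)} [IsProbabilityMeasure P] {p : E d → ℝ} (hp : IsDensity P p)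
    {𝒳 : Set (E d)} (h𝒳 : Bornology.IsBounded 𝒳) (hP : P 𝒳ᶜ = 0) {K : NNReal}
    (hK : LipschitzOnWith K p 𝒳) {CP M c : ℝ} (hCP0 : 0 ≤ CP)
    (hCP : ∀ x : E d, ∀ r : ℝ, 0 ≤ r → P.real (Metric.closedBall x r) ≤ CP * r ^ d)
    (hc0 : 0 < c) (hc : ∀ x ∈ 𝒳, ∀ r : ℝ, 0 ≤ r → r ≤ Metric.diam 𝒳 →
      c * r ^ d ≤ P.real (Metric.closedBall x r))
    {Φ : E d → E d → ℝ} (hΦ : IsLocalIncrement 𝒳 M Φ) {x : E d} (hx : x ∈ 𝒳) {lam ε : ℝ}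
    (hε : 0 < ε) (hlam : lam = c * n / (4 * (k + 1 : ℕ))) (hεl : lam * ε ^ d = 1) :
    |∫ X, nnSum Finset.univ k Φ X x ∂(Measure.pi fun _ : Fin n => P)| ≤
      n * (M * (CP + K * volume.real (Metric.ball (0 : E d) 1)) *
        ((d + 2).factorial * 2 ^ (d + 2) : ℝ) * (1 + Real.exp 1) *
        (ε ^ (d + 2) + ε ^ (d + 1) * Real.exp (-(lam / 2) * Metric.infDist x 𝒳ᶜ ^ d))) := by
  have hM := hΦ.nonneg hx
  have hv := measureReal_unitBall_pos (d := d)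
  set C₀ := M * (CP + K * volume.real (Metric.ball (0 : E d) 1)) with hC₀
  have hC₀0 : 0 ≤ C₀ := by positivity
  set F₀ : ℝ := ((d + 2).factorial * 2 ^ (d + 2) : ℝ) with hF₀
  -- One constant serves both the interior power `d + 2` and the boundary power `d + 1`.
  have hF₁ : ((d + 1).factorial * 2 ^ (d + 1) : ℝ) ≤ F₀ := by
    rw [hF₀]
    gcongr
    · norm_num
    · norm_num
    · norm_num
  set δ := Metric.infDist x 𝒳ᶜ with hδ
  have hδ0 : 0 ≤ δ := Metric.infDist_nonneg
  have hlam0 : 0 ≤ lam := by rw [hlam]; positivity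
  obtain ⟨hint, hle⟩ := integrable_exp_knnRadius hd (by omega : 1 ≤ k + 1) hkn h𝒳 hP hc0 hc hx
  rw [← hlam] at hint hle
  have hΦm : Measurable (Φ x) := hΦ.measurable.comp measurable_prodMk_left
  have hΦD := hΦ.abs_le_diam hM h𝒳
  have hterm : ∀ i : Fin n, |∫ X, (if ‖X i - x‖ ≤ ordStat Finset.univ k (fun j => ‖X j - x‖)
      then Φ x (X i) else 0) ∂(Measure.pi fun _ : Fin n => P)| ≤
      C₀ * F₀ * (1 + Real.exp 1) *
        (ε ^ (d + 2) + ε ^ (d + 1) * Real.exp (-(lam / 2) * δ ^ d)) := by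
    intro i
    rw [integral_ite_knnRadius hk hkn P hΦm (hΦD x) x i]
    have hpt : ∀ X : Fin n → E d,
        ‖∫ y in Metric.closedBall x (ordStat (Finset.univ.erase i) k fun j => ‖X j - x‖),
          Φ x y ∂P‖ ≤ C₀ * F₀ * (ε ^ (d + 2) + ε ^ (d + 1) * Real.exp (-(lam / 2) * δ ^ d)) *
            Real.exp (lam * knnRadius (k + 1) X x ^ d) := by
      intro X
      set R := ordStat (Finset.univ.erase i) k fun j => ‖X j - x‖
      set T := knnRadius (k + 1) X x with hT
      have hR0 : 0 ≤ R := ordStat_nonneg hk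
        (by rw [Finset.card_erase_of_mem (Finset.mem_univ i)]; simp; omega)
        fun j _ => norm_nonneg _
      have hRT : R ≤ T := by
        rw [hT, knnRadius_eq_ordStat]
        exact ordStat_erase_le hk (Finset.mem_univ i) (by simpa using hkn)
      have hT0 := hR0.trans hRT
      have h1 := hΦ.abs_setIntegral_le hp h𝒳 hP hK hCP0 hCP hx hR0
      have h2 : (if δ ≤ R then R ^ (d + 1) else 0) ≤ if δ ≤ T then T ^ (d + 1) else 0 := by
        split_ifs with h3 h4 h4
        · gcongr
        · exact absurd (h3.trans hRT) h4
        · positivity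
        · exact le_rfl
      have h3 := ite_pow_le_mul_exp hd (d + 1) hlam0 hε hεl hT0 hδ0
      -- Taking `δ = 0` makes the indicator always true and gives the plain power bound.
      have h4 := ite_pow_le_mul_exp hd (d + 2) hlam0 hε hεl hT0 le_rfl
      rw [if_pos hT0, zero_pow (by omega), mul_zero, Real.exp_zero, mul_one] at h4
      have h5 : ((d + 1).factorial * 2 ^ (d + 1) : ℝ) * ε ^ (d + 1) *
          Real.exp (-(lam / 2) * δ ^ d) * Real.exp (lam * T ^ d) ≤
          F₀ * ε ^ (d + 1) * Real.exp (-(lam / 2) * δ ^ d) * Real.exp (lam * T ^ d) := by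
        gcongr
      have h6 : R ^ (d + 2) ≤ T ^ (d + 2) := by gcongr
      calc _ ≤ _ := h1
        _ ≤ C₀ * (F₀ * ε ^ (d + 2) * Real.exp (lam * T ^ d) +
            F₀ * ε ^ (d + 1) * Real.exp (-(lam / 2) * δ ^ d) * Real.exp (lam * T ^ d)) := by
          refine mul_le_mul_of_nonneg_left ?_ hC₀0
          exact add_le_add (h6.trans h4) (h2.trans (h3.trans h5))
        _ = _ := by ring
    refine (norm_integral_le_of_norm_le (hint.const_mul _)
      (Filter.Eventually.of_forall hpt)).trans ?_
    rw [integral_const_mul]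
    calc _ ≤ C₀ * F₀ * (ε ^ (d + 2) + ε ^ (d + 1) * Real.exp (-(lam / 2) * δ ^ d)) *
          (1 + Real.exp 1) := by gcongr
      _ = _ := by ring
  simp only [nnSum_eq_sum_ite]
  rw [integral_finsetSum]
  · refine (Finset.abs_sum_le_sum_abs _ _).trans ((Finset.sum_le_card_nsmul _ _ _
      fun i _ => hterm i).trans ?_)
    simp
  · intro i _
    have h1 : Measurable fun X : Fin n → E d => ordStat Finset.univ k (fun j => ‖X j - x‖) :=
      measurable_ordStat hk (by simp; omega) fun i => by fun_prop
    have h2 : Measurable fun X : Fin n → E d => ‖X i - x‖ := by fun_prop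
    refine integrable_of_abs_le (C := M * Metric.diam 𝒳) (Measurable.ite (measurableSet_le h2 h1)
      (hΦm.comp (measurable_pi_apply i)) measurable_const) fun X => ?_
    split_ifs
    · exact hΦD _ _
    · rw [abs_zero]; exact (abs_nonneg _).trans (hΦD x x)

/-- The condition is applied at `L = lam / 2`. Since `lam = ε ^ (-d)` and `2 ≤ 2 ^ d`, the prefactor
`L ^ (1 / d)` is at least `1 / (2 ε)`. -/
theorem GeomCondition.exists_integral_le (hd : 1 ≤ d) {𝒳 : Set (E d)} {Q : Measure (E d)}
    (hQ : Q 𝒳ᶜ = 0) (hA : GeomCondition 𝒳 Q) :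
    ∃ M : ℝ, 0 ≤ M ∧ ∀ lam ε : ℝ, 0 < ε → lam * ε ^ d = 1 →
      ∫ x, Real.exp (-(lam / 2) * Metric.infDist x 𝒳ᶜ ^ d) ∂Q ≤ M * ε := by
  obtain ⟨M, hM⟩ := hA
  have hM0 : 0 ≤ M := by
    refine le_trans ?_ (hM 1 one_pos)
    exact mul_nonneg (by positivity) (integral_nonneg fun x => (Real.exp_pos _).le)
  refine ⟨M * 2, by positivity, fun lam ε hε hl => ?_⟩
  have hlam0 : 0 < lam := by
    by_contra! h
    have : 0 < ε ^ d := by positivity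
    nlinarith
  have h := hM (lam / 2) (by positivity)
  have hrestr : Q.restrict 𝒳 = Q := Measure.restrict_eq_self_of_ae_mem hQ
  rw [hrestr] at h
  set I := ∫ x, Real.exp (-(lam / 2) * Metric.infDist x 𝒳ᶜ ^ d) ∂Q
  have hI : 0 ≤ I := integral_nonneg fun x => (Real.exp_pos _).le
  have h1 : 1 / (2 * ε) ≤ (lam / 2) ^ (1 / (d : ℝ)) := by
    have h2 : 1 / (2 * ε) = ((1 / (2 * ε)) ^ d) ^ (1 / (d : ℝ)) := by
      rw [one_div (d : ℝ), Real.pow_rpow_inv_natCast (by positivity) (by omega)]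
    rw [h2]
    refine Real.rpow_le_rpow (by positivity) ?_ (by positivity)
    rw [div_pow, one_pow, mul_pow, div_le_div_iff₀ (by positivity) two_pos]
    have : (2 : ℝ) ≤ 2 ^ d := le_self_pow₀ one_le_two (by omega)
    calc (1 : ℝ) * 2 ≤ 2 ^ d := by linarith
      _ = lam * (2 ^ d * ε ^ d) := by rw [mul_left_comm, hl, mul_one]
  have h3 : 1 / (2 * ε) * I ≤ M := (mul_le_mul_of_nonneg_right h1 hI).trans h
  rw [one_div, inv_mul_le_iff₀ (by positivity)] at h3
  linarith

/-- After integrating over `Q`, the boundary term of order `ε ^ (d + 1)` acquires a factor `ε` and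
matches the interior one. The prefactor `n / k` cancels `ε ^ d`, leaving `ε ^ 2`. -/
theorem exists_abs_integral_nnBias_le (hd : 1 ≤ d) {P Q : Measure (E d)} [IsProbabilityMeasure P]
    [IsProbabilityMeasure Q] {p : E d → ℝ} (hp : IsDensity P p)
    {𝒳 : Set (E d)} (h𝒳 : Bornology.IsBounded 𝒳) (hP : P 𝒳ᶜ = 0) (hQ : Q 𝒳ᶜ = 0) {K : NNReal}
    (hK : LipschitzOnWith K p 𝒳) {CP M c : ℝ} (hM : 0 ≤ M) (hCP0 : 0 ≤ CP)
    (hCP : ∀ x : E d, ∀ r : ℝ, 0 ≤ r → P.real (Metric.closedBall x r) ≤ CP * r ^ d)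
    (hc0 : 0 < c) (hc : ∀ x ∈ 𝒳, ∀ r : ℝ, 0 ≤ r → r ≤ Metric.diam 𝒳 →
      c * r ^ d ≤ P.real (Metric.closedBall x r)) (hA : GeomCondition 𝒳 Q)
    {Φ : E d → E d → ℝ} (hΦ : IsLocalIncrement 𝒳 M Φ) :
    ∃ C : ℝ, 0 ≤ C ∧ ∀ n k : ℕ, 1 ≤ k → k + 1 ≤ n → ∀ ε : ℝ, 0 < ε →
      c * n / (4 * (k + 1 : ℕ)) * ε ^ d = 1 →
      |∫ X, nnBias Finset.univ k Q Φ X ∂(Measure.pi fun _ : Fin n => P)| ≤ C * ε ^ 2 := by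
  obtain ⟨G, hG0, hG⟩ := hA.exists_integral_le hd hQ
  have hv := measureReal_unitBall_pos (d := d)
  set C₀ := M * (CP + K * volume.real (Metric.ball (0 : E d) 1)) *
        ((d + 2).factorial * 2 ^ (d + 2) : ℝ) * (1 + Real.exp 1) with hC₀
  have hC₀0 : 0 ≤ C₀ := by positivity
  refine ⟨8 / c * C₀ * (1 + G), by positivity, fun n k hk hkn ε hε hεl => ?_⟩
  have hΦD := hΦ.abs_le_diam hM h𝒳
  have hk0 : (0 : ℝ) < k := by exact_mod_cast hk
  have hn0 : (0 : ℝ) < n := by exact_mod_cast (by omega : 0 < n)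
  set lam := c * n / (4 * (k + 1 : ℕ)) with hlam
  have hlam0 : 0 < lam := by rw [hlam]; positivity
  have hmeas : Measurable fun z : (Fin n → E d) × E d =>
      (k : ℝ)⁻¹ * nnSum Finset.univ k Φ z.1 z.2 :=
    (measurable_nnSum hk (by simp; omega) hΦ.measurable).const_mul _
  have hint : Integrable (Function.uncurry fun (X : Fin n → E d) x =>
      (k : ℝ)⁻¹ * nnSum Finset.univ k Φ X x) ((Measure.pi fun _ : Fin n => P).prod Q) := by
    refine integrable_of_abs_le hmeas (C := (k : ℝ)⁻¹ * (n * (M * Metric.diam 𝒳))) fun z => ?_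
    rw [Function.uncurry, abs_mul, abs_of_nonneg (by positivity : 0 ≤ (k : ℝ)⁻¹)]
    gcongr
    exact abs_nnSum_le hΦD _ _
  simp only [nnBias]
  rw [integral_integral_swap hint]
  simp only [integral_const_mul]
  rw [abs_mul, abs_of_nonneg (by positivity : 0 ≤ (k : ℝ)⁻¹)]
  have hexpint : Integrable (fun x => Real.exp (-(lam / 2) * Metric.infDist x 𝒳ᶜ ^ d)) Q := by
    refine integrable_of_abs_le (C := 1) ?_ fun x => ?_
    · exact Real.measurable_exp.comp
        ((Metric.continuous_infDist_pt _).measurable.pow_const d |>.const_mul _)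
    · rw [abs_of_pos (Real.exp_pos _), Real.exp_le_one_iff]
      have : 0 ≤ Metric.infDist x 𝒳ᶜ ^ d := pow_nonneg Metric.infDist_nonneg d
      nlinarith
  have hx : ‖∫ x, ∫ X, nnSum Finset.univ k Φ X x ∂(Measure.pi fun _ : Fin n => P) ∂Q‖ ≤
      ∫ x, n * (C₀ * (ε ^ (d + 2) + ε ^ (d + 1) *
        Real.exp (-(lam / 2) * Metric.infDist x 𝒳ᶜ ^ d))) ∂Q := by
    refine norm_integral_le_of_norm_le
      ((((integrable_const _).add (hexpint.const_mul _)).const_mul _).const_mul _) ?_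
    filter_upwards [show ∀ᵐ x ∂Q, x ∈ 𝒳 from hQ] with x hx
    exact abs_integral_nnSum_le hd hk hkn hp h𝒳 hP hK hCP0 hCP hc0 hc hΦ hx hε hlam hεl
  rw [integral_const_mul, integral_const_mul, integral_add (integrable_const _)
    (hexpint.const_mul _), integral_const_mul, integral_const] at hx
  simp only [probReal_univ, one_smul] at hx
  -- The left side is `4 (k + 1) / (c k)`, and `k + 1 ≤ 2 k`.
  have hratio : (k : ℝ)⁻¹ * n * ε ^ d ≤ 8 / c := by
    have h1 : (k : ℝ)⁻¹ * n * ε ^ d = 4 * (k + 1) / (c * k) * (lam * ε ^ d) := by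
      rw [hlam]; push_cast; field_simp
    rw [h1, hεl, mul_one, div_le_div_iff₀ (by positivity) hc0]
    have : (1 : ℝ) ≤ k := by exact_mod_cast hk
    nlinarith
  calc (k : ℝ)⁻¹ * |∫ x, ∫ X, nnSum Finset.univ k Φ X x ∂(Measure.pi fun _ : Fin n => P) ∂Q|
      ≤ (k : ℝ)⁻¹ * (n * (C₀ * (ε ^ (d + 2) + ε ^ (d + 1) *
        ∫ x, Real.exp (-(lam / 2) * Metric.infDist x 𝒳ᶜ ^ d) ∂Q))) := by
        gcongr; exact hx
    _ ≤ (k : ℝ)⁻¹ * (n * (C₀ * (ε ^ (d + 2) + ε ^ (d + 1) * (G * ε)))) := by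
        gcongr; exact hG lam ε hε hεl
    _ = ((k : ℝ)⁻¹ * n * ε ^ d) * (C₀ * (1 + G) * ε ^ 2) := by ring
    _ ≤ 8 / c * (C₀ * (1 + G) * ε ^ 2) := by gcongr
    _ = _ := by ring

end NearestNeighbourBias


section Variance

variable {d n : ℕ}

/-! ### The variance -/

theorem card_filter_knnRadius {k : ℕ} (hk : 1 ≤ k) (hkn : k ≤ n) {X : Fin n → E d} {x : E d}
    (hinj : Function.Injective fun i => ‖X i - x‖) :
    (Finset.univ.filter fun i => ‖X i - x‖ ≤ knnRadius k X x).card = k :=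
  card_filter_le_ordStat (a := fun i => ‖X i - x‖) hk (by simpa using hkn) hinj.injOn

theorem knnRadius_mono {k : ℕ} (hk : 1 ≤ k) (hkn : k + 1 ≤ n) (X : Fin n → E d) (x : E d) :
    knnRadius k X x ≤ knnRadius (k + 1) X x :=
  ordStat_mono_right hk (by omega) (by simpa using hkn)

/-- The indicator of `X i` being a `k`-nearest neighbour of `x`, times the next radius. -/
def nnWeight (k : ℕ) (X : Fin n → E d) (i : Fin n) (x : E d) : ℝ :=
  if ‖X i - x‖ ≤ knnRadius k X x then knnRadius (k + 1) X x else 0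

theorem measurable_nnWeight {k : ℕ} (hk : 1 ≤ k) (hkn : k + 1 ≤ n) (X : Fin n → E d)
    (i : Fin n) : Measurable (nnWeight k X i) := by
  have h2 : Measurable fun x : E d => ‖X i - x‖ := by fun_prop
  exact Measurable.ite (measurableSet_le h2 (measurable_knnRadius_right hk (by omega) X))
    (measurable_knnRadius_right (by omega) hkn X) measurable_const

theorem nnWeight_nonneg {k : ℕ} (hkn : k + 1 ≤ n) (X : Fin n → E d) (i : Fin n) (x : E d) :
    0 ≤ nnWeight k X i x := by
  unfold nnWeight
  split_ifs
  · exact knnRadius_nonneg (by omega) hkn X x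
  · exact le_rfl

theorem nnWeight_le {k : ℕ} (hkn : k + 1 ≤ n) (X : Fin n → E d) (i : Fin n) (x : E d) :
    nnWeight k X i x ≤ knnRadius (k + 1) X x := by
  unfold nnWeight
  split_ifs
  · exact le_rfl
  · exact knnRadius_nonneg (by omega) hkn X x

/-- A common neighbour of `x` and `x'` puts them, by the triangle inequality, within twice the
larger radius. At most `k` indices contribute, since without ties `x` has exactly `k` neighbours. -/
theorem sum_nnWeight_mul_le {k : ℕ} (hk : 1 ≤ k) (hkn : k + 1 ≤ n) (X : Fin n → E d) {x x' : E d}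
    (hinj : Function.Injective fun i => ‖X i - x‖)
    (hle : knnRadius (k + 1) X x' ≤ knnRadius (k + 1) X x) :
    ∑ i, nnWeight k X i x * nnWeight k X i x' ≤
      k * (if ‖x' - x‖ ≤ 2 * knnRadius (k + 1) X x then knnRadius (k + 1) X x ^ 2 else 0) := by
  set T := knnRadius (k + 1) X x with hT
  have hT0 : 0 ≤ T := knnRadius_nonneg (by omega) hkn X x
  have hk' := knnRadius_mono hk hkn X x
  have hk'' := knnRadius_mono hk hkn X x'
  have hterm : ∀ i, nnWeight k X i x * nnWeight k X i x' ≤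
      if ‖X i - x‖ ≤ knnRadius k X x then
        (if ‖x' - x‖ ≤ 2 * T then T ^ 2 else 0) else 0 := by
    intro i
    by_cases h1 : ‖X i - x‖ ≤ knnRadius k X x
    · rw [if_pos h1]
      by_cases h2 : ‖X i - x'‖ ≤ knnRadius k X x'
      · have h3 : ‖x' - x‖ ≤ 2 * T := by
          have h4 : x' - x = (X i - x) - (X i - x') := by abel
          rw [h4]
          refine (norm_sub_le _ _).trans ?_
          linarith
        rw [if_pos h3, sq]
        exact mul_le_mul (nnWeight_le hkn X i x) ((nnWeight_le hkn X i x').trans hle)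
          (nnWeight_nonneg hkn X i x') hT0
      · have : nnWeight k X i x' = 0 := if_neg h2
        rw [this, mul_zero]
        split_ifs <;> positivity
    · have : nnWeight k X i x = 0 := if_neg h1
      rw [this, zero_mul, if_neg h1]
  refine (Finset.sum_le_sum fun i _ => hterm i).trans (le_of_eq ?_)
  rw [← Finset.sum_filter, Finset.sum_const, card_filter_knnRadius hk (by omega) hinj,
    nsmul_eq_mul]

/-- The squared integrals become a double integral over `(x, x')`, so that the sum over `i` can be
taken pointwise. Integrating out `x'` yields the `Q`-mass of a ball of radius `2 T x`, which raises
`T ^ 2` to `T ^ (d + 2)`. -/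
theorem sum_sq_integral_nnWeight_le {k : ℕ} (hk : 1 ≤ k) (hkn : k + 1 ≤ n)
    {Q : Measure (E d)} [IsProbabilityMeasure Q] {𝒳 : Set (E d)} (h𝒳 : Bornology.IsBounded 𝒳)
    (hQ : Q 𝒳ᶜ = 0) {CQ : ℝ} (hCQ : ∀ x : E d, ∀ r : ℝ, 0 ≤ r →
      Q.real (Metric.closedBall x r) ≤ CQ * r ^ d) {X : Fin n → E d} (hX : ∀ i, X i ∈ 𝒳)
    (hinj : ∀ᵐ x ∂Q, Function.Injective fun i => ‖X i - x‖) :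
    ∑ i, (∫ x, nnWeight k X i x ∂Q) ^ 2 ≤
      k * (2 * (CQ * 2 ^ d) * ∫ x, knnRadius (k + 1) X x ^ (d + 2) ∂Q) := by
  set T : E d → ℝ := fun x => knnRadius (k + 1) X x with hT
  set D := Metric.diam 𝒳 with hD
  have hTm : Measurable T := measurable_knnRadius_right (by omega) hkn X
  have hT0 : ∀ x, 0 ≤ T x := knnRadius_nonneg (by omega) hkn X
  have hTD : ∀ᵐ x ∂Q, T x ≤ D := by
    filter_upwards [show ∀ᵐ x ∂Q, x ∈ 𝒳 from hQ] with x hx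
    exact knnRadius_le_diam (by omega) hkn h𝒳 hX hx
  have hTpow : ∀ s : ℕ, Integrable (fun x => T x ^ s) Q := fun s => by
    refine Integrable.of_bound (hTm.pow_const s).aestronglyMeasurable (D ^ s) ?_
    filter_upwards [hTD] with x hx
    rw [Real.norm_of_nonneg (pow_nonneg (hT0 x) s)]
    exact pow_le_pow_left₀ (hT0 x) hx s
  set F : E d × E d → ℝ := fun z => if ‖z.2 - z.1‖ ≤ 2 * T z.1 then T z.1 ^ 2 else 0 with hF
  have hFm : Measurable F := by
    have h1 : Measurable fun z : E d × E d => ‖z.2 - z.1‖ := by fun_prop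
    exact Measurable.ite (measurableSet_le h1 ((hTm.comp measurable_fst).const_mul 2))
      ((hTm.comp measurable_fst).pow_const 2) measurable_const
  have hF0 : ∀ z, 0 ≤ F z := fun z => by
    simp only [hF]; split_ifs <;> positivity
  have hFint : Integrable F (Q.prod Q) := by
    refine ((hTpow 2).comp_fst Q).mono' hFm.aestronglyMeasurable
      (Filter.Eventually.of_forall fun z => ?_)
    rw [Real.norm_of_nonneg (hF0 z)]
    simp only [hF]
    split_ifs
    · exact le_rfl
    · positivity
  have hFle : ∫ z, F z ∂(Q.prod Q) ≤ CQ * 2 ^ d * ∫ x, T x ^ (d + 2) ∂Q := by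
    rw [integral_prod _ hFint, ← integral_const_mul]
    refine integral_mono hFint.integral_prod_left ((hTpow _).const_mul _) fun x => ?_
    have h1 : ∫ x', F (x, x') ∂Q = T x ^ 2 * Q.real (Metric.closedBall x (2 * T x)) := by
      have : (fun x' => F (x, x')) =
          (Metric.closedBall x (2 * T x)).indicator fun _ => T x ^ 2 := by
        ext x'
        simp only [hF, indicator, Metric.mem_closedBall, dist_eq_norm]
      rw [this, integral_indicator_const _ measurableSet_closedBall, smul_eq_mul, mul_comm]
    simp only [h1]
    calc T x ^ 2 * Q.real (Metric.closedBall x (2 * T x))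
        ≤ T x ^ 2 * (CQ * (2 * T x) ^ d) := by
          gcongr
          exact hCQ x _ (mul_nonneg two_pos.le (hT0 x))
      _ = _ := by rw [mul_pow]; ring
  have hw : ∀ i, Integrable (nnWeight k X i) Q := fun i => by
    refine (hTpow 1).mono' (measurable_nnWeight hk hkn X i).aestronglyMeasurable
      (Filter.Eventually.of_forall fun x => ?_)
    rw [Real.norm_of_nonneg (nnWeight_nonneg hkn X i x), pow_one]
    exact nnWeight_le hkn X i x
  have hww : ∀ i, Integrable (fun z : E d × E d => nnWeight k X i z.1 * nnWeight k X i z.2)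
      (Q.prod Q) := fun i => (hw i).mul_prod (hw i)
  have hFs : Integrable (fun z : E d × E d => F z.swap) (Q.prod Q) := hFint.swap
  calc ∑ i, (∫ x, nnWeight k X i x ∂Q) ^ 2
      = ∑ i, ∫ z, nnWeight k X i z.1 * nnWeight k X i z.2 ∂(Q.prod Q) :=
        Finset.sum_congr rfl fun i _ => by rw [integral_prod_mul, sq]
    _ = ∫ z, ∑ i, nnWeight k X i z.1 * nnWeight k X i z.2 ∂(Q.prod Q) :=
        (integral_finsetSum _ fun i _ => hww i).symm
    -- The pointwise bound is stated for the point with the larger radius; adding the swapped term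
    -- covers both orders.
    _ ≤ ∫ z, k * (F z + F z.swap) ∂(Q.prod Q) := by
        refine integral_mono_ae (integrable_finsetSum _ fun i _ => hww i)
          ((hFint.add hFs).const_mul _) ?_
        filter_upwards [Measure.quasiMeasurePreserving_fst.ae hinj,
          Measure.quasiMeasurePreserving_snd.ae hinj] with z h1 h2
        rcases le_total (T z.2) (T z.1) with h | h
        · refine (sum_nnWeight_mul_le hk hkn X h1 h).trans ?_
          gcongr
          exact le_add_of_nonneg_right (hF0 _)
        · have := sum_nnWeight_mul_le hk hkn X h2 h
          simp only [mul_comm (nnWeight k X _ z.2)] at this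
          refine this.trans ?_
          gcongr
          exact le_add_of_nonneg_left (hF0 _)
    _ = k * (2 * ∫ z, F z ∂(Q.prod Q)) := by
        rw [integral_const_mul, integral_add hFint hFs, integral_prod_swap, two_mul]
    _ ≤ _ := by
        refine mul_le_mul_of_nonneg_left ?_ (by positivity)
        linarith

/-- Deletion swaps one neighbour for another, both within the `(k + 1)`-st radius, where `|Φ x|` is
at most `M` times that radius. -/
theorem abs_nnBias_sub_le {k : ℕ} (hk : 1 ≤ k) (hkn : k + 1 ≤ n)
    {Q : Measure (E d)} [IsProbabilityMeasure Q] {𝒳 : Set (E d)} (h𝒳 : Bornology.IsBounded 𝒳)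
    (hQ : Q 𝒳ᶜ = 0) {M : ℝ} (hM : 0 ≤ M) {Φ : E d → E d → ℝ} (hΦ : IsLocalIncrement 𝒳 M Φ)
    {X : Fin n → E d} (hX : ∀ i, X i ∈ 𝒳)
    (hinj : ∀ᵐ x ∂Q, Function.Injective fun i => ‖X i - x‖) (i : Fin n) :
    |nnBias Finset.univ k Q Φ X - nnBias (Finset.univ.erase i) k Q Φ X| ≤
      (k : ℝ)⁻¹ * (2 * M) * ∫ x, nnWeight k X i x ∂Q := by
  have hΦD := hΦ.abs_le_diam hM h𝒳
  have hint : ∀ s : Finset (Fin n), k ≤ s.card →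
      Integrable (fun x => (k : ℝ)⁻¹ * nnSum s k Φ X x) Q := by
    intro s hs
    have hXx : Measurable fun x : E d => (X, x) := by fun_prop
    have hm := (measurable_nnSum hk hs hΦ.measurable).comp hXx
    simp only [Function.comp_def] at hm
    exact (integrable_of_abs_le hm (abs_nnSum_le hΦD X)).const_mul _
  have hw : Integrable (nnWeight k X i) Q := by
    refine Integrable.of_bound (measurable_nnWeight hk hkn X i).aestronglyMeasurable
      (Metric.diam 𝒳) ?_
    filter_upwards [show ∀ᵐ x ∂Q, x ∈ 𝒳 from hQ] with x hx
    rw [Real.norm_of_nonneg (nnWeight_nonneg hkn X i x)]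
    exact (nnWeight_le hkn X i x).trans (knnRadius_le_diam (by omega) hkn h𝒳 hX hx)
  rw [nnBias, nnBias, ← integral_sub (hint _ (by simp; omega))
    (hint _ (by rw [Finset.card_erase_of_mem (Finset.mem_univ i)]; simp; omega)),
    ← integral_const_mul, ← Real.norm_eq_abs]
  refine norm_integral_le_of_norm_le (hw.const_mul _) ?_
  filter_upwards [hinj, show ∀ᵐ x ∂Q, x ∈ 𝒳 from hQ] with x hx hx𝒳
  rw [← mul_sub, norm_mul, Real.norm_of_nonneg (by positivity : 0 ≤ (k : ℝ)⁻¹), mul_assoc]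
  gcongr
  refine (abs_sum_filter_sub_sum_filter_erase_le (a := fun j => ‖X j - x‖) hk (Finset.mem_univ i)
    (by simpa using hkn) hx.injOn (fun j => Φ x (X j)) (c := M * knnRadius (k + 1) X x)
    fun j _ hj => ?_).trans (le_of_eq ?_)
  · exact (hΦ.abs_le x hx𝒳 (X j) (hX j)).trans (mul_le_mul_of_nonneg_left hj hM)
  · unfold nnWeight
    rw [← knnRadius_eq_ordStat]
    split_ifs
    · ring
    · ring

theorem sum_integral_sq_nnBias_sub_le (hd : 1 ≤ d) {k : ℕ} (hk : 1 ≤ k) (hkn : k + 1 ≤ n)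
    {P Q : Measure (E d)} [IsProbabilityMeasure P] [IsProbabilityMeasure Q] (hPac : P ≪ volume)
    {𝒳 : Set (E d)} (h𝒳 : Bornology.IsBounded 𝒳) (hP : P 𝒳ᶜ = 0) (hQ : Q 𝒳ᶜ = 0)
    {CQ M c : ℝ} (hM : 0 ≤ M) (hCQ0 : 0 ≤ CQ)
    (hCQ : ∀ x : E d, ∀ r : ℝ, 0 ≤ r → Q.real (Metric.closedBall x r) ≤ CQ * r ^ d)
    (hc0 : 0 < c) (hc : ∀ x ∈ 𝒳, ∀ r : ℝ, 0 ≤ r → r ≤ Metric.diam 𝒳 →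
      c * r ^ d ≤ P.real (Metric.closedBall x r))
    {Φ : E d → E d → ℝ} (hΦ : IsLocalIncrement 𝒳 M Φ) {ε : ℝ} (hε : 0 < ε)
    (hεl : c * n / (4 * (k + 1 : ℕ)) * ε ^ d = 1) :
    ∑ i, ∫ X, (nnBias Finset.univ k Q Φ X - nnBias (Finset.univ.erase i) k Q Φ X) ^ 2
        ∂(Measure.pi fun _ : Fin n => P) ≤
      8 * M ^ 2 * (CQ * 2 ^ d) *
        (((d + 2).factorial * 2 ^ (d + 2) : ℝ) * ε ^ (d + 2) * (1 + Real.exp 1)) := by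
  have hk0 : (0 : ℝ) < k := by exact_mod_cast hk
  have hk1 : (1 : ℝ) ≤ k := by exact_mod_cast hk
  have hΦD := hΦ.abs_le_diam hM h𝒳
  set ν := Measure.pi fun _ : Fin n => P with hν
  set A := 8 * M ^ 2 * (CQ * 2 ^ d) with hA
  have hA0 : 0 ≤ A := by positivity
  have hTint : Integrable (Function.uncurry fun (X : Fin n → E d) (x : E d) =>
      knnRadius (k + 1) X x ^ (d + 2)) (ν.prod Q) := by
    refine Integrable.of_bound ((measurable_knnRadius (by omega) hkn).pow_const
      (d + 2)).aestronglyMeasurable (Metric.diam 𝒳 ^ (d + 2)) ?_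
    filter_upwards [Measure.quasiMeasurePreserving_fst.ae (ae_pi_forall_mem (n := n) hP),
      Measure.quasiMeasurePreserving_snd.ae (show ∀ᵐ x ∂Q, x ∈ 𝒳 from hQ)] with z h1 h2
    have h0 := knnRadius_nonneg (by omega) hkn z.1 z.2
    rw [Function.uncurry, Real.norm_of_nonneg (pow_nonneg h0 _)]
    exact pow_le_pow_left₀ h0 (knnRadius_le_diam (by omega) hkn h𝒳 h1 h2) _
  have hbint : ∀ i : Fin n, Integrable (fun X => (nnBias Finset.univ k Q Φ X -
      nnBias (Finset.univ.erase i) k Q Φ X) ^ 2) ν := by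
    intro i
    have hm : Measurable fun X : Fin n → E d => nnBias Finset.univ k Q Φ X -
        nnBias (Finset.univ.erase i) k Q Φ X :=
      (measurable_nnBias hk (by simp; omega) hΦ.measurable Q).sub (measurable_nnBias hk
        (by rw [Finset.card_erase_of_mem (Finset.mem_univ i)]; simp; omega) hΦ.measurable Q)
    refine integrable_of_abs_le (hm.pow_const 2)
      (C := ((k : ℝ)⁻¹ * (n * (M * Metric.diam 𝒳)) + (k : ℝ)⁻¹ * (n * (M * Metric.diam 𝒳))) ^ 2)
      fun X => ?_
    rw [abs_pow]
    refine pow_le_pow_left₀ (abs_nonneg _) ?_ 2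
    exact (abs_sub _ _).trans (add_le_add (abs_nnBias_le hΦD Q X) (abs_nnBias_le hΦD Q X))
  have hpt : ∀ᵐ X ∂ν, ∑ i, (nnBias Finset.univ k Q Φ X -
      nnBias (Finset.univ.erase i) k Q Φ X) ^ 2 ≤
      A * ∫ x, knnRadius (k + 1) X x ^ (d + 2) ∂Q := by
    filter_upwards [ae_pi_forall_mem (n := n) hP,
      ae_ae_injective_norm_sub (n := n) (Q := Q) hd hPac] with X hX hinj
    have hI0 : 0 ≤ ∫ x, knnRadius (k + 1) X x ^ (d + 2) ∂Q :=
      integral_nonneg fun x => pow_nonneg (knnRadius_nonneg (by omega) hkn X x) _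
    calc ∑ i, (nnBias Finset.univ k Q Φ X - nnBias (Finset.univ.erase i) k Q Φ X) ^ 2
        ≤ ∑ i, ((k : ℝ)⁻¹ * (2 * M)) ^ 2 * (∫ x, nnWeight k X i x ∂Q) ^ 2 := by
          refine Finset.sum_le_sum fun i _ => ?_
          rw [← mul_pow, ← sq_abs]
          exact pow_le_pow_left₀ (abs_nonneg _)
            (abs_nnBias_sub_le hk hkn h𝒳 hQ hM hΦ hX hinj i) 2
      _ ≤ ((k : ℝ)⁻¹ * (2 * M)) ^ 2 *
          (k * (2 * (CQ * 2 ^ d) * ∫ x, knnRadius (k + 1) X x ^ (d + 2) ∂Q)) := by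
          rw [← Finset.mul_sum]
          gcongr
          exact sum_sq_integral_nnWeight_le hk hkn h𝒳 hQ hCQ hX hinj
      _ = (k : ℝ)⁻¹ * (A * ∫ x, knnRadius (k + 1) X x ^ (d + 2) ∂Q) := by
          rw [hA]; field_simp; ring
      -- The gain `1 / k` is not needed for the target rate and is dropped.
      _ ≤ 1 * (A * ∫ x, knnRadius (k + 1) X x ^ (d + 2) ∂Q) := by
          gcongr
          exact inv_le_one_of_one_le₀ hk1
      _ = _ := one_mul _
  rw [← integral_finsetSum _ fun i _ => hbint i]
  calc _ ≤ ∫ X, A * ∫ x, knnRadius (k + 1) X x ^ (d + 2) ∂Q ∂ν :=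
        integral_mono_ae (integrable_finsetSum _ fun i _ => hbint i)
          (hTint.integral_prod_left.const_mul _) hpt
    _ = A * ∫ x, ∫ X, knnRadius (k + 1) X x ^ (d + 2) ∂ν ∂Q := by
        rw [integral_const_mul, integral_integral_swap hTint]
    _ ≤ A * ∫ _, (((d + 2).factorial * 2 ^ (d + 2) : ℝ) * ε ^ (d + 2) * (1 + Real.exp 1)) ∂Q := by
        gcongr ?_ * ?_
        refine integral_mono_ae hTint.integral_prod_right (integrable_const _) ?_
        filter_upwards [show ∀ᵐ x ∂Q, x ∈ 𝒳 from hQ] with x hx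
        exact integral_pow_knnRadius_le hd (by omega) hkn h𝒳 hP hc0 hc hx hε hεl (d + 2)
    _ = _ := by simp

end Variance


section MeanSquare

variable {d : ℕ}

/-! ### The mean square of the nearest neighbour bias -/

theorem pow_le_rpow_mul_rpow (hd : 1 ≤ d) {ε a t m : ℝ} (hε : 0 < ε) (ha : 0 < a) (ht : 0 < t)
    (ht1 : t ≤ 1) (h : ε ^ d ≤ a * t) (s : ℕ) (hm : m ≤ s / d) :
    ε ^ s ≤ a ^ ((s : ℝ) / d) * t ^ m := by
  have hd0 : (d : ℝ) ≠ 0 := by exact_mod_cast (by omega : d ≠ 0)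
  have h1 : ε ^ s = (ε ^ d) ^ ((s : ℝ) / d) := by
    rw [← Real.rpow_natCast, ← Real.rpow_natCast, ← Real.rpow_mul hε.le, mul_div_cancel₀ _ hd0]
  calc ε ^ s = (ε ^ d) ^ ((s : ℝ) / d) := h1
    _ ≤ (a * t) ^ ((s : ℝ) / d) := Real.rpow_le_rpow (by positivity) h (by positivity)
    _ = a ^ ((s : ℝ) / d) * t ^ ((s : ℝ) / d) := Real.mul_rpow ha.le ht.le
    _ ≤ _ := by
        exact mul_le_mul_of_nonneg_left (Real.rpow_le_rpow_of_exponent_ge ht ht1 hm)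
          (by positivity)

/-- The variance exponent `1 + 2 / d` is at least `4 / d` exactly when `d ≥ 2`; for `d = 1` it is
`3`, the origin of the cap. -/
theorem min_four_div_three_le (hd : 1 ≤ d) : min (4 / (d : ℝ)) 3 ≤ ((d + 2 : ℕ) : ℝ) / d := by
  have hd0 : (0 : ℝ) < d := by exact_mod_cast hd
  rcases Nat.lt_or_ge d 2 with h | h
  · have : d = 1 := by omega
    subst this
    exact (min_le_right _ _).trans (by norm_num)
  · refine (min_le_left _ _).trans ?_
    have : (2 : ℝ) ≤ d := by exact_mod_cast h
    gcongr
    push_cast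
    linarith

/-- The mean contributes `ε ^ 4` and the variance `ε ^ (d + 2)`, with `ε ^ d` at most a multiple of
`k / (n + 1)`. The case `k = n`, where no `k`-th neighbour survives a deletion, is covered by
boundedness. -/
theorem exists_integral_sq_nnBias_le (hd : 1 ≤ d) {𝒳 : Set (E d)} {P Q : Measure (E d)}
    [IsProbabilityMeasure P] [IsProbabilityMeasure Q] (hP : P 𝒳ᶜ = 0) (hQ : Q 𝒳ᶜ = 0)
    (hX1 : IsCompact 𝒳) (hX2 : BallVolume 𝒳) {p q : E d → ℝ}
    (hp : IsDensity P p) (hq : IsDensity Q q)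
    (hpinf : ∃ pinf : ℝ, 0 < pinf ∧ ∀ x ∈ 𝒳, pinf ≤ p x)
    (hqsup : ∃ qsup : ℝ, 0 < qsup ∧ ∀ x ∈ 𝒳, q x ≤ qsup)
    (hX5 : ∃ K, LipschitzOnWith K p 𝒳) (hA : GeomCondition 𝒳 Q)
    {M : ℝ} (hM : 0 ≤ M) {Φ : E d → E d → ℝ} (hΦ : IsLocalIncrement 𝒳 M Φ) :
    ∃ C : ℝ, ∀ n k : ℕ, 1 ≤ k → k ≤ n →
      ∫ X, nnBias Finset.univ k Q Φ X ^ 2 ∂(Measure.pi fun _ : Fin n => P) ≤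
        C * ((k : ℝ) / ((n : ℝ) + 1)) ^ (min (4 / (d : ℝ)) 3) := by
  have h𝒳 := hX1.isBounded
  have h𝒳m := hX1.measurableSet
  have hd0 : (0 : ℝ) < d := by exact_mod_cast hd
  obtain ⟨K, hK⟩ := hX5
  have hpsup : ∃ b : ℝ, 0 < b ∧ ∀ x ∈ 𝒳, p x ≤ b := by
    obtain ⟨b, hb⟩ := (hX1.image_of_continuousOn hK.continuousOn).bddAbove
    exact ⟨max b 1, by positivity, fun x hx => (hb ⟨x, hx, rfl⟩).trans (le_max_left _ _)⟩
  obtain ⟨CP, hCP0, hCP⟩ := exists_measureReal_closedBall_le hp h𝒳m hP hpsup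
  obtain ⟨CQ, hCQ0, hCQ⟩ := exists_measureReal_closedBall_le hq h𝒳m hQ hqsup
  obtain ⟨c, hc0, hc⟩ := exists_le_measureReal_closedBall hp h𝒳m hX2 hpinf
  obtain ⟨Cm, hCm0, hmean⟩ := exists_abs_integral_nnBias_le hd hp h𝒳 hP hQ hK hM hCP0.le hCP hc0
    hc hA hΦ
  have hPac : P ≪ volume := by rw [hp.eq]; exact withDensity_absolutelyContinuous _ _
  set D := M * Metric.diam 𝒳 with hD
  have hΦD : ∀ x u, |Φ x u| ≤ D := hΦ.abs_le_diam hM h𝒳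
  set m := min (4 / (d : ℝ)) 3 with hm
  set Cv := 8 * M ^ 2 * (CQ * 2 ^ d) * (((d + 2).factorial * 2 ^ (d + 2) : ℝ) * (1 + Real.exp 1))
    with hCv
  -- From `ε ^ d = 4 (k + 1) / (c n)` together with `k + 1 ≤ 2 k` and `n + 1 ≤ 2 n`.
  set a := 16 / c with ha
  have ha0 : 0 < a := by positivity
  set C₁ := Cm ^ 2 * a ^ (((4 : ℕ) : ℝ) / d) + Cv * a ^ (((d + 2 : ℕ) : ℝ) / d) with hC₁
  refine ⟨8 * D ^ 2 + C₁, fun n k hk hkn => ?_⟩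
  have hk0 : (0 : ℝ) < k := by exact_mod_cast hk
  have hn0 : (0 : ℝ) < n := by exact_mod_cast hk.trans hkn
  have hknR : (k : ℝ) ≤ n := by exact_mod_cast hkn
  set t := (k : ℝ) / (n + 1) with ht
  have ht0 : 0 < t := by positivity
  have ht1 : t ≤ 1 := by rw [ht, div_le_one (by positivity)]; linarith
  have htm : 0 ≤ t ^ m := by positivity
  have hCv0 : 0 ≤ Cv := by positivity
  have hC₁0 : 0 ≤ C₁ := by positivity
  have hbm := measurable_nnBias (n := n) (s := Finset.univ) hk (by simpa using hkn) hΦ.measurable Q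
  rcases hkn.eq_or_lt with heq | hlt
  · have hb : ∀ X : Fin n → E d, nnBias Finset.univ k Q Φ X ^ 2 ≤ D ^ 2 := by
      intro X
      have h1 := abs_nnBias_le (s := Finset.univ) (k := k) hΦD Q X
      rw [show (n : ℝ) = k by rw [heq], inv_mul_cancel_left₀ hk0.ne'] at h1
      rw [← sq_abs]
      exact pow_le_pow_left₀ (abs_nonneg _) h1 2
    have hle : ∫ X, nnBias Finset.univ k Q Φ X ^ 2 ∂(Measure.pi fun _ : Fin n => P) ≤ D ^ 2 := by
      calc _ ≤ ∫ _, D ^ 2 ∂(Measure.pi fun _ : Fin n => P) :=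
            integral_mono_of_nonneg (Filter.Eventually.of_forall fun X => sq_nonneg _)
              (integrable_const _) (Filter.Eventually.of_forall hb)
        _ = _ := by simp
    -- When `k = n` the ratio is at least `1 / 2`, so its power is at least `1 / 8`; hence the
    -- constant `8 * D ^ 2`.
    have ht2 : 1 / 2 ≤ t := by
      rw [ht, heq, div_le_div_iff₀ two_pos (by positivity)]
      have : (1 : ℝ) ≤ n := by exact_mod_cast hk.trans hkn
      linarith
    have ht8 : 1 / 8 ≤ t ^ m := by
      calc (1 / 8 : ℝ) = (1 / 2) ^ 3 := by norm_num
        _ ≤ t ^ 3 := by gcongr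
        _ = t ^ (3 : ℝ) := by norm_cast
        _ ≤ t ^ m := Real.rpow_le_rpow_of_exponent_ge ht0 ht1 (min_le_right _ _)
    have hD2 : 0 ≤ D ^ 2 := sq_nonneg _
    calc _ ≤ D ^ 2 := hle
      _ = 8 * D ^ 2 * (1 / 8) := by ring
      _ ≤ 8 * D ^ 2 * t ^ m := by gcongr
      _ ≤ (8 * D ^ 2 + C₁) * t ^ m := by
          gcongr; linarith
  · have hkn' : k + 1 ≤ n := hlt
    set lam := c * n / (4 * (k + 1 : ℕ)) with hlam
    have hlam0 : 0 < lam := by rw [hlam]; positivity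
    set ε := (1 / lam) ^ (1 / (d : ℝ)) with hε
    have hε0 : 0 < ε := by positivity
    have hεd : ε ^ d = 1 / lam := by
      rw [hε, one_div (d : ℝ), Real.rpow_inv_natCast_pow (by positivity) (by omega)]
    have hεl : lam * ε ^ d = 1 := by rw [hεd]; field_simp
    have hεt : ε ^ d ≤ a * t := by
      have hk1 : (1 : ℝ) ≤ k := by exact_mod_cast hk
      rw [hεd, hlam, ha, ht, one_div_div, div_mul_div_comm,
        div_le_div_iff₀ (by positivity) (by positivity)]
      push_cast
      have h1 : 4 * ((k : ℝ) + 1) * (n + 1) ≤ 16 * k * n := by nlinarith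
      nlinarith
    have h4 : (ε ^ 2) ^ 2 ≤ a ^ (((4 : ℕ) : ℝ) / d) * t ^ m := by
      rw [← pow_mul]
      exact pow_le_rpow_mul_rpow hd hε0 ha0 ht0 ht1 hεt 4 (by push_cast; exact min_le_left _ _)
    have hd2 : ε ^ (d + 2) ≤ a ^ (((d + 2 : ℕ) : ℝ) / d) * t ^ m :=
      pow_le_rpow_mul_rpow hd hε0 ha0 ht0 ht1 hεt (d + 2) (min_four_div_three_le hd)
    have hES := efron_stein P n (C := (k : ℝ)⁻¹ * (n * D)) (nnBias Finset.univ k Q Φ)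
      (fun i => nnBias (Finset.univ.erase i) k Q Φ) hbm
      (fun i => measurable_nnBias hk
        (by rw [Finset.card_erase_of_mem (Finset.mem_univ i)]; simp; omega) hΦ.measurable Q)
      (abs_nnBias_le hΦD Q) (fun i => abs_nnBias_le hΦD Q)
      (fun i X y => nnBias_erase_update k Q Φ X i y)
    have hV := sum_integral_sq_nnBias_sub_le hd hk hkn' hPac h𝒳 hP hQ hM hCQ0.le hCQ hc0 hc hΦ
      hε0 hεl
    have hE := hmean n k hk hkn' ε hε0 hεl
    have hE2 : (∫ X, nnBias Finset.univ k Q Φ X ∂(Measure.pi fun _ : Fin n => P)) ^ 2 ≤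
        Cm ^ 2 * (ε ^ 2) ^ 2 := by
      rw [← sq_abs, ← mul_pow]
      exact pow_le_pow_left₀ (abs_nonneg _) hE 2
    calc _ ≤ _ := hES
      _ ≤ Cm ^ 2 * (ε ^ 2) ^ 2 + Cv * ε ^ (d + 2) := by
          refine add_le_add hE2 (hV.trans (le_of_eq ?_))
          rw [hCv]; ring
      _ ≤ Cm ^ 2 * (a ^ (((4 : ℕ) : ℝ) / d) * t ^ m) +
          Cv * (a ^ (((d + 2 : ℕ) : ℝ) / d) * t ^ m) := by gcongr
      _ = C₁ * t ^ m := by rw [hC₁]; ring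
      _ ≤ (8 * D ^ 2 + C₁) * t ^ m := by
          gcongr
          have : 0 ≤ D ^ 2 := sq_nonneg _
          linarith

end MeanSquare


section Laws

variable {d n m : ℕ}

/-! ### Joint laws under the sampling model -/

/-- Given all covariates, the label `Y i` depends on `X i` alone. The proof resamples the `i`-th
pair, disintegrates its law into `P` and `κ`, and puts the covariate back. -/
theorem map_pi_compProd_eval (P : Measure (E d)) [IsProbabilityMeasure P] (κ : Kernel (E d) ℝ)
    [IsMarkovKernel κ] (i : Fin n) :
    (Measure.pi fun _ : Fin n => P ⊗ₘ κ).map (fun z => ((fun l => (z l).1), (z i).2)) =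
      (Measure.pi fun _ : Fin n => P) ⊗ₘ (κ.comap (fun X : Fin n → E d => X i)
        (measurable_pi_apply i)) := by
  have hm : Measurable fun z : Fin n → E d × ℝ => ((fun l => (z l).1), (z i).2) := by fun_prop
  refine Measure.ext_of_lintegral _ fun f hf => ?_
  set K : (Fin n → E d) → ℝ≥0∞ := fun X => ∫⁻ y, f (X, y) ∂(κ (X i)) with hK
  have hKm : Measurable K := Measurable.lintegral_kernel_prod_right
    (κ := κ.comap (fun X : Fin n → E d => X i) (measurable_pi_apply i)) hf
  rw [Measure.lintegral_compProd hf, lintegral_map hf hm]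
  change _ = ∫⁻ X, K X ∂_
  have hup := measurePreserving_update (P ⊗ₘ κ) i
  have hfm : Measurable fun z : Fin n → E d × ℝ => f ((fun l => (z l).1), (z i).2) := hf.comp hm
  have hfu : Measurable fun w : (Fin n → E d × ℝ) × E d × ℝ =>
      f ((fun l => (Function.update w.1 i w.2 l).1), (Function.update w.1 i w.2 i).2) :=
    hfm.comp hup.measurable
  rw [← hup.lintegral_comp hfm, lintegral_prod _ hfu.aemeasurable]
  have hinner : ∀ z : Fin n → E d × ℝ,
      ∫⁻ v, f ((fun l => (Function.update z i v l).1), (Function.update z i v i).2) ∂(P ⊗ₘ κ) =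
        ∫⁻ x, K (Function.update (fun l => (z l).1) i x) ∂P := by
    intro z
    have hupd : ∀ v : E d × ℝ, (fun l => (Function.update z i v l).1) =
        Function.update (fun l => (z l).1) i v.1 := by
      intro v
      ext1 l
      by_cases hl : l = i
      · subst hl; simp
      · simp [Function.update_of_ne hl]
    simp only [hupd, Function.update_self]
    rw [Measure.lintegral_compProd]
    · simp only [hK, Function.update_self]
    · refine hf.comp (Measurable.prodMk ?_ measurable_snd)
      exact (measurable_update _).comp measurable_fst
  simp only [hinner]
  have hfst : (Measure.pi fun _ : Fin n => P ⊗ₘ κ).map (fun z l => (z l).1) =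
      Measure.pi fun _ : Fin n => P := by
    have hP : ∀ _ : Fin n, (P ⊗ₘ κ).map Prod.fst = P := fun _ => Measure.fst_compProd P κ
    have : ∀ l : Fin n, SigmaFinite ((P ⊗ₘ κ).map (Prod.fst : E d × ℝ → E d)) := fun l => by
      rw [hP l]; infer_instance
    rw [Measure.pi_map_pi (f := fun (_ : Fin n) (v : E d × ℝ) => v.1)
      (fun _ => measurable_fst.aemeasurable)]
    congr 1
    ext1 l
    exact hP l
  have hupP := measurePreserving_update P i
  have hKu : Measurable fun w : (Fin n → E d) × E d => K (Function.update w.1 i w.2) :=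
    hKm.comp hupP.measurable
  rw [← lintegral_map (f := fun X => ∫⁻ x, K (Function.update X i x) ∂P) hKu.lintegral_prod_right'
    (by fun_prop : Measurable fun (z : Fin n → E d × ℝ) l => (z l).1), hfst,
    ← hupP.lintegral_comp hKm, lintegral_prod _ hKu.aemeasurable]

variable {Ω : Type*} [MeasurableSpace Ω] {μ : Measure Ω} {P Q : Measure (E d)}
  {κ : Kernel (E d) ℝ} {X : Fin n → Ω → E d} {Y : Fin n → Ω → ℝ} {Xs : Fin m → Ω → E d}

theorem IsSample.measurable_X_pi (hS : IsSample μ P Q κ X Y Xs) :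
    Measurable fun ω i => X i ω := measurable_pi_lambda _ hS.measurable_X

/-- The indicator that `X i` is among the `k` nearest neighbours of `x`. -/
def nnIndicator (k : ℕ) (X : Fin n → E d) (x : E d) (i : Fin n) : ℝ :=
  if ‖X i - x‖ ≤ knnRadius k X x then 1 else 0

theorem measurable_nnIndicator {k : ℕ} (hk : 1 ≤ k) (hkn : k ≤ n) (i : Fin n) :
    Measurable fun z : (Fin n → E d) × E d => nnIndicator k z.1 z.2 i := by
  have h2 : Measurable fun z : (Fin n → E d) × E d => ‖z.1 i - z.2‖ := by fun_prop
  exact Measurable.ite (measurableSet_le h2 (measurable_knnRadius hk hkn)) measurable_const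
    measurable_const

theorem abs_nnIndicator_le_one (k : ℕ) (X : Fin n → E d) (x : E d) (i : Fin n) :
    |nnIndicator k X x i| ≤ 1 := by
  unfold nnIndicator
  split_ifs <;> simp

theorem IsSample.measurableSet_nn (hS : IsSample μ P Q κ X Y Xs) {k : ℕ} (hk : 1 ≤ k)
    (hkn : k ≤ n) (i : Fin n) (j : Fin m) :
    MeasurableSet {ω | ‖X i ω - Xs j ω‖ ≤ knnRadius k (fun l => X l ω) (Xs j ω)} := by
  have h1 := (measurable_knnRadius hk hkn).comp (hS.measurable_X_pi.prodMk (hS.measurable_Xs j))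
  simp only [Function.comp_def] at h1
  exact measurableSet_le ((hS.measurable_X i).sub (hS.measurable_Xs j)).norm h1

variable [IsProbabilityMeasure μ]

theorem IsSample.map_XY (hS : IsSample μ P Q κ X Y Xs) :
    μ.map (fun ω i => (X i ω, Y i ω)) = Measure.pi fun _ => P ⊗ₘ κ := by
  have hXY : ∀ i, Measurable fun ω => (X i ω, Y i ω) := fun i =>
    (hS.measurable_X i).prodMk (hS.measurable_Y i)
  have := (iIndepFun_iff_map_fun_eq_pi_map fun i => (hXY i).aemeasurable).1 hS.indep_XY
  rw [this]
  simp only [hS.law_XY]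

/-! ### Conditional law of the generated labels -/

variable {k : ℕ} {Yhat : Fin m → Ω → ℝ}

/-- The conditional law is given one Borel set at a time; this determines the joint law on
rectangles, hence everywhere. As an identity of measures it can be applied to unbounded integrands.
-/
theorem IsLabels.map_data_Yhat (hL : IsLabels μ k X Y Xs Yhat) (hS : IsSample μ P Q κ X Y Xs)
    (hk : 1 ≤ k) (hkn : k ≤ n) (j : Fin m) :
    μ.map (fun ω => (((fun i => (X i ω, Y i ω)), fun l => Xs l ω), Yhat j ω)) =
      ∑ i, (k : ℝ≥0∞)⁻¹ •
        (μ.restrict {ω | ‖X i ω - Xs j ω‖ ≤ knnRadius k (fun l => X l ω) (Xs j ω)}).map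
          (fun ω => (((fun i => (X i ω, Y i ω)), fun l => Xs l ω), Y i ω)) := by
  classical
  set D : Ω → (Fin n → E d × ℝ) × (Fin m → E d) :=
    fun ω => ((fun i => (X i ω, Y i ω)), fun l => Xs l ω) with hD
  have hDm : Measurable D := (measurable_pi_lambda _ fun i =>
    (hS.measurable_X i).prodMk (hS.measurable_Y i)).prodMk
      (measurable_pi_lambda _ hS.measurable_Xs)
  have hle : dataSigma X Y Xs ≤ ‹MeasurableSpace Ω› := hDm.comap_le
  set N : Fin n → Set Ω :=
    fun i => {ω | ‖X i ω - Xs j ω‖ ≤ knnRadius k (fun l => X l ω) (Xs j ω)} with hN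
  have hNm : ∀ i, MeasurableSet (N i) := fun i => hS.measurableSet_nn hk hkn i j
  have hDY : Measurable fun ω => (D ω, Yhat j ω) := hDm.prodMk (hL.measurable j)
  have : IsProbabilityMeasure (μ.map fun ω => (D ω, Yhat j ω)) :=
    Measure.isProbabilityMeasure_map hDY.aemeasurable
  refine Measure.ext_prod fun {S B} hSm hB => ?_
  rw [Measure.map_apply hDY (hSm.prod hB), Measure.finsetSum_apply]
  have hDi : ∀ i, Measurable fun ω => (D ω, Y i ω) := fun i => hDm.prodMk (hS.measurable_Y i)
  have hrhs : ∀ i, ((k : ℝ≥0∞)⁻¹ • (μ.restrict (N i)).map (fun ω => (D ω, Y i ω))) (S ×ˢ B) =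
      ENNReal.ofReal ((k : ℝ)⁻¹ * μ.real (D ⁻¹' S ∩ (N i ∩ Y i ⁻¹' B))) := by
    intro i
    rw [Measure.smul_apply, Measure.map_apply (hDi i) (hSm.prod hB),
      Measure.restrict_apply ((hDi i) (hSm.prod hB)), smul_eq_mul,
      ENNReal.ofReal_mul (by positivity), ofReal_measureReal,
      ENNReal.ofReal_inv_of_pos (by exact_mod_cast hk), ENNReal.ofReal_natCast]
    congr 2
    ext ω
    simp only [mem_inter_iff, mem_preimage, mem_prod]
    tauto
  rw [Finset.sum_congr rfl fun i _ => hrhs i,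
    ← ENNReal.ofReal_sum_of_nonneg fun i _ => by positivity, ← ofReal_measureReal]
  congr 1
  have hYB : MeasurableSet (Yhat j ⁻¹' B) := hL.measurable j hB
  have hDS : MeasurableSet[dataSigma X Y Xs] (D ⁻¹' S) := ⟨S, hSm, rfl⟩
  have h1 : ∫ ω in D ⁻¹' S, (Yhat j ⁻¹' B).indicator (fun _ => (1 : ℝ)) ω ∂μ =
      μ.real ((fun ω => (D ω, Yhat j ω)) ⁻¹' S ×ˢ B) := by
    rw [integral_indicator_const _ hYB, measureReal_restrict_apply hYB, smul_eq_mul, mul_one]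
    congr 1
    ext ω
    simp only [mem_inter_iff, mem_preimage, mem_prod]
    tauto
  rw [← h1, ← setIntegral_condExp hle ((integrable_const _).indicator hYB) hDS,
    setIntegral_congr_ae (hle _ hDS) ((hL.condLaw j B hB).mono fun ω h _ => h),
    integral_const_mul, ← Finset.mul_sum]
  congr 1
  have hite : ∀ i, (fun ω => if ‖X i ω - Xs j ω‖ ≤ knnRadius k (fun i => X i ω) (Xs j ω) ∧
      Y i ω ∈ B then (1 : ℝ) else 0) = (N i ∩ Y i ⁻¹' B).indicator fun _ => (1 : ℝ) := by
    intro i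
    ext ω
    simp only [indicator, mem_inter_iff, hN, mem_ofPred_eq, mem_preimage]
  have hNB : ∀ i, MeasurableSet (N i ∩ Y i ⁻¹' B) := fun i => (hNm i).inter (hS.measurable_Y i hB)
  rw [integral_finsetSum]
  · refine Finset.sum_congr rfl fun i _ => ?_
    rw [hite i, integral_indicator_const _ (hNB i), measureReal_restrict_apply (hNB i),
      smul_eq_mul, mul_one, inter_comm]
  · intro i _
    rw [hite i]
    exact (integrable_const _).indicator (hNB i)

/-- Integrability against a finite sum of measures is integrability against each of them. So the
summands inherit it from the generated label, and nothing has to be assumed about `h` at mismatched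
pairs. -/
theorem IsLabels.integral_eq (hL : IsLabels μ k X Y Xs Yhat) (hS : IsSample μ P Q κ X Y Xs)
    (hk : 1 ≤ k) (hkn : k ≤ n) (j : Fin m) {F : (Fin n → E d) × E d → ℝ → ℝ}
    (hF : Measurable (Function.uncurry F))
    (hint : Integrable (fun ω => F ((fun l => X l ω), Xs j ω) (Yhat j ω)) μ) :
    (∀ i, Integrable (fun ω => nnIndicator k (fun l => X l ω) (Xs j ω) i *
        F ((fun l => X l ω), Xs j ω) (Y i ω)) μ) ∧
      ∫ ω, F ((fun l => X l ω), Xs j ω) (Yhat j ω) ∂μ =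
        (k : ℝ)⁻¹ * ∑ i, ∫ ω, nnIndicator k (fun l => X l ω) (Xs j ω) i *
          F ((fun l => X l ω), Xs j ω) (Y i ω) ∂μ := by
  set D : Ω → (Fin n → E d × ℝ) × (Fin m → E d) :=
    fun ω => ((fun i => (X i ω, Y i ω)), fun l => Xs l ω) with hD
  have hDm : Measurable D := (measurable_pi_lambda _ fun i =>
    (hS.measurable_X i).prodMk (hS.measurable_Y i)).prodMk
      (measurable_pi_lambda _ hS.measurable_Xs)
  set H : ((Fin n → E d × ℝ) × (Fin m → E d)) × ℝ → ℝ :=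
    fun z => F ((fun l => (z.1.1 l).1), z.1.2 j) z.2 with hH
  have hHm : Measurable H := by
    have h1 : Measurable fun z : ((Fin n → E d × ℝ) × (Fin m → E d)) × ℝ =>
      (((fun l => (z.1.1 l).1), z.1.2 j), z.2) := by fun_prop
    exact hF.comp h1
  set N : Fin n → Set Ω :=
    fun i => {ω | ‖X i ω - Xs j ω‖ ≤ knnRadius k (fun l => X l ω) (Xs j ω)} with hN
  have hNm : ∀ i, MeasurableSet (N i) := fun i => hS.measurableSet_nn hk hkn i j
  have hDY : Measurable fun ω => (D ω, Yhat j ω) := hDm.prodMk (hL.measurable j)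
  have hDi : ∀ i, Measurable fun ω => (D ω, Y i ω) := fun i => hDm.prodMk (hS.measurable_Y i)
  have hind : ∀ i, (fun ω => nnIndicator k (fun l => X l ω) (Xs j ω) i *
      F ((fun l => X l ω), Xs j ω) (Y i ω)) = (N i).indicator fun ω => H (D ω, Y i ω) := by
    intro i
    ext ω
    by_cases hω : ω ∈ N i
    · have hω' : ‖X i ω - Xs j ω‖ ≤ knnRadius k (fun l => X l ω) (Xs j ω) := hω
      rw [indicator_of_mem hω, nnIndicator, if_pos hω', one_mul]
    · have hω' : ¬‖X i ω - Xs j ω‖ ≤ knnRadius k (fun l => X l ω) (Xs j ω) := hω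
      rw [indicator_of_notMem hω, nnIndicator, if_neg hω', zero_mul]
  have hmap := hL.map_data_Yhat hS hk hkn j
  have hk0 : (k : ℝ≥0∞)⁻¹ ≠ 0 := ENNReal.inv_ne_zero.2 (ENNReal.natCast_ne_top k)
  have hkt : (k : ℝ≥0∞)⁻¹ ≠ ∞ := ENNReal.inv_ne_top.2 (by exact_mod_cast (by omega : k ≠ 0))
  have hintH : Integrable H (μ.map fun ω => (D ω, Yhat j ω)) := by
    rw [integrable_map_measure hHm.aestronglyMeasurable hDY.aemeasurable]
    exact hint
  rw [hmap, integrable_finsetSum_measure] at hintH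
  have hint' : ∀ i, IntegrableOn (fun ω => H (D ω, Y i ω)) (N i) μ := by
    intro i
    have h1 := hintH i (Finset.mem_univ i)
    rw [integrable_smul_measure hk0 hkt,
      integrable_map_measure hHm.aestronglyMeasurable (hDi i).aemeasurable] at h1
    exact h1
  refine ⟨fun i => by rw [hind i]; exact (hint' i).integrable_indicator (hNm i), ?_⟩
  have h2 : ∫ ω, F ((fun l => X l ω), Xs j ω) (Yhat j ω) ∂μ =
      ∫ z, H z ∂(μ.map fun ω => (D ω, Yhat j ω)) := by
    rw [integral_map hDY.aemeasurable hHm.aestronglyMeasurable]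
  rw [h2, hmap, integral_finsetSum_measure hintH, Finset.mul_sum]
  refine Finset.sum_congr rfl fun i _ => ?_
  rw [integral_smul_measure, integral_map (hDi i).aemeasurable hHm.aestronglyMeasurable, hind i,
    integral_indicator (hNm i), ENNReal.toReal_inv, ENNReal.toReal_natCast, smul_eq_mul]

/-! ### Joint law of the source sample and one target point -/

variable [IsProbabilityMeasure P] [IsMarkovKernel κ]

theorem IsSample.map_joint (hS : IsSample μ P Q κ X Y Xs) (i : Fin n) (j : Fin m) :
    μ.map (fun ω => (((fun l => X l ω), Y i ω), Xs j ω)) =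
      ((Measure.pi fun _ : Fin n => P) ⊗ₘ (κ.comap (fun X : Fin n → E d => X i)
        (measurable_pi_apply i))).prod Q := by
  have hXY : Measurable fun ω i => (X i ω, Y i ω) := measurable_pi_lambda _ fun i =>
    (hS.measurable_X i).prodMk (hS.measurable_Y i)
  have hm : Measurable fun z : Fin n → E d × ℝ => ((fun l => (z l).1), (z i).2) := by fun_prop
  have hind : IndepFun (fun ω => ((fun l => X l ω), Y i ω)) (Xs j) μ :=
    hS.indep.comp hm (measurable_pi_apply j)
  rw [(indepFun_iff_map_prod_eq_prod_map_map
    (hS.measurable_X_pi.prodMk (hS.measurable_Y i)).aemeasurable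
    (hS.measurable_Xs j).aemeasurable).1 hind, hS.law_Xs j, ← map_pi_compProd_eval P κ i,
    ← hS.map_XY, Measure.map_map hm hXY]
  rfl

/-- The index `i` only serves to invoke `map_pi_compProd_eval`, of which this is the first marginal.
-/
theorem IsSample.map_X (hS : IsSample μ P Q κ X Y Xs) (i : Fin n) :
    μ.map (fun ω l => X l ω) = Measure.pi fun _ => P := by
  have hm : Measurable fun z : Fin n → E d × ℝ => ((fun l => (z l).1), (z i).2) := by fun_prop
  have hXY : Measurable fun ω i => (X i ω, Y i ω) := measurable_pi_lambda _ fun i =>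
    (hS.measurable_X i).prodMk (hS.measurable_Y i)
  have h := map_pi_compProd_eval P κ i
  rw [← hS.map_XY, Measure.map_map hm hXY] at h
  have h2 := congrArg Measure.fst h
  rw [Measure.fst_compProd, Measure.fst, Measure.map_map measurable_fst (hm.comp hXY)] at h2
  exact h2

theorem IsSample.integral_joint [IsProbabilityMeasure Q] (hS : IsSample μ P Q κ X Y Xs) (i : Fin n) (j : Fin m)
    {G : ((Fin n → E d) × ℝ) × E d → ℝ} (hG : Measurable G)
    (hint : Integrable (fun ω => G (((fun l => X l ω), Y i ω), Xs j ω)) μ) :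
    ∫ ω, G (((fun l => X l ω), Y i ω), Xs j ω) ∂μ =
      ∫ x, ∫ X', ∫ y, G ((X', y), x) ∂(κ (X' i)) ∂(Measure.pi fun _ : Fin n => P) ∂Q := by
  have hm : Measurable fun ω => (((fun l => X l ω), Y i ω), Xs j ω) :=
    (hS.measurable_X_pi.prodMk (hS.measurable_Y i)).prodMk (hS.measurable_Xs j)
  rw [← integral_map (f := G) hm.aemeasurable hG.aestronglyMeasurable, hS.map_joint i j]
  have hint' : Integrable G (((Measure.pi fun _ : Fin n => P) ⊗ₘ (κ.comap
      (fun X : Fin n → E d => X i) (measurable_pi_apply i))).prod Q) := by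
    rw [← hS.map_joint i j, integrable_map_measure hG.aestronglyMeasurable hm.aemeasurable]
    exact hint
  rw [integral_prod_symm _ hint']
  refine integral_congr_ae ?_
  filter_upwards [hint'.prod_left_ae] with x hx
  rw [Measure.integral_compProd hx]
  rfl

end Laws


/-! ### Taylor expansion of smooth regression functions -/

section TaylorNormed

variable {V : Type*} [NormedAddCommGroup V] [NormedSpace ℝ V]

/-- The mean value inequality, used twice: on the gradient, which moves by at most `M * ‖u - x‖`
along the segment, and then on `f` minus its linear part at `x`. Convexity of `K` keeps the segment
where the bounds hold. -/
theorem taylor_bounds_of_contDiffOn {K U : Set (V)} (hU : IsOpen U) (hK : Convex ℝ K)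
    (hKU : K ⊆ U) {f : V → ℝ} (hf : ContDiffOn ℝ 2 f U) {M : ℝ}
    (hM : ∀ y ∈ K, ‖fderiv ℝ f y‖ + ‖fderiv ℝ (fderiv ℝ f) y‖ ≤ M) {x u : V} (hx : x ∈ K)
    (hu : u ∈ K) :
    ‖fderiv ℝ f x‖ ≤ M ∧ |f u - f x| ≤ M * ‖u - x‖ ∧
      |f u - f x - fderiv ℝ f x (u - x)| ≤ M * ‖u - x‖ ^ 2 := by
  have h1 : ∀ y ∈ K, ‖fderiv ℝ f y‖ ≤ M := fun y hy => by
    linarith [hM y hy, norm_nonneg (fderiv ℝ (fderiv ℝ f) y)]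
  have h2 : ∀ y ∈ K, ‖fderiv ℝ (fderiv ℝ f) y‖ ≤ M := fun y hy => by
    linarith [hM y hy, norm_nonneg (fderiv ℝ f y)]
  have hM0 : 0 ≤ M := (norm_nonneg _).trans (h1 x hx)
  have hd1 : ∀ y ∈ K, DifferentiableAt ℝ f y := fun y hy =>
    (hf.differentiableOn (by norm_num)).differentiableAt (hU.mem_nhds (hKU hy))
  have hf' : ContDiffOn ℝ 1 (fderiv ℝ f) U := hf.fderiv_of_isOpen hU (by norm_num)
  have hd2 : ∀ y ∈ K, DifferentiableAt ℝ (fderiv ℝ f) y := fun y hy =>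
    (hf'.differentiableOn (by norm_num)).differentiableAt (hU.mem_nhds (hKU hy))
  refine ⟨h1 x hx, Convex.norm_image_sub_le_of_norm_fderiv_le hd1 h1 hK hx hu, ?_⟩
  have hseg : segment ℝ x u ⊆ K := hK.segment_subset hx hu
  have h3 : ∀ y ∈ segment ℝ x u, ‖fderiv ℝ f y - fderiv ℝ f x‖ ≤ M * ‖u - x‖ := by
    intro y hy
    refine (Convex.norm_image_sub_le_of_norm_fderiv_le hd2 h2 hK hx (hseg hy)).trans ?_
    gcongr
    exact norm_sub_le_of_mem_segment hy
  have h4 := Convex.norm_image_sub_le_of_norm_fderiv_le' (fun y hy => hd1 y (hseg hy)) h3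
    (convex_segment x u) (left_mem_segment ℝ x u) (right_mem_segment ℝ x u)
  rw [Real.norm_eq_abs] at h4
  exact h4.trans (le_of_eq (by ring))

theorem exists_norm_fderiv_add_norm_fderiv_fderiv_le {K U : Set V} (hU : IsOpen U)
    (hK : IsCompact K) (hKU : K ⊆ U) {f : V → ℝ} (hf : ContDiffOn ℝ 2 f U) :
    ∃ M : ℝ, ∀ y ∈ K, ‖fderiv ℝ f y‖ + ‖fderiv ℝ (fderiv ℝ f) y‖ ≤ M := by
  have hf' : ContDiffOn ℝ 1 (fderiv ℝ f) U := hf.fderiv_of_isOpen hU (by norm_num)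
  have hf'' : ContinuousOn (fderiv ℝ (fderiv ℝ f)) U :=
    hf'.continuousOn_fderiv_of_isOpen hU (by norm_num)
  have hn : ContinuousOn (fun y => ‖fderiv ℝ (fderiv ℝ f) y‖) U :=
    ContinuousOn.norm (E := V →L[ℝ] V →L[ℝ] ℝ) hf''
  obtain ⟨M, hM⟩ := (hK.image_of_continuousOn
    ((hf'.continuousOn.norm.add hn).mono hKU)).bddAbove
  exact ⟨M, fun y hy => hM ⟨y, hy, rfl⟩⟩

end TaylorNormed

section Taylor

variable {d : ℕ}

open scoped Pointwise in
-- Cover `s` by finitely many balls of radius `r`, where the closed `r`-thickening of `s` stays in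
-- `U`. The hull of the centres plus the closed `r`-ball is compact and convex, and it is the hull
-- of a subset of that thickening. Such a set lets compactness bound derivatives for which no bound
-- is assumed.
theorem exists_isCompact_convex_between {s U : Set (E d)} (hs : IsCompact s) (hU : IsOpen U)
    (hUc : Convex ℝ U) (hsU : s ⊆ U) :
    ∃ K : Set (E d), IsCompact K ∧ Convex ℝ K ∧ s ⊆ K ∧ K ⊆ U := by
  obtain ⟨r, hr, hrU⟩ := hs.exists_cthickening_subset_open hU hsU
  obtain ⟨t, hts, htf, hst⟩ := hs.finite_cover_balls hr
  refine ⟨convexHull ℝ t + Metric.closedBall 0 r,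
    (htf.isCompact_convexHull ℝ).add (isCompact_closedBall 0 r),
    (convex_convexHull ℝ t).add (convex_closedBall 0 r), fun x hx => ?_, ?_⟩
  · obtain ⟨y, hy, hxy⟩ := mem_iUnion₂.1 (hst hx)
    refine Set.mem_add.2 ⟨y, subset_convexHull ℝ t hy, x - y, ?_, by abel⟩
    rw [mem_closedBall_zero_iff, ← dist_eq_norm]
    exact (Metric.mem_ball.1 hxy).le
  · have hball : convexHull ℝ (Metric.closedBall (0 : E d) r) = Metric.closedBall 0 r :=
      (convex_closedBall 0 r).convexHull_eq
    rw [← hball, ← convexHull_add]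
    refine convexHull_min ?_ hUc
    rintro _ ⟨y, hy, z, hz, rfl⟩
    refine hrU (Metric.mem_cthickening_of_dist_le _ y r s (hts hy) ?_)
    simpa [dist_eq_norm] using hz

/-- The cut-off makes the increment bounded everywhere when `𝒳` is bounded, and almost surely
changes nothing, since both samples live in `𝒳`. -/
theorem isLocalIncrement_of_taylor {𝒳 : Set (E d)} (h𝒳 : MeasurableSet 𝒳) {M : ℝ}
    {Ψ : E d → E d → ℝ} (hΨ : Measurable (Function.uncurry Ψ))
    (hT : ∀ x ∈ 𝒳, ∃ A : E d →L[ℝ] ℝ, ‖A‖ ≤ M ∧ ∀ u ∈ 𝒳, |Ψ x u - Ψ x x| ≤ M * ‖u - x‖ ∧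
      |Ψ x u - Ψ x x - A (u - x)| ≤ M * ‖u - x‖ ^ 2) :
    IsLocalIncrement 𝒳 M
      (fun x u => (𝒳 ×ˢ 𝒳).indicator (fun z => Ψ z.1 z.2 - Ψ z.1 z.1) (x, u)) := by
  have hin : ∀ x ∈ 𝒳, ∀ u ∈ 𝒳, (𝒳 ×ˢ 𝒳).indicator (fun z => Ψ z.1 z.2 - Ψ z.1 z.1) (x, u) =
      Ψ x u - Ψ x x := fun x hx u hu =>
    indicator_of_mem (show (x, u) ∈ 𝒳 ×ˢ 𝒳 from ⟨hx, hu⟩) _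
  refine ⟨?_, fun x u hxu =>
    indicator_of_notMem (show (x, u) ∉ 𝒳 ×ˢ 𝒳 from hxu) _, fun x hx u hu => ?_, fun x hx => ?_⟩
  · have hdiag : Measurable fun z : E d × E d => Ψ z.1 z.1 :=
      hΨ.comp (measurable_fst.prodMk measurable_fst)
    exact (Measurable.sub hΨ hdiag).indicator (h𝒳.prod h𝒳)
  · obtain ⟨A, _, h⟩ := hT x hx
    rw [hin x hx u hu]
    exact (h u hu).1
  · obtain ⟨A, hA, h⟩ := hT x hx
    refine ⟨A, hA, fun u hu => ?_⟩
    rw [hin x hx u hu]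
    exact (h u hu).2

theorem SmoothDelta.exists_taylor {𝒳 : Set (E d)} {κ : Kernel (E d) ℝ} {h : E d → ℝ → ℝ}
    (hD : SmoothDelta 𝒳 κ h) :
    ∃ M : ℝ, 0 ≤ M ∧ ∀ x ∈ 𝒳, ∃ A : E d →L[ℝ] ℝ, ‖A‖ ≤ M ∧ ∀ u ∈ 𝒳,
      |Delta κ h x u - Delta κ h x x| ≤ M * ‖u - x‖ ∧
      |Delta κ h x u - Delta κ h x x - A (u - x)| ≤ M * ‖u - x‖ ^ 2 := by
  obtain ⟨U, hU, hUc, -, h𝒳U, D, hDx, M, hM⟩ := hD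
  -- The bound `M` need not be nonnegative when `𝒳` is empty, a case not excluded here.
  refine ⟨max M 0, le_max_right _ _, fun x hx => ⟨fderiv ℝ (D x) x, ?_⟩⟩
  have hco : ∀ u ∈ 𝒳, u ∈ convexHull ℝ 𝒳 := fun u hu => subset_convexHull ℝ 𝒳 hu
  have key := fun u (hu : u ∈ 𝒳) => taylor_bounds_of_contDiffOn hU (convex_convexHull ℝ 𝒳)
    (convexHull_min h𝒳U hUc) (hDx x hx).1 (M := max M 0)
    (fun y hy => (hM x hx y hy).trans (le_max_left _ _)) (hco x hx) (hco u hu)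
  refine ⟨(key x hx).1, fun u hu => ?_⟩
  rw [← (hDx x hx).2 hu, ← (hDx x hx).2 hx]
  exact (key u hu).2

theorem SmoothRegr.exists_taylor {𝒳 : Set (E d)} (h𝒳 : IsCompact 𝒳) {κ : Kernel (E d) ℝ}
    {h : E d → ℝ → ℝ} (hG : SmoothRegr 𝒳 κ h) :
    ∃ M : ℝ, 0 ≤ M ∧ ∀ x ∈ 𝒳, ∃ A : E d →L[ℝ] ℝ, ‖A‖ ≤ M ∧ ∀ u ∈ 𝒳,
      |regr κ h u - regr κ h x| ≤ M * ‖u - x‖ ∧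
      |regr κ h u - regr κ h x - A (u - x)| ≤ M * ‖u - x‖ ^ 2 := by
  obtain ⟨U, hU, hUc, -, h𝒳U, G, hG, hGr⟩ := hG
  obtain ⟨K, hK, hKc, h𝒳K, hKU⟩ := exists_isCompact_convex_between h𝒳 hU hUc h𝒳U
  obtain ⟨M, hM⟩ := exists_norm_fderiv_add_norm_fderiv_fderiv_le hU hK hKU hG
  refine ⟨max M 0, le_max_right _ _, fun x hx => ⟨fderiv ℝ G x, ?_⟩⟩
  have key := fun u (hu : u ∈ 𝒳) => taylor_bounds_of_contDiffOn hU hKc hKU hG (M := max M 0)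
    (fun y hy => (hM y hy).trans (le_max_left _ _)) (h𝒳K hx) (h𝒳K hu)
  refine ⟨(key x hx).1, fun u hu => ?_⟩
  rw [← hGr hu, ← hGr hx]
  exact (key u hu).2

end Taylor

section Target

variable {d : ℕ} {𝒳 : Set (E d)} {P Q : Measure (E d)} {κ : Kernel (E d) ℝ}
  {h : E d → ℝ → ℝ} {p q : E d → ℝ}

/-! ### The target mean -/

/-- On `𝒳`, `q ≤ b ≤ (b / a) p` for the bounds `a`, `b` on the densities. This domination carries
integrability of `h` from the source to the target law. -/
theorem exists_le_smul (h𝒳 : MeasurableSet 𝒳) (hQ : Q 𝒳ᶜ = 0) (hp : IsDensity P p)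
    (hq : IsDensity Q q) (hpinf : ∃ pinf : ℝ, 0 < pinf ∧ ∀ x ∈ 𝒳, pinf ≤ p x)
    (hqsup : ∃ qsup : ℝ, 0 < qsup ∧ ∀ x ∈ 𝒳, q x ≤ qsup) :
    ∃ c : ℝ≥0∞, c ≠ ∞ ∧ Q ≤ c • P := by
  obtain ⟨a, ha, hpa⟩ := hpinf
  obtain ⟨b, hb, hqb⟩ := hqsup
  refine ⟨ENNReal.ofReal (b / a), ENNReal.ofReal_ne_top, Measure.le_iff.2 fun s hs => ?_⟩
  have hs𝒳 := hs.inter h𝒳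
  calc Q s ≤ Q (s ∩ 𝒳) + Q 𝒳ᶜ :=
        (measure_mono fun y hy => by by_cases hy' : y ∈ 𝒳 <;> simp [hy, hy']).trans
          (measure_union_le _ _)
    _ = ∫⁻ y in s ∩ 𝒳, ENNReal.ofReal (q y) := by
        rw [hQ, add_zero]
        conv_lhs => rw [hq.eq]
        rw [withDensity_apply _ hs𝒳]
    _ ≤ ∫⁻ y in s ∩ 𝒳, ENNReal.ofReal (b / a) * ENNReal.ofReal (p y) := by
        refine setLIntegral_mono (hp.measurable.ennreal_ofReal.const_mul _) fun y hy => ?_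
        rw [← ENNReal.ofReal_mul (by positivity)]
        refine ENNReal.ofReal_le_ofReal ((hqb y hy.2).trans ?_)
        rw [div_mul_eq_mul_div, le_div_iff₀ ha]
        exact mul_le_mul_of_nonneg_left (hpa y hy.2) hb.le
    _ = ENNReal.ofReal (b / a) * P (s ∩ 𝒳) := by
        rw [lintegral_const_mul _ hp.measurable.ennreal_ofReal]
        conv_rhs => rw [hp.eq]
        rw [withDensity_apply _ hs𝒳]
    _ ≤ (ENNReal.ofReal (b / a) • P) s := by
        rw [Measure.smul_apply, smul_eq_mul]
        gcongr
        exact inter_subset_left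

variable [IsProbabilityMeasure P] [IsProbabilityMeasure Q] [IsMarkovKernel κ]

theorem integrable_compProd_of_le_smul (hint : Integrable (Function.uncurry h) (P ⊗ₘ κ))
    {c : ℝ≥0∞} (hc : c ≠ ∞) (hQP : Q ≤ c • P) : Integrable (Function.uncurry h) (Q ⊗ₘ κ) := by
  have hle : Q ⊗ₘ κ ≤ c • (P ⊗ₘ κ) := by
    refine Measure.le_iff.2 fun s hs => ?_
    rw [Measure.smul_apply, Measure.compProd_apply hs, Measure.compProd_apply hs]
    exact (lintegral_mono' hQP le_rfl).trans (le_of_eq (lintegral_smul_measure _ _))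
  exact (hint.smul_measure hc).mono_measure hle

theorem integrable_regr_and_targetMean_eq (hint : Integrable (Function.uncurry h) (Q ⊗ₘ κ)) :
    Integrable (regr κ h) Q ∧ targetMean Q κ h = ∫ x, regr κ h x ∂Q :=
  ⟨Integrable.integral_compProd (κ := Kernel.const Unit Q)
    (η := Kernel.prodMkLeft Unit κ) (a := Unit.unit) hint, Measure.integral_compProd hint⟩

theorem measurable_Delta (hh : Measurable (Function.uncurry h)) :
    Measurable (Function.uncurry (Delta κ h)) := by
  have hm : Measurable fun z : (E d × E d) × ℝ => h z.1.1 z.2 :=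
    hh.comp (by fun_prop : Measurable fun z : (E d × E d) × ℝ => (z.1.1, z.2))
  exact (StronglyMeasurable.integral_kernel_prod_right'
    (κ := κ.comap Prod.snd measurable_snd) hm.stronglyMeasurable).measurable

theorem measurable_regr (hh : Measurable (Function.uncurry h)) : Measurable (regr κ h) :=
  (StronglyMeasurable.integral_kernel_prod_right' (κ := κ) hh.stronglyMeasurable).measurable

end Target


section ConditionalBias

variable {d n m k : ℕ} {𝒳 : Set (E d)} {P Q : Measure (E d)} [IsProbabilityMeasure P]
  [IsProbabilityMeasure Q]

/-! ### Identification of the conditional bias -/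

theorem sum_nnIndicator_mul (X : Fin n → E d) (x : E d) (φ : Fin n → ℝ) :
    ∑ i, nnIndicator k X x i * φ i =
      ∑ i ∈ Finset.univ.filter (fun i => ‖X i - x‖ ≤ knnRadius k X x), φ i := by
  rw [Finset.sum_filter]
  exact Finset.sum_congr rfl fun i _ => by unfold nnIndicator; split_ifs <;> simp

/-- Without ties exactly `k` indicators equal one, so the part `g x` of `Ψ` averages to itself and
only `Φ` contributes to the bias. The event `A` is the test set for the conditional expectation
given the covariates. -/
theorem sum_integral_nnIndicator_mul (hd : 1 ≤ d) (hk : 1 ≤ k) (hkn : k ≤ n) (hPac : P ≪ volume)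
    (hP : P 𝒳ᶜ = 0) (hQ : Q 𝒳ᶜ = 0) {Φ Ψ : E d → E d → ℝ} {g : E d → ℝ}
    (hΦm : Measurable (Function.uncurry Φ)) (hΨm : Measurable (Function.uncurry Ψ))
    {D : ℝ} (hΦD : ∀ x u, |Φ x u| ≤ D) (hg : Integrable g Q)
    (hΨ : ∀ x ∈ 𝒳, ∀ u ∈ 𝒳, Ψ x u = Φ x u + g x) {A : Set (Fin n → E d)}
    (hA : MeasurableSet A) :
    (k : ℝ)⁻¹ * ∑ i, ∫ x, ∫ X, A.indicator (fun _ => (1 : ℝ)) X *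
        (nnIndicator k X x i * Ψ x (X i)) ∂(Measure.pi fun _ : Fin n => P) ∂Q =
      ∫ X in A, (nnBias Finset.univ k Q Φ X + ∫ x, g x ∂Q) ∂(Measure.pi fun _ : Fin n => P) := by
  have hk0 : (k : ℝ) ≠ 0 := by exact_mod_cast (by omega : k ≠ 0)
  set ν := Measure.pi fun _ : Fin n => P with hν
  set f : Fin n → (Fin n → E d) → E d → ℝ := fun i X x =>
    A.indicator (fun _ => (1 : ℝ)) X * (nnIndicator k X x i * Ψ x (X i)) with hf
  have hA1 : ∀ X, |A.indicator (fun _ => (1 : ℝ)) X| ≤ 1 := fun X => by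
    by_cases hX : X ∈ A <;> simp [hX]
  have hfm : ∀ i, Measurable (Function.uncurry (f i)) := by
    intro i
    have h1 : Measurable fun z : (Fin n → E d) × E d => (z.2, z.1 i) := by fun_prop
    exact ((measurable_const.indicator hA).comp measurable_fst).mul
      ((measurable_nnIndicator hk hkn i).mul (hΨm.comp h1))
  have hfi : ∀ i, Integrable (Function.uncurry (f i)) (ν.prod Q) := by
    intro i
    have hdom : Integrable (fun z : (Fin n → E d) × E d => D + ‖g z.2‖) (ν.prod Q) :=
      (integrable_const D).add (hg.norm.comp_snd ν)
    refine hdom.mono' (hfm i).aestronglyMeasurable ?_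
    filter_upwards [Measure.quasiMeasurePreserving_fst.ae (ae_pi_forall_mem (n := n) hP),
      Measure.quasiMeasurePreserving_snd.ae (show ∀ᵐ x ∂Q, x ∈ 𝒳 from hQ)] with z h1 h2
    have h3 : |Ψ z.2 (z.1 i)| ≤ D + ‖g z.2‖ := by
      rw [hΨ z.2 h2 _ (h1 i)]
      exact (abs_add_le _ _).trans (add_le_add (hΦD _ _) le_rfl)
    simp only [Function.uncurry, hf, norm_mul, Real.norm_eq_abs]
    calc _ ≤ 1 * (1 * |Ψ z.2 (z.1 i)|) := by
          gcongr
          · exact hA1 _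
          · exact abs_nnIndicator_le_one _ _ _ _
      _ ≤ _ := by rw [one_mul, one_mul]; exact h3
  have hswap : ∀ i, ∫ x, ∫ X, f i X x ∂ν ∂Q = ∫ X, ∫ x, f i X x ∂Q ∂ν := fun i =>
    (integral_integral_swap (hfi i)).symm
  have hfl : ∀ i, Integrable (fun X => ∫ x, f i X x ∂Q) ν := fun i => (hfi i).integral_prod_left
  rw [Finset.sum_congr rfl fun i _ => hswap i, ← integral_finsetSum _ fun i _ => hfl i, ← integral_const_mul, ← integral_indicator hA]
  refine integral_congr_ae ?_
  filter_upwards [ae_pi_forall_mem (n := n) hP, ae_ae_injective_norm_sub (n := n) (Q := Q) hd hPac,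
    ae_all_iff.2 fun i => (hfi i).prod_right_ae] with X hX hinj hint
  have hnm : Integrable (fun x => (k : ℝ)⁻¹ * nnSum Finset.univ k Φ X x) Q := by
    have hXx : Measurable fun x : E d => (X, x) := by fun_prop
    have hm := (measurable_nnSum hk (s := Finset.univ) (by simpa using hkn) hΦm).comp hXx
    simp only [Function.comp_def] at hm
    exact (integrable_of_abs_le hm (abs_nnSum_le hΦD X)).const_mul _
  have hpt : ∀ᵐ x ∂Q, (k : ℝ)⁻¹ * ∑ i, f i X x = A.indicator (fun _ => (1 : ℝ)) X *
      ((k : ℝ)⁻¹ * nnSum Finset.univ k Φ X x + g x) := by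
    filter_upwards [hinj, show ∀ᵐ x ∂Q, x ∈ 𝒳 from hQ] with x hx hx𝒳
    have h1 : ∑ i, nnIndicator k X x i * Ψ x (X i) = nnSum Finset.univ k Φ X x + k * g x := by
      rw [sum_nnIndicator_mul, Finset.sum_congr rfl fun i _ => hΨ x hx𝒳 (X i) (hX i),
        Finset.sum_add_distrib, Finset.sum_const, card_filter_knnRadius hk hkn hx, nsmul_eq_mul]
      rfl
    simp only [hf]
    rw [← Finset.mul_sum, h1]
    field_simp
  calc (k : ℝ)⁻¹ * ∑ i, ∫ x, f i X x ∂Q = ∫ x, (k : ℝ)⁻¹ * ∑ i, f i X x ∂Q := by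
        have hint' : ∀ i, Integrable (fun x => f i X x) Q := hint
        rw [integral_const_mul, integral_finsetSum _ fun i _ => hint' i]
    _ = ∫ x, A.indicator (fun _ => (1 : ℝ)) X *
          ((k : ℝ)⁻¹ * nnSum Finset.univ k Φ X x + g x) ∂Q := integral_congr_ae hpt
    _ = A.indicator (fun _ => (1 : ℝ)) X * (nnBias Finset.univ k Q Φ X + ∫ x, g x ∂Q) := by
        rw [integral_const_mul, integral_add hnm hg]
        rfl
    _ = _ := by
        by_cases hXA : X ∈ A <;> simp [hXA]

variable {Ω : Type*} [MeasurableSpace Ω] {μ : Measure Ω} [IsProbabilityMeasure μ]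
  {κ : Kernel (E d) ℝ} [IsMarkovKernel κ]
  {X : Fin n → Ω → E d} {Y : Fin n → Ω → ℝ} {Xs : Fin m → Ω → E d}

theorem IsSample.setIntegral_nnIndicator_mul (hS : IsSample μ P Q κ X Y Xs) (hk : 1 ≤ k)
    (hkn : k ≤ n) {H : E d → E d → ℝ → ℝ}
    (hH : Measurable fun z : (E d × E d) × ℝ => H z.1.1 z.1.2 z.2) (i : Fin n) (j : Fin m)
    (hint : Integrable (fun ω => nnIndicator k (fun l => X l ω) (Xs j ω) i *
      H (X i ω) (Xs j ω) (Y i ω)) μ) {A : Set (Fin n → E d)} (hA : MeasurableSet A) :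
    ∫ ω in (fun ω l => X l ω) ⁻¹' A, nnIndicator k (fun l => X l ω) (Xs j ω) i *
        H (X i ω) (Xs j ω) (Y i ω) ∂μ =
      ∫ x, ∫ X', A.indicator (fun _ => (1 : ℝ)) X' *
        (nnIndicator k X' x i * ∫ y, H (X' i) x y ∂(κ (X' i)))
          ∂(Measure.pi fun _ : Fin n => P) ∂Q := by
  set G : ((Fin n → E d) × ℝ) × E d → ℝ := fun z => A.indicator (fun _ => (1 : ℝ)) z.1.1 *
    (nnIndicator k z.1.1 z.2 i * H (z.1.1 i) z.2 z.1.2) with hG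
  have hGm : Measurable G := by
    have h1 : Measurable fun z : ((Fin n → E d) × ℝ) × E d => (z.1.1, z.2) := by fun_prop
    have h2 : Measurable fun z : ((Fin n → E d) × ℝ) × E d => ((z.1.1 i, z.2), z.1.2) := by
      fun_prop
    have h3 := (measurable_nnIndicator (d := d) hk hkn i).comp h1
    have h4 := hH.comp h2
    have h5 : Measurable fun z : ((Fin n → E d) × ℝ) × E d =>
        A.indicator (fun _ => (1 : ℝ)) z.1.1 :=
      (measurable_const.indicator hA).comp (measurable_fst.comp measurable_fst)
    exact h5.mul (h3.mul h4)
  have hAm : MeasurableSet ((fun ω l => X l ω) ⁻¹' A) := hS.measurable_X_pi hA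
  have hind : (fun ω => G (((fun l => X l ω), Y i ω), Xs j ω)) =
      ((fun ω l => X l ω) ⁻¹' A).indicator (fun ω => nnIndicator k (fun l => X l ω) (Xs j ω) i *
        H (X i ω) (Xs j ω) (Y i ω)) := by
    ext ω
    by_cases hω : (fun l => X l ω) ∈ A
    · rw [indicator_of_mem (show ω ∈ (fun ω l => X l ω) ⁻¹' A from hω)]
      simp only [hG, indicator_of_mem hω, one_mul]
    · rw [indicator_of_notMem (show ω ∉ (fun ω l => X l ω) ⁻¹' A from hω)]
      simp only [hG, indicator_of_notMem hω, zero_mul]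
  have hGi : Integrable (fun ω => G (((fun l => X l ω), Y i ω), Xs j ω)) μ := by
    rw [hind]; exact hint.indicator hAm
  rw [← integral_indicator hAm, ← hind, hS.integral_joint i j hGm hGi]
  simp only [hG, integral_const_mul]

/-- Treats both estimators at once: `H` receives the source covariate, the target covariate and the
source label, so `h` can be evaluated at either covariate. Every `j` contributes the same integral
over each event of `covSigma X`, which removes `m` and identifies the conditional expectation. -/
theorem IsSample.condBias_ae_eq (hS : IsSample μ P Q κ X Y Xs) (hd : 1 ≤ d) (hk : 1 ≤ k)
    (hkn : k ≤ n) (hm1 : 1 ≤ m) (hPac : P ≪ volume) (hP : P 𝒳ᶜ = 0) (hQ : Q 𝒳ᶜ = 0)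
    {H : E d → E d → ℝ → ℝ} (hH : Measurable fun z : (E d × E d) × ℝ => H z.1.1 z.1.2 z.2)
    {Φ Ψ : E d → E d → ℝ} {g : E d → ℝ}
    (hΦm : Measurable (Function.uncurry Φ)) (hΨm : Measurable (Function.uncurry Ψ))
    (hΨH : ∀ x u, Ψ x u = ∫ y, H u x y ∂(κ u))
    {D : ℝ} (hΦD : ∀ x u, |Φ x u| ≤ D) (hg : Integrable g Q)
    (hΨ : ∀ x ∈ 𝒳, ∀ u ∈ 𝒳, Ψ x u = Φ x u + g x)
    (hint : ∀ i j, Integrable (fun ω => nnIndicator k (fun l => X l ω) (Xs j ω) i *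
      H (X i ω) (Xs j ω) (Y i ω)) μ)
    {est : Ω → ℝ} (hest : Integrable est μ)
    (hestA : ∀ A : Set (Fin n → E d), MeasurableSet A →
      ∫ ω in (fun ω l => X l ω) ⁻¹' A, est ω ∂μ = (m : ℝ)⁻¹ * ∑ j, (k : ℝ)⁻¹ * ∑ i,
        ∫ ω in (fun ω l => X l ω) ⁻¹' A, nnIndicator k (fun l => X l ω) (Xs j ω) i *
          H (X i ω) (Xs j ω) (Y i ω) ∂μ) :
    condBias μ X est (∫ x, g x ∂Q) =ᵐ[μ]
      fun ω => nnBias Finset.univ k Q Φ (fun l => X l ω) := by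
  have hXm := hS.measurable_X_pi
  have hle : covSigma X ≤ ‹MeasurableSpace Ω› := hXm.comap_le
  have hbm : Measurable fun X' : Fin n → E d => nnBias Finset.univ k Q Φ X' + ∫ x, g x ∂Q :=
    (measurable_nnBias hk (by simpa using hkn) hΦm Q).add_const _
  have hi₀ : Fin n := ⟨0, by omega⟩
  have hbint : Integrable (fun ω => nnBias Finset.univ k Q Φ (fun l => X l ω) + ∫ x, g x ∂Q) μ := by
    refine integrable_of_abs_le (hbm.comp hXm) (C := (k : ℝ)⁻¹ * (n * D) + |∫ x, g x ∂Q|)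
      fun ω => ?_
    exact (abs_add_le _ _).trans (add_le_add (abs_nnBias_le hΦD Q _) le_rfl)
  have hce : (fun ω => nnBias Finset.univ k Q Φ (fun l => X l ω) + ∫ x, g x ∂Q) =ᵐ[μ]
      μ[est | covSigma X] := by
    refine ae_eq_condExp_of_forall_setIntegral_eq hle hest (fun s _ _ => hbint.integrableOn) ?_ ?_
    · rintro s ⟨A, hA, rfl⟩ -
      have hm0 : (m : ℝ) ≠ 0 := by exact_mod_cast (by omega : m ≠ 0)
      rw [hestA A hA]
      have hj : ∀ j, (k : ℝ)⁻¹ * ∑ i, ∫ ω in (fun ω l => X l ω) ⁻¹' A,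
          nnIndicator k (fun l => X l ω) (Xs j ω) i * H (X i ω) (Xs j ω) (Y i ω) ∂μ =
          ∫ X' in A, (nnBias Finset.univ k Q Φ X' + ∫ x, g x ∂Q)
            ∂(Measure.pi fun _ : Fin n => P) := by
        intro j
        rw [← sum_integral_nnIndicator_mul hd hk hkn hPac hP hQ hΦm hΨm hΦD hg hΨ hA]
        congr 1
        refine Finset.sum_congr rfl fun i _ => ?_
        rw [hS.setIntegral_nnIndicator_mul hk hkn hH i j (hint i j) hA]
        simp only [hΨH]
      rw [Finset.sum_congr rfl fun j _ => hj j, Finset.sum_const, Finset.card_univ,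
        Fintype.card_fin, nsmul_eq_mul, inv_mul_cancel_left₀ hm0, ← hS.map_X hi₀,
        setIntegral_map hA hbm.aestronglyMeasurable hXm.aemeasurable]
    · exact (hbm.stronglyMeasurable.comp_measurable
        (comap_measurable _)).aestronglyMeasurable
  filter_upwards [hce] with ω hω
  rw [condBias, ← hω]
  ring

theorem IsSample.integral_sq_le_of_ae_eq (hS : IsSample μ P Q κ X Y Xs) (hk : 1 ≤ k)
    (hkn : k ≤ n) {Φ : E d → E d → ℝ} (hΦm : Measurable (Function.uncurry Φ))
    {D : ℝ} (hΦD : ∀ x u, |Φ x u| ≤ D) {B : Ω → ℝ} {b : ℝ}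
    (hB : B =ᵐ[μ] fun ω => nnBias Finset.univ k Q Φ (fun l => X l ω))
    (hb : ∫ X', nnBias Finset.univ k Q Φ X' ^ 2 ∂(Measure.pi fun _ : Fin n => P) ≤ b) :
    Integrable (fun ω => B ω ^ 2) μ ∧ ∫ ω, B ω ^ 2 ∂μ ≤ b := by
  have hXm := hS.measurable_X_pi
  have hbm : Measurable fun X' : Fin n → E d => nnBias Finset.univ k Q Φ X' ^ 2 :=
    (measurable_nnBias hk (by simpa using hkn) hΦm Q).pow_const 2
  have hB2 : (fun ω => B ω ^ 2) =ᵐ[μ] fun ω => nnBias Finset.univ k Q Φ (fun l => X l ω) ^ 2 := by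
    filter_upwards [hB] with ω hω
    rw [hω]
  constructor
  · refine Integrable.congr ?_ hB2.symm
    refine integrable_of_abs_le (hbm.comp hXm) (C := ((k : ℝ)⁻¹ * (n * D)) ^ 2) fun ω => ?_
    simp only [abs_pow]
    exact pow_le_pow_left₀ (abs_nonneg _) (abs_nnBias_le hΦD Q _) 2
  · rw [integral_congr_ae hB2]
    rw [← hS.map_X ⟨0, by omega⟩, integral_map hXm.aemeasurable hbm.aestronglyMeasurable] at hb
    exact hb

end ConditionalBias

section Estimators

/-! ### The two estimators -/

variable {d n m k : ℕ} {P Q : Measure (E d)} {Ω : Type*} [MeasurableSpace Ω] {μ : Measure Ω}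
  {κ : Kernel (E d) ℝ} {X : Fin n → Ω → E d} {Y : Fin n → Ω → ℝ} {Xs : Fin m → Ω → E d}
  {h : E d → ℝ → ℝ} {Yhat : Fin m → Ω → ℝ}

/-- The event depends on the covariates only, so its indicator can be absorbed into the integrand
`F` before the label is integrated out. -/
theorem est1_setIntegral [IsProbabilityMeasure μ] (hS : IsSample μ P Q κ X Y Xs) (hL : IsLabels μ k X Y Xs Yhat)
    (hk : 1 ≤ k) (hkn : k ≤ n) (hh : Measurable (Function.uncurry h))
    (hint : ∀ j, Integrable (fun ω => h (Xs j ω) (Yhat j ω)) μ) {A : Set (Fin n → E d)}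
    (hA : MeasurableSet A) :
    ∫ ω in (fun ω l => X l ω) ⁻¹' A, est1 h (fun j => Xs j ω) (fun j => Yhat j ω) ∂μ =
      (m : ℝ)⁻¹ * ∑ j, (k : ℝ)⁻¹ * ∑ i, ∫ ω in (fun ω l => X l ω) ⁻¹' A,
        nnIndicator k (fun l => X l ω) (Xs j ω) i * h (Xs j ω) (Y i ω) ∂μ := by
  have hAm : MeasurableSet ((fun ω l => X l ω) ⁻¹' A) := hS.measurable_X_pi hA
  simp only [est1]
  rw [integral_const_mul, integral_finsetSum _ fun j _ => (hint j).integrableOn, one_div]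
  congr 1
  refine Finset.sum_congr rfl fun j _ => ?_
  set F : (Fin n → E d) × E d → ℝ → ℝ :=
    fun z y => A.indicator (fun _ => (1 : ℝ)) z.1 * h z.2 y with hF
  have hFm : Measurable (Function.uncurry F) := by
    have h1 : Measurable fun z : ((Fin n → E d) × E d) × ℝ => (z.1.2, z.2) := by fun_prop
    have h5 : Measurable fun z : ((Fin n → E d) × E d) × ℝ =>
        A.indicator (fun _ => (1 : ℝ)) z.1.1 :=
      (measurable_const.indicator hA).comp (measurable_fst.comp measurable_fst)
    exact h5.mul (hh.comp h1)
  have hind : ∀ φ : Ω → ℝ, (fun ω => A.indicator (fun _ => (1 : ℝ)) (fun l => X l ω) * φ ω) =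
      ((fun ω l => X l ω) ⁻¹' A).indicator φ := by
    intro φ
    ext ω
    by_cases hω : (fun l => X l ω) ∈ A
    · rw [indicator_of_mem (show ω ∈ (fun ω l => X l ω) ⁻¹' A from hω), indicator_of_mem hω,
        one_mul]
    · rw [indicator_of_notMem (show ω ∉ (fun ω l => X l ω) ⁻¹' A from hω),
        indicator_of_notMem hω, zero_mul]
  have hFint : Integrable (fun ω => F ((fun l => X l ω), Xs j ω) (Yhat j ω)) μ := by
    simp only [hF]
    rw [hind]
    exact (hint j).indicator hAm
  have h2 := (hL.integral_eq hS hk hkn j hFm hFint).2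
  simp only [hF, mul_left_comm (nnIndicator k _ _ _)] at h2
  rw [hind, integral_indicator hAm] at h2
  rw [h2]
  congr 1
  refine Finset.sum_congr rfl fun i _ => ?_
  rw [hind, integral_indicator hAm]

/-- Double counting of the matched pairs `(i, j)`: in this form the two estimators differ only in
the covariate at which `h` is evaluated. -/
theorem est2_eq (hk : 1 ≤ k) (hkn : k ≤ n) (X' : Fin n → E d) (Y' : Fin n → ℝ)
    (Xs' : Fin m → E d) :
    est2 k h X' Y' Xs' = (m : ℝ)⁻¹ * ∑ j, (k : ℝ)⁻¹ * ∑ i,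
      nnIndicator k X' (Xs' j) i * h (X' i) (Y' i) := by
  have hn0 : (n : ℝ) ≠ 0 := by exact_mod_cast (by omega : n ≠ 0)
  have hM : ∀ i, (matchCount k X' Xs' (X' i) : ℝ) = ∑ j, nnIndicator k X' (Xs' j) i := by
    intro i
    rw [matchCount, Finset.card_filter]
    push_cast
    rfl
  rw [est2, ← Finset.mul_sum, Finset.sum_comm, Finset.mul_sum, Finset.mul_sum, Finset.mul_sum]
  refine Finset.sum_congr rfl fun i _ => ?_
  rw [← Finset.sum_mul, ← hM i]
  field_simp

end Estimators

end Matching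

end

/-! ### Assembly of the two bounds -/

theorem mainTheorem1 (d : ℕ) (hd : 1 ≤ d)
    (𝒳 : Set (Matching.E d))
    (P Q : Measure (Matching.E d)) [IsProbabilityMeasure P] [IsProbabilityMeasure Q]
    (hP𝒳 : P 𝒳ᶜ = 0) (hQ𝒳 : Q 𝒳ᶜ = 0)
    (κ : Kernel (Matching.E d) ℝ) [IsMarkovKernel κ]
    (h : Matching.E d → ℝ → ℝ) (hh : Measurable (Function.uncurry h))
    (hint : Integrable (Function.uncurry h) (P ⊗ₘ κ))
    (hX1 : IsCompact 𝒳)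
    (hX2 : Matching.BallVolume 𝒳)
    (p q : Matching.E d → ℝ)
    (hp : Matching.IsDensity P p) (hq : Matching.IsDensity Q q)
    (hpinf : ∃ pinf : ℝ, 0 < pinf ∧ ∀ x ∈ 𝒳, pinf ≤ p x)
    (hqsup : ∃ qsup : ℝ, 0 < qsup ∧ ∀ x ∈ 𝒳, q x ≤ qsup)
    (hX4 : ∃ K, LipschitzOnWith K (Matching.regr κ h) 𝒳)
    (hX5 : ∃ K, LipschitzOnWith K p 𝒳)
    (hA : Matching.GeomCondition 𝒳 Q) :
    (Matching.SmoothDelta 𝒳 κ h →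
      ∃ C : ℝ, ∀ (Ω : Type u) [MeasurableSpace Ω] (μ : Measure Ω) [IsProbabilityMeasure μ]
        (n m k : ℕ) (X : Fin n → Ω → Matching.E d) (Y : Fin n → Ω → ℝ)
        (Xs : Fin m → Ω → Matching.E d) (Yhat : Fin m → Ω → ℝ),
        1 ≤ k → k ≤ n → 1 ≤ m →
        Matching.IsSample μ P Q κ X Y Xs →
        Matching.IsLabels μ k X Y Xs Yhat →
        (∀ j, Integrable (fun ω => h (Xs j ω) (Yhat j ω)) μ) →
        Integrable (fun ω => (Matching.B1 Q κ h μ X Xs Yhat ω) ^ 2) μ ∧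
          ∫ ω, (Matching.B1 Q κ h μ X Xs Yhat ω) ^ 2 ∂μ ≤ C * ((k : ℝ) / ((n : ℝ) + 1)) ^ (min (4 / (d : ℝ)) 3)) ∧
    (Matching.SmoothRegr 𝒳 κ h →
      ∃ C : ℝ, ∀ (Ω : Type u) [MeasurableSpace Ω] (μ : Measure Ω) [IsProbabilityMeasure μ]
        (n m k : ℕ) (X : Fin n → Ω → Matching.E d) (Y : Fin n → Ω → ℝ)
        (Xs : Fin m → Ω → Matching.E d),
        1 ≤ k → k ≤ n → 1 ≤ m →
        Matching.IsSample μ P Q κ X Y Xs →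
        Integrable (fun ω => (Matching.B2 Q κ h μ k X Y Xs ω) ^ 2) μ ∧
          ∫ ω, (Matching.B2 Q κ h μ k X Y Xs ω) ^ 2 ∂μ ≤ C * ((k : ℝ) / ((n : ℝ) + 1)) ^ (min (4 / (d : ℝ)) 3)) := by
  have h𝒳m := hX1.measurableSet
  have hPac : P ≪ volume := by rw [hp.eq]; exact withDensity_absolutelyContinuous _ _
  obtain ⟨c, hc, hQP⟩ := Matching.exists_le_smul h𝒳m hQ𝒳 hp hq hpinf hqsup
  obtain ⟨hgint, hgmean⟩ := Matching.integrable_regr_and_targetMean_eq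
    (Matching.integrable_compProd_of_le_smul hint hc hQP)
  refine ⟨fun hD => ?_, fun hG => ?_⟩
  · obtain ⟨M, hM, hT⟩ := hD.exists_taylor
    have hΨm := Matching.measurable_Delta (κ := κ) hh
    have hΦ := Matching.isLocalIncrement_of_taylor h𝒳m hΨm hT
    obtain ⟨C, hC⟩ := Matching.exists_integral_sq_nnBias_le hd hP𝒳 hQ𝒳 hX1 hX2 hp hq hpinf hqsup
      hX5 hA hM hΦ
    have hΦD := hΦ.abs_le_diam hM hX1.isBounded
    refine ⟨C, fun Ω _ μ _ n m k X Y Xs Yhat hk hkn hm hS hL hYint => ?_⟩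
    refine hS.integral_sq_le_of_ae_eq hk hkn hΦ.measurable hΦD ?_ (hC n k hk hkn)
    unfold Matching.B1
    rw [hgmean]
    refine hS.condBias_ae_eq (H := fun _ x y => h x y) hd hk hkn hm hPac hP𝒳 hQ𝒳
      (hh.comp ((measurable_snd.comp measurable_fst).prodMk measurable_snd)) hΦ.measurable hΨm
      (fun x u => rfl) hΦD hgint (fun x hx u hu => ?_) (fun i j => ?_) ?_ fun A hA' => ?_
    · rw [indicator_of_mem (show (x, u) ∈ 𝒳 ×ˢ 𝒳 from ⟨hx, hu⟩)]
      exact (sub_add_cancel _ _).symm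
    · exact (hL.integral_eq hS hk hkn j (F := fun z y => h z.2 y)
        (hh.comp ((measurable_snd.comp measurable_fst).prodMk measurable_snd)) (hYint j)).1 i
    · exact (integrable_finsetSum _ fun j _ => hYint j).const_mul _
    · exact Matching.est1_setIntegral hS hL hk hkn hh hYint hA'
  · obtain ⟨M, hM, hT⟩ := hG.exists_taylor hX1
    -- Here `Ψ` ignores the target point, because the second estimator evaluates `h` at the source
    -- covariate; its increment is `g(u) - g(x)`.
    have hΨm : Measurable (Function.uncurry fun _ u : Matching.E d => Matching.regr κ h u) :=
      (Matching.measurable_regr hh).comp measurable_snd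
    have hΦ := Matching.isLocalIncrement_of_taylor h𝒳m hΨm hT
    obtain ⟨C, hC⟩ := Matching.exists_integral_sq_nnBias_le hd hP𝒳 hQ𝒳 hX1 hX2 hp hq hpinf hqsup
      hX5 hA hM hΦ
    have hΦD := hΦ.abs_le_diam hM hX1.isBounded
    refine ⟨C, fun Ω _ μ _ n m k X Y Xs hk hkn hm hS => ?_⟩
    have hterm : ∀ i j, Integrable (fun ω => Matching.nnIndicator k (fun l => X l ω) (Xs j ω) i *
        h (X i ω) (Y i ω)) μ := by
      intro i j
      have hXY : Measurable fun ω => (X i ω, Y i ω) :=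
        (hS.measurable_X i).prodMk (hS.measurable_Y i)
      -- For matched pairs integrability comes from the law of the sample, so no extra hypothesis is
      -- needed as for the generated labels.
      have h1 : Integrable (fun ω => h (X i ω) (Y i ω)) μ := by
        have h2 := hint
        rw [← hS.law_XY i, integrable_map_measure hh.aestronglyMeasurable hXY.aemeasurable] at h2
        exact h2
      have h3 := (Matching.measurable_nnIndicator (d := d) hk hkn i).comp
        (hS.measurable_X_pi.prodMk (hS.measurable_Xs j))
      exact h1.bdd_mul h3.aestronglyMeasurable (c := 1)
        (Filter.Eventually.of_forall fun ω => Matching.abs_nnIndicator_le_one _ _ _ _)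
    have hsum : ∀ j, Integrable (fun ω => (k : ℝ)⁻¹ * ∑ i, Matching.nnIndicator k
        (fun l => X l ω) (Xs j ω) i * h (X i ω) (Y i ω)) μ := fun j =>
      (integrable_finsetSum _ fun i _ => hterm i j).const_mul _
    refine hS.integral_sq_le_of_ae_eq hk hkn hΦ.measurable hΦD ?_ (hC n k hk hkn)
    unfold Matching.B2
    rw [hgmean]
    simp only [Matching.est2_eq hk hkn]
    refine hS.condBias_ae_eq (H := fun u _ y => h u y) hd hk hkn hm hPac hP𝒳 hQ𝒳
      (hh.comp ((measurable_fst.comp measurable_fst).prodMk measurable_snd)) hΦ.measurable hΨm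
      (fun x u => rfl) hΦD hgint (fun x hx u hu => ?_) hterm ?_ fun A hA' => ?_
    · rw [indicator_of_mem (show (x, u) ∈ 𝒳 ×ˢ 𝒳 from ⟨hx, hu⟩)]
      exact (sub_add_cancel _ _).symm
    · exact (integrable_finsetSum _ fun j _ => hsum j).const_mul _
    · rw [integral_const_mul, integral_finsetSum _ fun j _ => (hsum j).integrableOn]
      congr 1
      refine Finset.sum_congr rfl fun j _ => ?_
      rw [integral_const_mul, integral_finsetSum _ fun i _ => (hterm i j).integrableOn]
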